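/- **Setting.** A Jacobi matrix $J$ is given by bounded real sequences $a=(a_n)_{n\in\mathbb Z}$, $b=(b_n)_{n\in\mathbb Z}$ with $a_n>0$, and acts as the bounded self-adjoint operator $(Ju)_n=a_nu_{n+1}+a_{n-1}u_{n-1}+b_nu_n$ on $\ell^2(\mathbb Z)$; $\mathcal J$ is the set of all Jacobi matrices. For a bounded operator $X$ put $X_{jk}=\langle\delta_j,X\delta_k\rangle$. Let $\mathcal O$ be the additive group of entire functions $f:\mathbb C\to\mathbb C$ with $f(x)\in\mathbb R$ for $x\in\mathbb R$. The group $\mathbb Z$ acts on $\mathcal J$ by shifts: $n\cdot J$ has the coefficients $(a_{m+n},b_{m+n})_m$. *Toda flows.* For $f\in\mathcal O$ let $f(J)_a$ be the infinite matrix with elements $f(J)_{jk}$ for $j<k$, $-f(J)_{jk}$ for $j>k$ and $0$ for $j=k$, and let $X_f(J)$ be the tridiagonal matrix with $X_f(J)_{jk}=\big(f(J)_aJ-Jf(J)_a\big)_{jk}$ for $|j-k|\le1$ and $X_f(J)_{jk}=0$ otherwise. Let $J(t)$ be the solution of the Lax equation $\dot J=X_f(J)$, $J(0)=J$ (derivative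 in operator norm), and put $f\cdot J:=J(1)$. For $(f,n)\in G:=\mathcal O\times\mathbb Z$ put $(f,n)\cdot J:=f\cdot(n\cdot J)$. *Cocycles.* Let $\mathrm{SL}$ be the set of entire matrix functions $T:\mathbb C\to \mathrm{SL}(2,\mathbb C)$ with $T(x)\in \mathrm{SL}(2,\mathbb R)$ for $x\in\mathbb R$. Put $$A(J)(z)=\begin{pmatrix}\frac{z-b_1}{a_1}&\frac1{a_1}\\-a_1&0\end{pmatrix},$$ $T(n;J)=A((n-1)\cdot J)\cdots A(J)$ for $n\ge0$ and $T(n;J)=T(-n;n\cdot J)^{-1}$ for $n<0$. With $$g_n(z)=\big((J-z)^{-1}\big)_{nn},\qquad h_n(z)=2a_n\big((J-z)^{-1}\big)_{n+1,n}-1\qquad(|z|>\|J\|),$$ and with $[L]=\sum_{n\ge0}L_nz^n$ for a Laurent series $L=\sum_{n\in\mathbb Z} L_nz^n$ convergent for $|z|>\|J\|$, put $$B_f(J)=\begin{pmatrix}[fh_1]+f(J)_{11}-2(z-b_1)[fg_1]&-2[fg_1]\\2a_0^2[fg_0]&2(z-b_1)[fg_1]-[fh_1]-f(J)_{11}\end{pmatrix}.$$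 Let $T(t)=T(t;J)(z)$ solve $\dot T=B_f\big((tf)\cdot J\big)T$, $T(0)=1$, and put $T(f;J):=T(1)$. For $g=(f,n)\in G$ put $$T(g;J):=T(f;n\cdot J)\,T(n;J).$$ **Theorem.** For all $f\in\mathcal O$ and $J\in\mathcal J$, the Lax equation has a unique global solution $J(t)\in\mathcal J$ ($t\in\mathbb R$), it is given by $J(t)=(tf)\cdot J$, and the equation for $T(t)$ has a unique global solution, so that all of the above is well defined. The map $(g,J)\mapsto g\cdot J$ is an action of $G=\mathcal O\times\mathbb Z$ on $\mathcal J$, and $T$ is a cocycle for this action: $T(g;J)\in \mathrm{SL}$ for all $g\in G$, $J\in\mathcal J$, and $$T(gh;J)=T(g;h\cdot J)\,T(h;J)\qquad\text{for all }g,h\in G,\ J\in\mathcal J$$ ($gh$ denotes the product in $G$, that is, $(f,m)(k,n)=(f+k,m+n)$). In particular, for every $f\in\mathcal O$ and $J\in\mathcal J$, the zero curvature equation $$\frac{d}{dt}A\big((tf)\cdot J\big)\Big|_{t=0}=B_f(1\cdot J)\,A(J)-A(J)\,B_f(J)$$ holds, where $1\cdot J$ is the shifted Jacobi matrix. -/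

import Mathlib

noncomputable section

namespace Toda

/-- The complex Hilbert space `ℓ²(ℤ)`. -/
abbrev Hilb : Type := lp (fun _ : ℤ => ℂ) 2

/-- The standard unit vector `δ_n`. -/
def delta (n : ℤ) : Hilb := lp.single 2 n (1 : ℂ)

/-- The matrix element `X_{jk} = ⟨δ_j, X δ_k⟩` of a bounded operator. -/
def entry (X : Hilb →L[ℂ] Hilb) (j k : ℤ) : ℂ := inner ℂ (delta j) (X (delta k))

/-! ### Jacobi matrices -/

/-- The coefficients of a bounded Jacobi matrix: bounded real sequences `a, b` with `a_n > 0`. -/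
@[ext]
structure JacobiMatrix where
  a : ℤ → ℝ
  b : ℤ → ℝ
  a_pos : ∀ n, 0 < a n
  a_bdd : ∃ C, ∀ n, |a n| ≤ C
  b_bdd : ∃ C, ∀ n, |b n| ≤ C

theorem summable_weightedShift {c : ℤ → ℝ} {C : ℝ} (hC : ∀ n, |c n| ≤ C) (k : ℤ) (u : Hilb) :
    Summable (fun n => C ^ 2 * ‖u (n + k)‖ ^ 2) ∧
      ∀ n, ‖(c n : ℂ) * u (n + k)‖ ^ 2 ≤ C ^ 2 * ‖u (n + k)‖ ^ 2 := by
  have hu : Summable (fun n => ‖u n‖ ^ 2) := by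
    simpa using (lp.memℓp u).summable (by norm_num)
  refine ⟨((Equiv.addRight k).summable_iff.mpr hu).mul_left _, fun n => ?_⟩
  rw [norm_mul, mul_pow, Complex.norm_real, Real.norm_eq_abs]
  gcongr
  exact hC n

theorem memlp_weightedShift {c : ℤ → ℝ} (hc : ∃ C, ∀ n, |c n| ≤ C) (k : ℤ) (u : Hilb) :
    Memℓp (fun n => (c n : ℂ) * u (n + k)) 2 := by
  obtain ⟨C, hC⟩ := hc
  obtain ⟨h1, h2⟩ := summable_weightedShift hC k u
  refine memℓp_gen ?_
  simpa using Summable.of_nonneg_of_le (fun n => sq_nonneg _) h2 h1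

/-- The bounded operator `(X u)_n = c_n u_{n+k}` on `ℓ²(ℤ)`, for a bounded sequence `c`. -/
def weightedShift (c : ℤ → ℝ) (hc : ∃ C, ∀ n, |c n| ≤ C) (k : ℤ) : Hilb →L[ℂ] Hilb :=
  LinearMap.mkContinuousOfExistsBound
    { toFun := fun u => ⟨fun n => (c n : ℂ) * u (n + k), memlp_weightedShift hc k u⟩
      map_add' := fun u v => by
        ext n
        exact mul_add _ _ _
      map_smul' := fun r u => by
        ext n
        simp [mul_left_comm] }
    (by
      obtain ⟨C, hC⟩ := hc
      have hC0 : 0 ≤ C := (abs_nonneg _).trans (hC 0)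
      refine ⟨C, fun u => lp.norm_le_of_tsum_le (by norm_num) (by positivity) ?_⟩
      obtain ⟨h1, h2⟩ := summable_weightedShift hC k u
      have h3 := Summable.tsum_le_tsum h2 (Summable.of_nonneg_of_le (fun n => sq_nonneg _) h2 h1) h1
      have h4 := lp.norm_rpow_eq_tsum (p := 2) (by norm_num) u
      have h5 := (Equiv.addRight k).tsum_eq (fun n => ‖u n‖ ^ 2)
      simp only [ENNReal.toReal_ofNat, Real.rpow_ofNat] at h4
      simp only [Equiv.coe_addRight] at h5
      rw [tsum_mul_left, h5, ← h4, ← mul_pow] at h3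
      simpa using h3)

theorem weightedShift_apply (c : ℤ → ℝ) (hc : ∃ C, ∀ n, |c n| ≤ C) (k : ℤ) (u : Hilb) (n : ℤ) :
    weightedShift c hc k u n = (c n : ℂ) * u (n + k) := rfl

namespace JacobiMatrix

theorem shift_bdd {c : ℤ → ℝ} (hc : ∃ C, ∀ n, |c n| ≤ C) (k : ℤ) :
    ∃ C, ∀ n, |c (n + k)| ≤ C :=
  hc.imp fun _ h n => h (n + k)

/-- The bounded operator on `ℓ²(ℤ)` given by a Jacobi matrix. -/
def op (J : JacobiMatrix) : Hilb →L[ℂ] Hilb :=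
  weightedShift J.a J.a_bdd 1 + weightedShift (fun n => J.a (n + -1)) (shift_bdd J.a_bdd (-1)) (-1)
    + weightedShift J.b J.b_bdd 0

theorem op_apply (J : JacobiMatrix) (u : Hilb) (n : ℤ) :
    J.op u n = J.a n * u (n + 1) + J.a (n - 1) * u (n - 1) + J.b n * u n := by
  have h : J.op u n = weightedShift J.a J.a_bdd 1 u n
      + weightedShift (fun n => J.a (n + -1)) (shift_bdd J.a_bdd (-1)) (-1) u n
      + weightedShift J.b J.b_bdd 0 u n := rfl
  rw [h, weightedShift_apply, weightedShift_apply, weightedShift_apply]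
  simp [sub_eq_add_neg]

/-- The action of `ℤ` by shifts: `m · J` has the coefficients `a_{n+m}, b_{n+m}`. -/
def shift (m : ℤ) (J : JacobiMatrix) : JacobiMatrix where
  a n := J.a (n + m)
  b n := J.b (n + m)
  a_pos n := J.a_pos (n + m)
  a_bdd := shift_bdd J.a_bdd m
  b_bdd := shift_bdd J.b_bdd m

end JacobiMatrix

/-! ### Entire functions that are real on the real line, and the Toda flows -/

/-- The additive group (and real vector space) of the entire functions that are real on `ℝ`. -/
def RealEntire : Submodule ℝ (ℂ → ℂ) where
  carrier := {f | Differentiable ℂ f ∧ ∀ x : ℝ, (f x).im = 0}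
  zero_mem' := ⟨differentiable_const 0, fun x => by simp⟩
  add_mem' := fun {f g} hf hg => ⟨hf.1.add hg.1, fun x => by simp [hf.2 x, hg.2 x]⟩
  smul_mem' := fun c f hf => ⟨hf.1.const_smul c, fun x => by simp [hf.2 x]⟩

/-- `f(J)`, through the functional calculus of the self-adjoint operator `J`. -/
def funcCalc (f : RealEntire) (J : JacobiMatrix) : Hilb →L[ℂ] Hilb :=
  cfc (f : ℂ → ℂ) J.op

/-- The anti-symmetric part `f(J)_a`, as an infinite matrix. -/
def antiPart (f : RealEntire) (J : JacobiMatrix) (j k : ℤ) : ℂ :=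
  if j < k then entry (funcCalc f J) j k
  else if k < j then -entry (funcCalc f J) j k
  else 0

/-- The infinite tridiagonal matrix `X_f(J)`: its elements with `|j - k| ≤ 1` are those of the
commutator `[f(J)_a, J]` of infinite matrices (`J` is tridiagonal, so that the row times column
sums have at most three nonzero terms, which are the ones written here). -/
def laxMatrix (f : RealEntire) (J : JacobiMatrix) (j k : ℤ) : ℂ :=
  if |j - k| ≤ 1 then
    (∑ l ∈ Finset.Icc (k - 1) (k + 1), antiPart f J j l * entry J.op l k)
      - ∑ l ∈ Finset.Icc (j - 1) (j + 1), entry J.op j l * antiPart f J l k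
  else 0

/-- `γ` is a global solution of the Lax equation `dJ/dt = X_f(J)` with `γ 0 = J`; the time
derivative is taken with respect to the operator norm, and it is the bounded operator whose matrix
is `X_f(γ t)`. -/
structure IsLaxSolution (f : RealEntire) (J : JacobiMatrix) (γ : ℝ → JacobiMatrix) : Prop where
  initial : γ 0 = J
  lax : ∀ t : ℝ, ∃ D : Hilb →L[ℂ] Hilb,
    (∀ j k, entry D j k = laxMatrix f (γ t) j k) ∧ HasDerivAt (fun s => (γ s).op) D t

open Classical in
/-- `f · J`, the time one map of the Toda flow of `f` (with the convention `f · J = J` if there were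
no global solution). -/
def todaMap (f : RealEntire) (J : JacobiMatrix) : JacobiMatrix :=
  if h : ∃ γ, IsLaxSolution f J γ then h.choose 1 else J

/-- The action of `𝒪 × ℤ` on Jacobi matrices: `(f, n) · J = f · (n · J)`. -/
def act (g : RealEntire × ℤ) (J : JacobiMatrix) : JacobiMatrix :=
  todaMap g.1 (J.shift g.2)

/-! ### Matrix functions and cocycles -/

/-- Complex `2 × 2` matrix functions of the spectral parameter. -/
abbrev MatFun : Type := ℂ → Matrix (Fin 2) (Fin 2) ℂ

/-- The entire matrix functions `T : ℂ → SL(2, ℂ)` with `T(x) ∈ SL(2, ℝ)` for real `x`. -/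
def SLFun : Set MatFun :=
  {T | (∀ i j, Differentiable ℂ fun z => T z i j) ∧ (∀ z, (T z).det = 1) ∧
    ∀ (x : ℝ) (i j : Fin 2), (T x i j).im = 0}

/-- `ρ` is an action of the additive group `G` on `X`. -/
structure IsAction {G X : Type*} [AddGroup G] (ρ : G → X → X) : Prop where
  zero : ∀ x, ρ 0 x = x
  add : ∀ g h x, ρ (g + h) x = ρ g (ρ h x)

/-- `T` is a cocycle for the action `ρ`, with values in `SLFun`. -/
structure IsCocycle {G X : Type*} [AddGroup G] (ρ : G → X → X) (T : G → X → MatFun) : Prop where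
  mem : ∀ g x, T g x ∈ SLFun
  add : ∀ g h x z, T (g + h) x z = T g (ρ h x) z * T h x z

/-- The one step transfer matrix `A(J)`. -/
def stepMatrix (J : JacobiMatrix) : MatFun := fun z =>
  !![(z - J.b 1) / J.a 1, 1 / J.a 1; -J.a 1, 0]

/-- `A((n-1) · J) ⋯ A(1 · J) A(J)`. -/
def transferNat : ℕ → JacobiMatrix → MatFun
  | 0, _ => fun _ => 1
  | n + 1, J => fun z => stepMatrix (J.shift n) z * transferNat n J z

/-- The shift cocycle `T(n; J)`, with `T(n; J) = T(-n; n · J)⁻¹` for `n < 0`. -/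
def transfer (n : ℤ) (J : JacobiMatrix) : MatFun := fun z =>
  if 0 ≤ n then transferNat n.toNat J z else (transferNat (-n).toNat (J.shift n) z)⁻¹

/-! ### The matrix function `B` and the Toda cocycle -/

/-- The operator `(J - z)⁻¹`, for `z` in the resolvent set. -/
def green (J : JacobiMatrix) (z : ℂ) : Hilb →L[ℂ] Hilb :=
  Ring.inverse (J.op - algebraMap ℂ (Hilb →L[ℂ] Hilb) z)

/-- `g_n(z; J)`, the diagonal of `(J - z)⁻¹`. -/
def gFun (J : JacobiMatrix) (n : ℤ) (z : ℂ) : ℂ := entry (green J z) n n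

/-- `h_n(z; J)`, the diagonal of `2 a S (J - z)⁻¹ - 1`, where `(S u)_n = u_{n+1}`. -/
def hFun (J : JacobiMatrix) (n : ℤ) (z : ℂ) : ℂ := 2 * J.a n * entry (green J z) (n + 1) n - 1

/-- The coefficient of `z ^ n` in the Laurent series about `0` of a function `L` that is holomorphic
on an annulus containing the circle `|z| = R`. -/
def laurentCoeff (R : ℝ) (L : ℂ → ℂ) (n : ℕ) : ℂ :=
  (2 * Real.pi * Complex.I)⁻¹ * ∮ w in C(0, R), L w / w ^ (n + 1)

/-- The power series part `∑_{n ≥ 0} L_n z ^ n` of the Laurent series of `L`. -/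
def powerPart (R : ℝ) (L : ℂ → ℂ) (z : ℂ) : ℂ := ∑' n : ℕ, laurentCoeff R L n * z ^ n

/-- `[f g]_n`; the functions `f g_n` and `f h_n` are holomorphic on `|z| > ‖J‖`, and any
circle in this region gives the same Laurent coefficients. -/
def fg (f : RealEntire) (J : JacobiMatrix) (n : ℤ) : ℂ → ℂ :=
  powerPart (‖J.op‖ + 1) fun w => (f : ℂ → ℂ) w * gFun J n w

/-- `[f h]_n`. -/
def fh (f : RealEntire) (J : JacobiMatrix) (n : ℤ) : ℂ → ℂ :=
  powerPart (‖J.op‖ + 1) fun w => (f : ℂ → ℂ) w * hFun J n w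

/-- The matrix function `B_f(J)`. -/
def bMatrix (f : RealEntire) (J : JacobiMatrix) : MatFun := fun z =>
  !![fh f J 1 z + entry (funcCalc f J) 1 1 - 2 * (z - J.b 1) * fg f J 1 z, -2 * fg f J 1 z;
     2 * (J.a 0 ^ 2 * fg f J 0 z),
       2 * (z - J.b 1) * fg f J 1 z - fh f J 1 z - entry (funcCalc f J) 1 1]

/-- `T = T(t; J)` solves `dT/dt = B_f(t · J) T`, `T(0) = 1` along the Toda flow
`t · J = (t f) · J`, for every value of the spectral parameter. -/
structure IsTodaCocycleSolution (f : RealEntire) (J : JacobiMatrix) (T : ℝ → MatFun) : Prop where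
  initial : ∀ z, T 0 z = 1
  ode : ∀ (z : ℂ) (t : ℝ) (i j : Fin 2),
    HasDerivAt (fun s => T s z i j) ((bMatrix f (todaMap (t • f) J) z * T t z) i j) t

open Classical in
/-- The individual Toda cocycle `T(f; J)`: the solution of the equation above, evaluated at `t = 1`
(with the convention `T(f; J) = 1` if there were no solution). -/
def todaCocycle (f : RealEntire) (J : JacobiMatrix) : MatFun :=
  if h : ∃ T, IsTodaCocycleSolution f J T then h.choose 1 else fun _ => 1

/-- `T(g; J) = T(f; n · J) T(n; J)` for `g = (f, n)`. -/
def jointCocycle (g : RealEntire × ℤ) (J : JacobiMatrix) : MatFun := fun z =>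
  todaCocycle g.1 (J.shift g.2) z * transfer g.2 J z

end Toda

end

/-!
The Jacobi matrices sit in the Banach space `Coeffs` of pairs of bounded real sequences, on which
the Lax equation for `f` becomes the differential equation `x' = field c x`, where `c` are the
Taylor coefficients of `f` at `0` (`isLaxSolution_iff`); functions of the operator are norm
convergent power series (`cfc_eq_psum`). The vector fields are continuously differentiable and
Lipschitz on balls. The anti-symmetric part of `f(J)` is a bounded skew-adjoint operator, because
the matrix elements of `f(J)` decay exponentially off the diagonal, so the flow is isospectral and
the operator norm is conserved (`RealRapid.norm_conserved`). This a priori bound gives global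
existence (`Tame.exists_global`), and Gronwall's inequality gives uniqueness.

The matrix `B_f(J)(z)` is expressed by matrix elements of `q(J)`, where
`q(x) = (f(x) - f(z)) / (x - z)`: the Laurent coefficients of `f g_n` and `f h_n` are computed from
the Neumann series of the resolvent (`powerPart_eq`, `bMatrix_eq`). As `f(J) = f(z) + (J - z) q(J)`
and `q(J)` commutes with `J`, what remains are identities between finitely many matrix elements.
There are two of them.

* Two flows: the vector fields of the joint system `x' = field c x`, `T' = bMat c z x * T` commute
  for different functions (`RealRapid.fderiv_extField_comm`). The first component says that the
  Toda fields commute; the second one is the zero curvature equation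
  `RealRapid.bMatDeriv_add_mul`, which comes from Green's identity, a summation by parts
  (`RealRapid.lieEntry_div`). For commuting fields the composition of the two flows at equal times
  is the flow of the sum (`Tame.hasDerivAt_flow_comp`), and the flow depends linearly on `f` through
  the field; this gives at once the action law and the cocycle law for `f + k`.
* A flow and the shift: the derivative of `A(J)` is `B(1 · J) A(J) - A(J) B(J)`
  (`RealRapid.hasDerivAt_stepMat`). Hence `A(J(t)) T(t; J)` and `T(t; 1 · J) A(J)` solve the same
  linear equation and agree (`fund_mul_stepMat`).

The cocycle law on `𝒪 × ℤ` follows from these two and from the one for the transfer matrices. The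
matrices `T` have determinant one because `B` is traceless, they are real for real `z` because `B`
is, and they are entire in `z` by variation of constants and dominated convergence
(`differentiable_fund_one`).
-/

open Set Metric Filter Topology
open scoped NNReal

noncomputable section

namespace Toda

/-! ### Global solutions and commuting flows of ordinary differential equations -/

section ODE

variable {E F G : Type*} [NormedAddCommGroup E] [NormedSpace ℝ E]
  [NormedAddCommGroup F] [NormedSpace ℝ F] [NormedAddCommGroup G] [NormedSpace ℝ G]

/-- A continuously differentiable map between normed spaces that is Lipschitz on every ball. In
infinite dimensions the second property does not follow from the first one. -/
structure Tame (v : E → F) : Prop where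
  contDiff : ContDiff ℝ 1 v
  lipschitz : ∀ R : ℝ, ∃ K : ℝ≥0, LipschitzOnWith K v (closedBall 0 R)

theorem Tame.exists_bound {v : E → F} (hv : Tame v) (R : ℝ) :
    ∃ C : ℝ, 0 ≤ C ∧ ∀ x, ‖x‖ ≤ R → ‖v x‖ ≤ C := by
  obtain ⟨K, hK⟩ := hv.lipschitz (max R 0)
  refine ⟨‖v 0‖ + K * max R 0, by positivity, fun x hx => ?_⟩
  have h1 : ‖v x - v 0‖ ≤ K * ‖x - 0‖ := by
    simpa [dist_eq_norm] using hK.dist_le_mul x (by simp [hx]) 0 (by simp)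
  rw [sub_zero] at h1
  have h2 : (K : ℝ) * ‖x‖ ≤ K * max R 0 := by
    gcongr
    exact hx.trans (le_max_left _ _)
  calc ‖v x‖ = ‖v 0 + (v x - v 0)‖ := by simp
    _ ≤ ‖v 0‖ + ‖v x - v 0‖ := norm_add_le _ _
    _ ≤ _ := by linarith

theorem Tame.const (c : F) : Tame (fun _ : E => c) :=
  ⟨contDiff_const, fun _ => ⟨0, (LipschitzWith.const c).lipschitzOnWith⟩⟩

theorem Tame.clm (A : E →L[ℝ] F) : Tame (fun x => A x) :=
  ⟨A.contDiff, fun _ => ⟨‖A‖₊, A.lipschitz.lipschitzOnWith⟩⟩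

theorem Tame.comp {v : F → G} {u : E → F} (hv : Tame v) (hu : Tame u) :
    Tame (fun x => v (u x)) := by
  refine ⟨hv.contDiff.comp hu.contDiff, fun R => ?_⟩
  obtain ⟨C, hC0, hC⟩ := hu.exists_bound R
  obtain ⟨K, hK⟩ := hu.lipschitz R
  obtain ⟨K', hK'⟩ := hv.lipschitz C
  refine ⟨K' * K, hK'.comp hK fun x hx => ?_⟩
  simpa using hC x (by simpa using hx)

theorem Tame.prodMk {v : E → F} {u : E → G} (hv : Tame v) (hu : Tame u) :
    Tame (fun x => (v x, u x)) := by
  refine ⟨hv.contDiff.prodMk hu.contDiff, fun R => ?_⟩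
  obtain ⟨K, hK⟩ := hv.lipschitz R
  obtain ⟨K', hK'⟩ := hu.lipschitz R
  exact ⟨max K K', hK.prodMk hK'⟩

theorem Tame.bilin {H : Type*} [NormedAddCommGroup H] [NormedSpace ℝ H]
    (B : F →L[ℝ] G →L[ℝ] H) {v : E → F} {u : E → G} (hv : Tame v) (hu : Tame u) :
    Tame (fun x => B (v x) (u x)) := by
  refine ⟨(B.isBoundedBilinearMap.contDiff (n := 1)).comp (hv.contDiff.prodMk hu.contDiff),
    fun R => ?_⟩
  obtain ⟨C, hC0, hC⟩ := hv.exists_bound R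
  obtain ⟨C', hC'0, hC'⟩ := hu.exists_bound R
  obtain ⟨K, hK⟩ := hv.lipschitz R
  obtain ⟨K', hK'⟩ := hu.lipschitz R
  refine ⟨‖B‖₊ * K * C'.toNNReal + ‖B‖₊ * C.toNNReal * K', LipschitzOnWith.of_dist_le_mul ?_⟩
  intro x hx y hy
  have h1 := hK.dist_le_mul x hx y hy
  have h2 := hK'.dist_le_mul x hx y hy
  rw [dist_eq_norm] at h1 h2 ⊢
  have h3 : B (v x) (u x) - B (v y) (u y) = B (v x - v y) (u x) + B (v y) (u x - u y) := by
    simp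
  rw [h3]
  have h4 : ‖B (v x - v y) (u x)‖ ≤ ‖B‖ * (K * dist x y) * C' :=
    (B.le_opNorm₂ _ _).trans (by gcongr; exact hC' x (by simpa using hx))
  have h5 : ‖B (v y) (u x - u y)‖ ≤ ‖B‖ * C * (K' * dist x y) :=
    (B.le_opNorm₂ _ _).trans (by gcongr; exact hC y (by simpa using hy))
  refine (norm_add_le _ _).trans ((add_le_add h4 h5).trans_eq ?_)
  push_cast
  rw [Real.coe_toNNReal _ hC0, Real.coe_toNNReal _ hC'0]
  ring

theorem Tame.add {v u : E → F} (hv : Tame v) (hu : Tame u) : Tame (fun x => v x + u x) :=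
  (Tame.clm (ContinuousLinearMap.fst ℝ F F + ContinuousLinearMap.snd ℝ F F)).comp
    (hv.prodMk hu)

theorem Tame.sub {v u : E → F} (hv : Tame v) (hu : Tame u) : Tame (fun x => v x - u x) :=
  (Tame.clm (ContinuousLinearMap.fst ℝ F F - ContinuousLinearMap.snd ℝ F F)).comp
    (hv.prodMk hu)

theorem Tame.neg {v : E → F} (hv : Tame v) : Tame (fun x => -v x) :=
  (Tame.clm (-ContinuousLinearMap.id ℝ F)).comp hv

theorem Tame.mul {A : Type*} [NormedRing A] [NormedAlgebra ℝ A] {v u : E → A} (hv : Tame v)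
    (hu : Tame u) : Tame (fun x => v x * u x) :=
  Tame.bilin (ContinuousLinearMap.mul ℝ A) hv hu

theorem Tame.differentiable {v : E → F} (hv : Tame v) : Differentiable ℝ v :=
  hv.contDiff.differentiable (by norm_num)

theorem Tame.unique_Ioo {v : E → E} (hv : Tame v) {T : ℝ} {x y : ℝ → E}
    (hx : ∀ t ∈ Ioo (-T) T, HasDerivAt x (v (x t)) t)
    (hy : ∀ t ∈ Ioo (-T) T, HasDerivAt y (v (y t)) t) (h0 : x 0 = y 0) :
    ∀ t ∈ Ioo (-T) T, x t = y t := by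
  intro t ht
  obtain ⟨T', hT1, hT2⟩ := exists_between (abs_lt.mpr ht)
  have hsub : Icc (-T') T' ⊆ Ioo (-T) T := fun s hs => ⟨by linarith [hs.1], by linarith [hs.2]⟩
  obtain ⟨R1, hR1⟩ := isCompact_Icc.exists_bound_of_continuousOn (f := x) (s := Icc (-T') T')
    fun s hs => (hx s (hsub hs)).continuousAt.continuousWithinAt
  obtain ⟨R2, hR2⟩ := isCompact_Icc.exists_bound_of_continuousOn (f := y) (s := Icc (-T') T')
    fun s hs => (hy s (hsub hs)).continuousAt.continuousWithinAt
  obtain ⟨K, hK⟩ := hv.lipschitz (max R1 R2)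
  refine ODE_solution_unique_of_mem_Ioo (v := fun _ => v) (s := fun _ => closedBall 0 (max R1 R2))
    (K := K) (t₀ := 0) (a := -T') (b := T') (fun _ _ => hK) ?_ ?_ ?_ h0 (abs_lt.mp hT1)
  · have := abs_nonneg t
    constructor <;> linarith
  · intro s hs
    have hs' := Ioo_subset_Icc_self hs
    exact ⟨hx s (hsub hs'), by simpa using Or.inl (hR1 s hs')⟩
  · intro s hs
    have hs' := Ioo_subset_Icc_self hs
    exact ⟨hy s (hsub hs'), by simpa using Or.inr (hR2 s hs')⟩

theorem Tame.unique {v : E → E} (hv : Tame v) {x y : ℝ → E} (hx : ∀ t, HasDerivAt x (v (x t)) t)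
    (hy : ∀ t, HasDerivAt y (v (y t)) t) (h0 : x 0 = y 0) : x = y := by
  ext t
  refine hv.unique_Ioo (T := |t| + 1) (fun s _ => hx s) (fun s _ => hy s) h0 t ?_
  exact abs_lt.mp (by linarith)

/-- Gronwall's inequality for a linearly bounded derivative, in both time directions. -/
theorem norm_le_of_norm_deriv_le {x x' : ℝ → E} {K T : ℝ}
    (hx : ∀ t ∈ Icc (-T) T, HasDerivWithinAt x (x' t) (Icc (-T) T) t)
    (hb : ∀ t ∈ Icc (-T) T, ‖x' t‖ ≤ K * ‖x t‖) :
    ∀ t ∈ Icc (-T) T, ‖x t‖ ≤ ‖x 0‖ * Real.exp (K * |t|) := by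
  have key : ∀ (y y' : ℝ → E), (∀ t ∈ Icc (-T) T, HasDerivWithinAt y (y' t) (Icc (-T) T) t) →
      (∀ t ∈ Icc (-T) T, ‖y' t‖ ≤ K * ‖y t‖) → ∀ t ∈ Icc 0 T,
      ‖y t‖ ≤ ‖y 0‖ * Real.exp (K * t) := by
    intro y y' hy hyb t ht
    have hsub : Icc 0 T ⊆ Icc (-T) T := fun s hs => ⟨by linarith [hs.1, hs.2], hs.2⟩
    have := norm_le_gronwallBound_of_norm_deriv_right_le (f := y) (f' := y') (δ := ‖y 0‖) (K := K)
      (ε := 0) (a := 0) (b := T)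
      (fun s hs => ((hy s (hsub hs)).mono hsub).continuousWithinAt)
      (fun s hs => by
        have hs' := hsub (Ico_subset_Icc_self hs)
        have h1 : Icc (-T) T ∈ 𝓝[≥] s :=
          mem_of_superset (Icc_mem_nhdsGE hs.2) (Icc_subset_Icc_left hs'.1)
        exact (hy s hs').mono_of_mem_nhdsWithin h1)
      le_rfl (fun s hs => by simpa using hyb s (hsub (Ico_subset_Icc_self hs))) t ht
    simpa [gronwallBound_ε0] using this
  intro t ht
  rcases le_total 0 t with h | h
  · rw [abs_of_nonneg h]
    exact key x x' hx hb t ⟨h, ht.2⟩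
  · rw [abs_of_nonpos h]
    have hneg : MapsTo (fun s : ℝ => -s) (Icc (-T) T) (Icc (-T) T) := fun s hs =>
      ⟨by linarith [hs.2], by linarith [hs.1]⟩
    have := key (fun s => x (-s)) (fun s => -x' (-s)) (fun s hs => by
      have h1 := (hx (-s) (hneg hs)).scomp s ((hasDerivAt_neg s).hasDerivWithinAt) hneg
      simpa using! h1) (fun s hs => by simpa using hb (-s) (hneg hs)) (-t)
      ⟨by linarith, by linarith [ht.1]⟩
    simpa using this

/-- A tame vector field has a global integral curve through `x₀` if the integral curves of all its
cut-offs `χ • v` satisfy an a priori bound: for the cut-off to a large ball the Picard–Lindelöf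
theorem applies on a prescribed time interval, and by the bound its solution never leaves the region
where `χ = 1`. -/
theorem Tame.exists_global [CompleteSpace E] {v : E → E} (hv : Tame v) (x₀ : E)
    (hb : ∀ T > 0, ∃ R, ∀ (χ : E → ℝ) (x : ℝ → E), (∀ p, 0 ≤ χ p ∧ χ p ≤ 1) → x 0 = x₀ →
      (∀ t ∈ Icc (-T) T, HasDerivWithinAt x (χ (x t) • v (x t)) (Icc (-T) T) t) →
      ∀ t ∈ Icc (-T) T, ‖x t‖ ≤ R) :
    ∃ x : ℝ → E, x 0 = x₀ ∧ ∀ t, HasDerivAt x (v (x t)) t := by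
  have local_sol : ∀ T > 0, ∃ x : ℝ → E, x 0 = x₀ ∧
      ∀ t ∈ Ioo (-T) T, HasDerivAt x (v (x t)) t := by
    intro T hT
    obtain ⟨R, hR⟩ := hb T hT
    let χ : E → ℝ := fun p => max 0 (min 1 (R + 1 - ‖p‖))
    have hχ : ∀ p, 0 ≤ χ p ∧ χ p ≤ 1 := fun p =>
      ⟨le_max_left _ _, max_le zero_le_one (min_le_left _ _)⟩
    have hχ1 : ∀ p, ‖p‖ ≤ R → χ p = 1 := fun p hp => by
      have : min 1 (R + 1 - ‖p‖) = 1 := min_eq_left (by linarith)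
      simp [χ, this]
    have hχ0 : ∀ p, R + 1 ≤ ‖p‖ → χ p = 0 := fun p hp =>
      max_eq_left ((min_le_right _ _).trans (by linarith))
    have hχL : LipschitzWith 1 χ := by
      have h1 : LipschitzWith 1 (fun p : E => R + 1 - ‖p‖) := by
        refine LipschitzWith.of_dist_le_mul fun p q => ?_
        rw [Real.dist_eq, dist_eq_norm, NNReal.coe_one, one_mul]
        have : R + 1 - ‖p‖ - (R + 1 - ‖q‖) = -(‖p‖ - ‖q‖) := by ring
        rw [this, abs_neg]
        exact abs_norm_sub_norm_le p q
      exact (h1.const_min 1).const_max 0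
    obtain ⟨C, hC0, hC⟩ := hv.exists_bound (R + 1)
    have hwb : ∀ p, ‖χ p • v p‖ ≤ C := by
      intro p
      rcases le_total ‖p‖ (R + 1) with h | h
      · rw [norm_smul, Real.norm_eq_abs, abs_of_nonneg (hχ p).1]
        calc χ p * ‖v p‖ ≤ 1 * ‖v p‖ := by gcongr; exact (hχ p).2
          _ ≤ C := by simpa using hC p h
      · simp [hχ0 p h, hC0]
    obtain ⟨K, hK⟩ := hv.lipschitz (‖x₀‖ + C * T)
    obtain ⟨C', hC'0, hC'⟩ := hv.exists_bound (‖x₀‖ + C * T)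
    have hball : ∀ p ∈ closedBall x₀ (C * T), ‖p‖ ≤ ‖x₀‖ + C * T := by
      intro p hp
      rw [mem_closedBall, dist_eq_norm] at hp
      calc ‖p‖ = ‖x₀ + (p - x₀)‖ := by simp
        _ ≤ _ := (norm_add_le _ _).trans (by linarith)
    have hw : LipschitzOnWith (C'.toNNReal + K) (fun p => χ p • v p) (closedBall x₀ (C * T)) := by
      refine LipschitzOnWith.of_dist_le_mul fun p hp q hq => ?_
      have h1 := hK.dist_le_mul p (by simpa using hball p hp) q (by simpa using hball q hq)
      have h2 := hχL.dist_le_mul p q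
      rw [dist_eq_norm] at h1 h2 ⊢
      have h3 : χ p • v p - χ q • v q = (χ p - χ q) • v p + χ q • (v p - v q) := by
        rw [sub_smul, smul_sub]; abel
      rw [h3]
      have h4 : ‖(χ p - χ q) • v p‖ ≤ dist p q * C' := by
        rw [norm_smul]
        gcongr
        · simpa using h2
        · exact hC' p (hball p hp)
      have h5 : ‖χ q • (v p - v q)‖ ≤ 1 * (K * dist p q) := by
        rw [norm_smul, Real.norm_eq_abs, abs_of_nonneg (hχ q).1]
        gcongr
        exact (hχ q).2
      refine (norm_add_le _ _).trans ((add_le_add h4 h5).trans_eq ?_)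
      push_cast
      rw [Real.coe_toNNReal _ hC'0]
      ring
    have hT0 : (0 : ℝ) ∈ Icc (-T) T := ⟨by linarith, hT.le⟩
    have hCT : 0 ≤ C * T := by positivity
    -- The cut-off field is bounded by `C` everywhere, so a ball of radius `C * T` is large enough for
    -- the time interval `[-T, T]`.
    have hPL : IsPicardLindelof (fun _ p => χ p • v p) (⟨0, hT0⟩ : Icc (-T) T) x₀
        (C * T).toNNReal 0 C.toNNReal (C'.toNNReal + K) :=
      { lipschitzOnWith := fun _ _ => by rwa [Real.coe_toNNReal _ hCT]
        continuousOn := fun _ _ => continuousOn_const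
        norm_le := fun _ _ p _ => by rw [Real.coe_toNNReal _ hC0]; exact hwb p
        mul_max_le := by
          rw [Real.coe_toNNReal _ hCT, Real.coe_toNNReal _ hC0]
          simp }
    obtain ⟨x, hx0, hx⟩ := hPL.exists_eq_forall_mem_Icc_hasDerivWithinAt₀
    refine ⟨x, hx0, fun t ht => ?_⟩
    have ht' := Ioo_subset_Icc_self ht
    have h1 := hx t ht'
    rw [hχ1 _ (hR χ x hχ hx0 hx t ht'), one_smul] at h1
    exact h1.hasDerivAt (Icc_mem_nhds ht.1 ht.2)
  choose! sol hsol0 hsol using local_sol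
  -- The solutions on different intervals agree by uniqueness.
  refine ⟨fun t => sol (|t| + 1) t, hsol0 _ (by positivity), fun t => ?_⟩
  have hpos : 0 < |t| + 2 := by positivity
  have hev : (fun s => sol (|s| + 1) s) =ᶠ[𝓝 t] sol (|t| + 2) := by
    have : ∀ᶠ s in 𝓝 t, |s| < |t| + 1 :=
      continuous_abs.continuousAt.eventually_lt continuousAt_const (by linarith)
    filter_upwards [this] with s hs
    have hpos' : 0 < |s| + 1 := by positivity
    refine hv.unique_Ioo (T := |s| + 1) (hsol _ hpos') (fun r hr => hsol _ hpos r ?_)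
      (by rw [hsol0 _ hpos', hsol0 _ hpos]) s (abs_lt.mp (by linarith))
    have := abs_lt.mpr hr
    exact abs_lt.mp (by linarith)
  have h1 := hsol _ hpos t (abs_lt.mp (by linarith))
  rw [← hev.eq_of_nhds] at h1
  exact h1.congr_of_eventuallyEq hev

theorem gronwallBound_mul (η K s : ℝ) :
    gronwallBound η K η s = η * gronwallBound 1 K 1 s := by
  unfold gronwallBound
  split_ifs <;> ring

/-- First order expansion of a flow in the direction of a commuting vector field `Y`: the curve
`s ↦ Φ s p + h • Y (Φ s p)` solves the equation of `X` up to an error `o(h)`. -/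
theorem Tame.flow_expansion {X Y : E → E} (hX : Tame X) (hY : Tame Y)
    (comm : ∀ p, fderiv ℝ X p (Y p) = fderiv ℝ Y p (X p)) {Φ : ℝ → E → E}
    (h0 : ∀ p, Φ 0 p = p) (hΦ : ∀ p s, HasDerivAt (fun s => Φ s p) (X (Φ s p)) s)
    (hb : ∀ R S, ∃ R', ∀ p, ‖p‖ ≤ R → ∀ s, |s| ≤ S → ‖Φ s p‖ ≤ R')
    {q : ℝ → E} {p : E} (hq0 : q 0 = p) (hq : HasDerivAt q (Y p) 0) (S : ℝ) {ε : ℝ} (hε : 0 < ε) :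
    ∀ᶠ h in 𝓝 (0 : ℝ), ∀ s ∈ Icc 0 S, ‖Φ s (q h) - Φ s p - h • Y (Φ s p)‖ ≤ ε * |h| := by
  set x : ℝ → E := fun s => Φ s p with hx
  obtain ⟨R', hR'⟩ := hb (‖p‖ + 1) S
  obtain ⟨C, hC0, hC⟩ := hY.exists_bound R'
  obtain ⟨K, hK⟩ := hX.lipschitz (R' + C)
  have hxc : Continuous x := continuous_iff_continuousAt.mpr fun s => (hΦ p s).continuousAt
  have hxR : ∀ s ∈ Icc 0 S, ‖x s‖ ≤ R' := fun s hs =>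
    hR' p (by linarith) s (abs_le.mpr ⟨by linarith [hs.1, hs.2], hs.2⟩)
  set g := gronwallBound 1 K 1 S with hg
  have hg0 : 0 ≤ |g| := abs_nonneg _
  set η := ε / (|g| + 1) with hη
  have hη0 : 0 < η := by positivity
  -- The derivative of `X` is an approximation that is uniform along the compact orbit.
  have unif : ∀ᶠ h in 𝓝 (0 : ℝ), ∀ s ∈ Icc 0 S,
      ‖X (x s + h • Y (x s)) - X (x s) - h • fderiv ℝ X (x s) (Y (x s))‖ ≤ η * |h| := by
    have key : ∀ s ∈ Icc 0 S, ∀ᶠ z : ℝ × ℝ in 𝓝 (0 : ℝ) ×ˢ 𝓝 s, z.2 ∈ Icc 0 S →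
        ‖X (x z.2 + z.1 • Y (x z.2)) - X (x z.2) - z.1 • fderiv ℝ X (x z.2) (Y (x z.2))‖
          ≤ η * |z.1| := by
      intro s hs
      set c := η / (2 * C + 1) with hc
      have hc0 : 0 < c := by positivity
      have hst := (hX.contDiff.contDiffAt (x := x s)).hasStrictFDerivAt (by norm_num)
      have h1 := (hst.isLittleO.def hc0)
      have hcont : Tendsto (fun z : ℝ × ℝ => (x z.2 + z.1 • Y (x z.2), x z.2))
          (𝓝 (0, s)) (𝓝 (x s, x s)) := by
        have : Continuous fun z : ℝ × ℝ => (x z.2 + z.1 • Y (x z.2), x z.2) := by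
          have := hY.contDiff.continuous
          fun_prop
        have h2 := this.tendsto (0, s)
        simpa using h2
      have h2 := hcont.eventually h1
      have h3 : ∀ᶠ z : ℝ × ℝ in 𝓝 (0, s), ‖fderiv ℝ X (x z.2) - fderiv ℝ X (x s)‖ < c := by
        have : Continuous fun z : ℝ × ℝ => ‖fderiv ℝ X (x z.2) - fderiv ℝ X (x s)‖ := by
          have := hX.contDiff.continuous_fderiv (by norm_num)
          fun_prop
        exact this.continuousAt.eventually_lt continuousAt_const (by simpa using hc0)
      rw [← nhds_prod_eq]
      filter_upwards [h2, h3] with z hz2 hz3 hz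
      have hYb := hC _ (hxR _ hz)
      simp only [add_sub_cancel_left, map_smul] at hz2
      have e : X (x z.2 + z.1 • Y (x z.2)) - X (x z.2) - z.1 • fderiv ℝ X (x z.2) (Y (x z.2))
          = (X (x z.2 + z.1 • Y (x z.2)) - X (x z.2) - z.1 • fderiv ℝ X (x s) (Y (x z.2)))
            - z.1 • (fderiv ℝ X (x z.2) - fderiv ℝ X (x s)) (Y (x z.2)) := by
        simp [smul_sub]
      rw [e]
      have b1 : c * ‖z.1 • Y (x z.2)‖ ≤ c * (|z.1| * C) := by
        rw [norm_smul, Real.norm_eq_abs]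
        gcongr
      have b2 : ‖z.1 • (fderiv ℝ X (x z.2) - fderiv ℝ X (x s)) (Y (x z.2))‖ ≤ |z.1| * (c * C) := by
        rw [norm_smul, Real.norm_eq_abs]
        gcongr
        exact (ContinuousLinearMap.le_opNorm _ _).trans (by gcongr)
      refine (norm_sub_le _ _).trans ((add_le_add (hz2.trans b1) b2).trans ?_)
      have : c * (2 * C + 1) = η := by rw [hc]; field_simp
      nlinarith [abs_nonneg z.1]
    have h4 := isCompact_Icc.eventually_forall_of_forall_eventually (x₀ := (0 : ℝ))
      (P := fun h s => s ∈ Icc 0 S → ‖X (x s + h • Y (x s)) - X (x s)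
        - h • fderiv ℝ X (x s) (Y (x s))‖ ≤ η * |h|) (K := Icc 0 S)
      (fun s hs => by rw [nhds_prod_eq]; exact key s hs)
    filter_upwards [h4] with h hh s hs using hh s hs hs
  have e1 : ∀ᶠ h in 𝓝 (0 : ℝ), ‖q h‖ ≤ ‖p‖ + 1 := by
    have := hq.continuousAt.norm.eventually_lt continuousAt_const
      (show ‖q 0‖ < ‖p‖ + 1 by rw [hq0]; linarith)
    filter_upwards [this] with h hh using hh.le
  have e2 : ∀ᶠ h in 𝓝 (0 : ℝ), ‖q h - p - h • Y p‖ ≤ η * |h| := by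
    have := (hasDerivAt_iff_isLittleO_nhds_zero.mp hq).def hη0
    simpa [hq0] using this
  have e3 : ∀ᶠ h in 𝓝 (0 : ℝ), |h| < 1 :=
    continuous_abs.continuousAt.eventually_lt continuousAt_const (by simp)
  filter_upwards [unif, e1, e2, e3] with h hu h1 h2 h3 s hs
  have hYd : ∀ s, HasDerivAt (fun s => x s + h • Y (x s))
      (X (x s) + h • fderiv ℝ Y (x s) (X (x s))) s := fun s =>
    (hΦ p s).add (((hY.differentiable (x s)).hasFDerivAt.comp_hasDerivAt s (hΦ p s)).const_smul h)
  have bound := dist_le_of_approx_trajectories_ODE_of_mem (v := fun _ => X)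
    (s := fun _ => closedBall 0 (R' + C)) (K := K) (a := 0) (b := S) (δ := η * |h|) (εf := 0)
    (εg := η * |h|) (f := fun s => Φ s (q h)) (g := fun s => x s + h • Y (x s))
    (fun _ _ => hK) (fun s _ => (hΦ (q h) s).continuousAt.continuousWithinAt)
    (fun s _ => (hΦ (q h) s).hasDerivWithinAt) (fun s _ => by simp)
    (fun s hs => by
      have := hR' (q h) h1 s (abs_le.mpr ⟨by linarith [hs.1, hs.2], hs.2.le⟩)
      simpa using this.trans (by linarith))
    (fun s _ => (hYd s).continuousAt.continuousWithinAt)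
    (fun s _ => (hYd s).hasDerivWithinAt)
    (fun s hs => by
      have := hu s (Ico_subset_Icc_self hs)
      -- By commutation `Y (x s)` solves the linearized equation.
      rw [comm] at this
      rw [dist_eq_norm, norm_sub_rev, ← sub_sub]
      exact this)
    (fun s hs => by
      have h4 := hxR s (Ico_subset_Icc_self hs)
      have h5 := hC _ h4
      have : ‖h • Y (x s)‖ ≤ 1 * C := by
        rw [norm_smul, Real.norm_eq_abs]
        gcongr
      simpa using (norm_add_le _ _).trans (add_le_add h4 (by simpa using this)))
    (by
      simp only [hx, h0]
      rw [dist_eq_norm, ← sub_sub]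
      exact h2) s hs
  rw [dist_eq_norm, zero_add, sub_zero, gronwallBound_mul] at bound
  have e4 : Φ s (q h) - x s - h • Y (x s) = Φ s (q h) - (x s + h • Y (x s)) := by abel
  rw [e4]
  refine bound.trans ?_
  have m1 : gronwallBound 1 K 1 s ≤ |g| :=
    (gronwallBound_mono zero_le_one zero_le_one K.2 hs.2).trans (le_abs_self _)
  have m2 : η * |g| ≤ ε := by
    rw [hη, div_mul_eq_mul_div, div_le_iff₀ (by positivity)]
    nlinarith
  calc η * |h| * gronwallBound 1 K 1 s ≤ η * |h| * |g| := by gcongr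
    _ = (η * |g|) * |h| := by ring
    _ ≤ ε * |h| := by gcongr

/-- If the vector fields `X` and `Y` commute, then flowing along the integral curves of `Y` and of
`X` for the same time is an integral curve of `X + Y`. -/
theorem Tame.hasDerivAt_flow_comp {X Y : E → E} (hX : Tame X) (hY : Tame Y)
    (comm : ∀ p, fderiv ℝ X p (Y p) = fderiv ℝ Y p (X p)) {Φ : ℝ → E → E}
    (h0 : ∀ p, Φ 0 p = p) (hΦ : ∀ p s, HasDerivAt (fun s => Φ s p) (X (Φ s p)) s)
    (hb : ∀ R S, ∃ R', ∀ p, ‖p‖ ≤ R → ∀ s, |s| ≤ S → ‖Φ s p‖ ≤ R')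
    {y : ℝ → E} (hy : ∀ t, HasDerivAt y (Y (y t)) t) (t : ℝ) :
    HasDerivAt (fun t => Φ t (y t)) (X (Φ t (y t)) + Y (Φ t (y t))) t := by
  rw [hasDerivAt_iff_isLittleO_nhds_zero, Asymptotics.isLittleO_iff]
  intro ε hε
  have hq0 : (fun h => y (t + h)) 0 = y t := by simp
  have hq : HasDerivAt (fun h => y (t + h)) (Y (y t)) 0 := by
    have := hy t
    exact HasDerivAt.comp_const_add t 0 (by simpa using hy t)
  have hneg : ∀ p, fderiv ℝ (fun x => -X x) p (Y p) = fderiv ℝ Y p (-X p) := fun p => by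
    rw [fderiv_fun_neg, map_neg, ← comm]
    rfl
  have f1 := hX.flow_expansion hY comm h0 hΦ hb hq0 hq (|t| + 1) (ε := ε / 3) (by positivity)
  -- Negative times are covered by the reversed flow, the one of `-X`.
  have f2 := hX.neg.flow_expansion hY hneg (Φ := fun s p => Φ (-s) p) (by simpa using h0)
    (fun p s => by simpa using! (hΦ p (-s)).scomp s (hasDerivAt_neg s))
    (fun R S => (hb R S).imp fun R' h p hp s hs => h p hp (-s) (by simpa using hs))
    hq0 hq (|t| + 1) (ε := ε / 3) (by positivity)
  have f3 := (hasDerivAt_iff_isLittleO_nhds_zero.mp (hΦ (y t) t)).def (c := ε / 3) (by positivity)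
  have f4 : ∀ᶠ h in 𝓝 (0 : ℝ), ‖Y (Φ (t + h) (y t)) - Y (Φ t (y t))‖ < ε / 3 := by
    have : Continuous fun h => ‖Y (Φ (t + h) (y t)) - Y (Φ t (y t))‖ := by
      have h1 := hY.contDiff.continuous
      have h2 : Continuous fun s => Φ s (y t) :=
        continuous_iff_continuousAt.mpr fun s => (hΦ _ s).continuousAt
      have h3 : Continuous fun h => Φ (t + h) (y t) := h2.comp (by fun_prop)
      fun_prop
    exact this.continuousAt.eventually_lt continuousAt_const (by simpa using hε)
  have f5 : ∀ᶠ h in 𝓝 (0 : ℝ), |t + h| < |t| + 1 := by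
    have : Continuous fun h => |t + h| := by fun_prop
    exact this.continuousAt.eventually_lt continuousAt_const (by simp)
  filter_upwards [f1, f2, f3, f4, f5] with h h1 h2 h3 h4 h5
  have h6 : ‖Φ (t + h) (y (t + h)) - Φ (t + h) (y t) - h • Y (Φ (t + h) (y t))‖
      ≤ ε / 3 * |h| := by
    rcases le_total 0 (t + h) with hs | hs
    · exact h1 (t + h) ⟨hs, (le_abs_self _).trans h5.le⟩
    · have := h2 (-(t + h)) ⟨by linarith, (neg_le_abs _).trans h5.le⟩
      simpa only [neg_neg] using this
  have e : Φ (t + h) (y (t + h)) - Φ t (y t) - h • (X (Φ t (y t)) + Y (Φ t (y t)))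
      = (Φ (t + h) (y (t + h)) - Φ (t + h) (y t) - h • Y (Φ (t + h) (y t)))
        + (Φ (t + h) (y t) - Φ t (y t) - h • X (Φ t (y t)))
        + h • (Y (Φ (t + h) (y t)) - Y (Φ t (y t))) := by
    rw [smul_add, smul_sub]; abel
  rw [e]
  have h7 : ‖h • (Y (Φ (t + h) (y t)) - Y (Φ t (y t)))‖ ≤ |h| * (ε / 3) := by
    rw [norm_smul, Real.norm_eq_abs]
    gcongr
  refine (norm_add₃_le).trans ((add_le_add (add_le_add h6 h3) h7).trans_eq ?_)
  rw [Real.norm_eq_abs]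
  ring

end ODE

/-! ### Matrix elements of bounded operators -/

open BoundedContinuousFunction

/-- The bounded operators on `ℓ²(ℤ)`. -/
abbrev Op : Type := Hilb →L[ℂ] Hilb

theorem delta_apply (n m : ℤ) : (delta n : ℤ → ℂ) m = if m = n then 1 else 0 := by
  rw [delta, lp.single_apply, Pi.single_apply]

theorem norm_delta (n : ℤ) : ‖delta n‖ = 1 := by
  rw [delta, lp.norm_single (by norm_num)]
  simp

theorem inner_delta (n : ℤ) (u : Hilb) : inner ℂ (delta n) u = u n := by
  rw [delta, lp.inner_single_left]
  simp

theorem entry_eq (X : Op) (j k : ℤ) : entry X j k = X (delta k) j := inner_delta _ _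

theorem norm_entry_le (X : Op) (j k : ℤ) : ‖entry X j k‖ ≤ ‖X‖ := by
  refine (norm_inner_le_norm _ _).trans ?_
  rw [norm_delta, one_mul]
  simpa [norm_delta] using X.le_opNorm (delta k)

/-- The matrix element as a continuous linear functional. -/
def entryL (j k : ℤ) : Op →L[ℂ] ℂ :=
  LinearMap.mkContinuous
    { toFun := fun X => entry X j k
      map_add' := fun X Y => by simp [entry]
      map_smul' := fun c X => by simp [entry] } 1
    (fun X => (norm_entry_le X j k).trans_eq (one_mul _).symm)

@[simp]
theorem entryL_apply (j k : ℤ) (X : Op) : entryL j k X = entry X j k := rfl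

theorem entry_add (X Y : Op) (j k : ℤ) : entry (X + Y) j k = entry X j k + entry Y j k :=
  map_add (entryL j k) X Y

theorem entry_sub (X Y : Op) (j k : ℤ) : entry (X - Y) j k = entry X j k - entry Y j k :=
  map_sub (entryL j k) X Y

theorem entry_neg (X : Op) (j k : ℤ) : entry (-X) j k = -entry X j k :=
  map_neg (entryL j k) X

theorem entry_smul (c : ℂ) (X : Op) (j k : ℤ) : entry (c • X) j k = c * entry X j k :=
  map_smul (entryL j k) c X

theorem entry_one (j k : ℤ) : entry (1 : Op) j k = if j = k then 1 else 0 := by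
  rw [entry_eq]
  exact delta_apply k j

theorem hasSum_delta (u : Hilb) : HasSum (fun k => u k • delta k) u := by
  have := lp.hasSum_single (E := fun _ : ℤ => ℂ) (p := 2) (by norm_num) u
  convert this using 2 with k
  ext n
  simp only [delta, lp.coeFn_smul, Pi.smul_apply, lp.single_apply, Pi.single_apply]
  split_ifs <;> simp

theorem hasSum_apply (A : Op) (u : Hilb) (j : ℤ) :
    HasSum (fun k => entry A j k * u k) (A u j) := by
  have h := ((innerSL ℂ (delta j)).comp A).hasSum (hasSum_delta u)
  simp only [ContinuousLinearMap.comp_apply, innerSL_apply_apply, map_smul, smul_eq_mul,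
    inner_delta] at h
  have e : (fun k => entry A j k * u k) = fun k => u k * A (delta k) j := by
    funext k
    rw [entry_eq, mul_comm]
  rw [e]
  exact h

theorem entry_ext {A B : Op} (h : ∀ j k, entry A j k = entry B j k) : A = B := by
  ext u j
  have h1 := hasSum_apply A u j
  simp only [h] at h1
  exact h1.unique (hasSum_apply B u j)

theorem hasSum_entry_mul (A B : Op) (j k : ℤ) :
    HasSum (fun l => entry A j l * entry B l k) (entry (A * B) j k) := by
  have := hasSum_apply A (B (delta k)) j
  rw [entry_eq (A * B) j k]
  simp only [← entry_eq B] at this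
  exact this

theorem entry_star (A : Op) (j k : ℤ) : entry (star A) j k = star (entry A k j) := by
  rw [entry, entry, ContinuousLinearMap.star_eq_adjoint, ContinuousLinearMap.adjoint_inner_right,
    ← inner_conj_symm]
  rfl

theorem norm_weightedShift_le {c : ℤ → ℝ} (hc : ∃ C, ∀ n, |c n| ≤ C) {C : ℝ}
    (hC : ∀ n, |c n| ≤ C) (k : ℤ) : ‖weightedShift c hc k‖ ≤ C := by
  have hC0 : 0 ≤ C := (abs_nonneg _).trans (hC 0)
  refine ContinuousLinearMap.opNorm_le_bound _ hC0 fun u =>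
    lp.norm_le_of_tsum_le (by norm_num) (by positivity) ?_
  obtain ⟨h1, h2⟩ := summable_weightedShift hC k u
  have h3 := Summable.tsum_le_tsum h2 (Summable.of_nonneg_of_le (fun n => sq_nonneg _) h2 h1) h1
  have h4 := lp.norm_rpow_eq_tsum (p := 2) (by norm_num) u
  have h5 := (Equiv.addRight k).tsum_eq (fun n => ‖u n‖ ^ 2)
  simp only [ENNReal.toReal_ofNat, Real.rpow_ofNat] at h4
  simp only [Equiv.coe_addRight] at h5
  rw [tsum_mul_left, h5, ← h4, ← mul_pow] at h3
  simpa [weightedShift_apply] using h3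

theorem entry_weightedShift (c : ℤ → ℝ) (hc : ∃ C, ∀ n, |c n| ≤ C) (k i j : ℤ) :
    entry (weightedShift c hc k) i j = if i + k = j then (c i : ℂ) else 0 := by
  rw [entry_eq, weightedShift_apply, delta_apply]
  split_ifs <;> simp

/-! ### The Banach space of coefficients -/

/-- The bounded real sequences. -/
abbrev Seq : Type := ℤ →ᵇ ℝ

/-- A family of uniformly bounded functionals, as a map into the bounded sequences. -/
def toSeqL {W : Type*} [NormedAddCommGroup W] [NormedSpace ℝ W] (φ : ℤ → W →L[ℝ] ℝ)
    (h : ∀ n, ‖φ n‖ ≤ 1) : W →L[ℝ] Seq :=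
  LinearMap.mkContinuous
    { toFun := fun w => ofNormedAddCommGroupDiscrete (fun n => φ n w) ‖w‖
        fun n => ((φ n).le_opNorm w).trans (mul_le_of_le_one_left (norm_nonneg w) (h n))
      map_add' := fun v w => by ext n; simp
      map_smul' := fun c w => by ext n; simp } 1
    (fun w => by
      rw [one_mul]
      exact norm_ofNormedAddCommGroup_le (by fun_prop) (norm_nonneg w) fun n =>
        ((φ n).le_opNorm w).trans (mul_le_of_le_one_left (norm_nonneg w) (h n)))

@[simp]
theorem toSeqL_apply {W : Type*} [NormedAddCommGroup W] [NormedSpace ℝ W] (φ : ℤ → W →L[ℝ] ℝ)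
    (h : ∀ n, ‖φ n‖ ≤ 1) (w : W) (n : ℤ) : toSeqL φ h w n = φ n w := rfl

/-- The evaluation of a bounded sequence at `n`. -/
def evalL (n : ℤ) : Seq →L[ℝ] ℝ := evalCLM ℝ n

@[simp]
theorem evalL_apply (n : ℤ) (c : Seq) : evalL n c = c n := rfl

theorem norm_evalL_le (n : ℤ) : ‖evalL n‖ ≤ 1 :=
  ContinuousLinearMap.opNorm_le_bound _ zero_le_one fun c => by simpa using c.norm_coe_le_norm n

/-- The translation `c ↦ (c_{n+k})_n` of bounded sequences. -/
def translL (k : ℤ) : Seq →L[ℝ] Seq := toSeqL (fun n => evalL (n + k)) fun _ => norm_evalL_le _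

@[simp]
theorem translL_apply (k : ℤ) (c : Seq) (n : ℤ) : translL k c n = c (n + k) := rfl

/-- The real part of the matrix element, as a real linear functional. -/
def reEntryL (j k : ℤ) : Op →L[ℝ] ℝ :=
  Complex.reCLM.comp ((entryL j k).restrictScalars ℝ)

@[simp]
theorem reEntryL_apply (j k : ℤ) (X : Op) : reEntryL j k X = (entry X j k).re := rfl

theorem norm_reEntryL_le (j k : ℤ) : ‖reEntryL j k‖ ≤ 1 :=
  ContinuousLinearMap.opNorm_le_bound _ zero_le_one fun X => by
    simpa using (Complex.abs_re_le_norm _).trans (norm_entry_le X j k)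

/-- The (real part of the) `d`-th diagonal `(X_{n,n+d})_n` of an operator. -/
def diagL (d : ℤ) : Op →L[ℝ] Seq :=
  toSeqL (fun n => reEntryL n (n + d)) fun _ => norm_reEntryL_le _ _

@[simp]
theorem diagL_apply (d : ℤ) (X : Op) (n : ℤ) : diagL d X n = (entry X n (n + d)).re := rfl

theorem seq_bdd (c : Seq) : ∃ C, ∀ n, |c n| ≤ C := ⟨‖c‖, fun n => c.norm_coe_le_norm n⟩

/-- The weighted shift as a function of its weight. -/
def wshiftL (k : ℤ) : Seq →L[ℝ] Op :=
  LinearMap.mkContinuous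
    { toFun := fun c => weightedShift c (seq_bdd c) k
      map_add' := fun c d => by
        ext u n
        rw [_root_.add_apply, lp.coeFn_add, Pi.add_apply]
        simp only [weightedShift_apply, BoundedContinuousFunction.add_apply]
        push_cast
        ring
      map_smul' := fun r c => by
        ext u n
        rw [RingHom.id_apply, _root_.smul_apply, lp.coeFn_smul, Pi.smul_apply]
        simp only [weightedShift_apply, BoundedContinuousFunction.smul_apply, Complex.real_smul,
          smul_eq_mul]
        push_cast
        ring } 1
    (fun c => by
      rw [one_mul]
      exact norm_weightedShift_le (seq_bdd c) (fun n => c.norm_coe_le_norm n) k)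

theorem norm_wshiftL_le (k : ℤ) (c : Seq) : ‖wshiftL k c‖ ≤ ‖c‖ :=
  norm_weightedShift_le (seq_bdd c) (fun n => c.norm_coe_le_norm n) k

theorem entry_wshiftL (k : ℤ) (c : Seq) (i j : ℤ) :
    entry (wshiftL k c) i j = if i + k = j then (c i : ℂ) else 0 :=
  entry_weightedShift c (seq_bdd c) k i j

/-- The Banach space of the coefficients `(a, b)` of Jacobi matrices; the sign of `a` is not
restricted, so that this is a linear space. -/
abbrev Coeffs : Type := Seq × Seq

/-- The tridiagonal operator with given coefficients. -/
def opL : Coeffs →L[ℝ] Op :=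
  (wshiftL 1).comp (ContinuousLinearMap.fst ℝ Seq Seq)
    + (wshiftL (-1)).comp ((translL (-1)).comp (ContinuousLinearMap.fst ℝ Seq Seq))
    + (wshiftL 0).comp (ContinuousLinearMap.snd ℝ Seq Seq)

theorem opL_apply (x : Coeffs) (u : Hilb) (n : ℤ) :
    opL x u n = x.1 n * u (n + 1) + x.1 (n - 1) * u (n - 1) + x.2 n * u n := by
  have h : opL x u n = weightedShift x.1 (seq_bdd x.1) 1 u n
      + weightedShift (translL (-1) x.1) (seq_bdd _) (-1) u n
      + weightedShift x.2 (seq_bdd x.2) 0 u n := rfl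
  rw [h, weightedShift_apply, weightedShift_apply, weightedShift_apply]
  simp [sub_eq_add_neg]

theorem opL_delta (x : Coeffs) (k : ℤ) :
    opL x (delta k) = (x.1 (k - 1) : ℂ) • delta (k - 1) + (x.2 k : ℂ) • delta k
      + (x.1 k : ℂ) • delta (k + 1) := by
  ext n
  rw [opL_apply]
  simp only [lp.coeFn_add, lp.coeFn_smul, Pi.add_apply, Pi.smul_apply, delta_apply, smul_eq_mul]
  have e1 : n + 1 = k ↔ n = k - 1 := by omega
  have e2 : n - 1 = k ↔ n = k + 1 := by omega
  simp only [e1, e2]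
  by_cases h : n = k - 1
  · subst h
    have e3 : k - 1 ≠ k + 1 := by omega
    simp [e3]
  by_cases h' : n = k
  · subst h'
    simp [h]
  by_cases h'' : n = k + 1
  · subst h''
    simp [h]
  · simp [h, h', h'']

theorem entry_mul_opL (M : Op) (x : Coeffs) (j k : ℤ) :
    entry (M * opL x) j k
      = x.1 (k - 1) * entry M j (k - 1) + x.2 k * entry M j k + x.1 k * entry M j (k + 1) := by
  rw [entry_eq, mul_apply_eq_comp, opL_delta]
  simp only [map_add, map_smul, lp.coeFn_add, lp.coeFn_smul, Pi.add_apply, Pi.smul_apply,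
    smul_eq_mul, entry_eq]

theorem entry_opL_mul (M : Op) (x : Coeffs) (j k : ℤ) :
    entry (opL x * M) j k
      = x.1 j * entry M (j + 1) k + x.1 (j - 1) * entry M (j - 1) k + x.2 j * entry M j k := by
  rw [entry_eq, mul_apply_eq_comp, opL_apply]
  simp only [entry_eq]

theorem entry_opL (x : Coeffs) (j k : ℤ) :
    entry (opL x) j k
      = if k = j + 1 then (x.1 j : ℂ) else if k = j - 1 then (x.1 (j - 1) : ℂ)
        else if k = j then (x.2 j : ℂ) else 0 := by
  have := entry_opL_mul 1 x j k
  rw [mul_one] at this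
  rw [this]
  simp only [entry_one]
  by_cases h : k = j + 1
  · subst h
    have e1 : j - 1 ≠ j + 1 := by omega
    simp [e1]
  by_cases h' : k = j - 1
  · subst h'
    have e1 : j + 1 ≠ j - 1 := by omega
    have e2 : j - 1 ≠ j + 1 := by omega
    have e3 : j ≠ j - 1 := by omega
    simp [e1, e2, e3]
  by_cases h'' : k = j
  · subst h''
    have e1 : k ≠ k - 1 := by omega
    have e2 : k - 1 ≠ k := by omega
    simp [e1, e2]
  · have e1 : j + 1 ≠ k := by omega
    have e2 : j - 1 ≠ k := by omega
    have e3 : j ≠ k := by omega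
    simp [h, h', h'', e1, e2, e3]

theorem star_opL (x : Coeffs) : star (opL x) = opL x := by
  refine entry_ext fun j k => ?_
  rw [entry_star, entry_opL, entry_opL]
  by_cases h : k = j + 1
  · subst h
    have e1 : j ≠ j + 1 + 1 := by omega
    simp [e1]
  by_cases h' : k = j - 1
  · subst h'
    have e2 : j - 1 ≠ j + 1 := by omega
    simp [e2]
  by_cases h'' : k = j
  · subst h''
    have e1 : k ≠ k - 1 := by omega
    simp [e1]
  · have e1 : j ≠ k + 1 := by omega
    have e2 : j ≠ k - 1 := by omega
    have e3 : j ≠ k := by omega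
    simp [h, h', h'', e1, e2, e3]

theorem isSelfAdjoint_opL (x : Coeffs) : IsSelfAdjoint (opL x) := star_opL x

/-- The coefficients of a tridiagonal operator: a left inverse of `opL`. -/
def coeffsL : Op →L[ℝ] Coeffs := (diagL 1).prod (diagL 0)

theorem coeffsL_opL (x : Coeffs) : coeffsL (opL x) = x := by
  refine Prod.ext ?_ ?_ <;> ext n
  · change (entry (opL x) n (n + 1)).re = _
    simp [entry_opL]
  · change (entry (opL x) n (n + 0)).re = _
    have e1 : n ≠ n - 1 := by omega
    simp [entry_opL, e1]

theorem norm_le_norm_opL (x : Coeffs) : ‖x‖ ≤ ‖opL x‖ := by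
  have h : ∀ d : ℤ, ‖diagL d (opL x)‖ ≤ ‖opL x‖ := fun d => by
    refine (norm_le (norm_nonneg _)).mpr fun n => ?_
    simpa using (Complex.abs_re_le_norm _).trans (norm_entry_le (opL x) n (n + d))
  have e := coeffsL_opL x
  refine max_le ?_ ?_
  · exact (congrArg (fun y => ‖y.1‖) e).symm.trans_le (h 1)
  · exact (congrArg (fun y => ‖y.2‖) e).symm.trans_le (h 0)

namespace JacobiMatrix

/-- The coefficients of a Jacobi matrix, as a point of the Banach space `Coeffs`. -/
def toCoeffs (J : JacobiMatrix) : Coeffs :=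
  (ofNormedAddCommGroupDiscrete J.a J.a_bdd.choose J.a_bdd.choose_spec,
    ofNormedAddCommGroupDiscrete J.b J.b_bdd.choose J.b_bdd.choose_spec)

@[simp]
theorem toCoeffs_fst (J : JacobiMatrix) (n : ℤ) : J.toCoeffs.1 n = J.a n := rfl

@[simp]
theorem toCoeffs_snd (J : JacobiMatrix) (n : ℤ) : J.toCoeffs.2 n = J.b n := rfl

theorem op_eq (J : JacobiMatrix) : J.op = opL J.toCoeffs := by
  ext u n
  rw [op_apply, opL_apply]
  rfl

/-- The Jacobi matrix with given coefficients. -/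
def ofCoeffs (x : Coeffs) (h : ∀ n, 0 < x.1 n) : JacobiMatrix where
  a := x.1
  b := x.2
  a_pos := h
  a_bdd := seq_bdd x.1
  b_bdd := seq_bdd x.2

theorem toCoeffs_injective : Function.Injective toCoeffs := fun J J' h => by
  ext n
  · exact congrArg (fun x : Coeffs => x.1 n) h
  · exact congrArg (fun x : Coeffs => x.2 n) h

end JacobiMatrix

/-! ### Entire functions of an element of a Banach algebra -/

theorem hasSum_of_eq {ι A : Type*} [AddCommMonoid A] [TopologicalSpace A] {f g : ι → A} {a : A}
    (h : HasSum f a) (e : ∀ n, f n = g n) : HasSum g a := by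
  rwa [← funext e]

/-- The Taylor coefficients at `0` of entire functions are those sequences whose products with all
geometric sequences are bounded. -/
def RapidDecay (c : ℕ → ℂ) : Prop := ∀ r : ℝ, 0 ≤ r → ∃ C, ∀ n, ‖c n‖ * r ^ n ≤ C

/-- A bound `C 2⁻ⁿ` in place of `C` is gained by doubling `r`. -/
theorem RapidDecay.exists_le {c : ℕ → ℂ} (hc : RapidDecay c) {r : ℝ} (hr : 0 ≤ r) :
    ∃ C, 0 ≤ C ∧ ∀ n, ‖c n‖ * r ^ n ≤ C * (1 / 2) ^ n := by
  obtain ⟨C, hC⟩ := hc (2 * r) (by positivity)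
  refine ⟨C, (by positivity : 0 ≤ ‖c 0‖ * (2 * r) ^ 0).trans (hC 0), fun n => ?_⟩
  have h2 : (2 : ℝ) ^ n * (1 / 2) ^ n = 1 := by rw [← mul_pow]; norm_num
  calc ‖c n‖ * r ^ n = (‖c n‖ * (2 * r) ^ n) * (1 / 2) ^ n := by
        rw [mul_pow]; linear_combination (-‖c n‖ * r ^ n) * h2
    _ ≤ C * (1 / 2) ^ n := by gcongr; exact hC n

theorem summable_half (C : ℝ) : Summable fun n : ℕ => C * (1 / 2 : ℝ) ^ n :=
  (summable_geometric_of_lt_one (by norm_num) (by norm_num)).mul_left C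

theorem RapidDecay.summable {c : ℕ → ℂ} (hc : RapidDecay c) {r : ℝ} (hr : 0 ≤ r) :
    Summable fun n => ‖c n‖ * r ^ n := by
  obtain ⟨C, _, hC⟩ := hc.exists_le hr
  exact Summable.of_nonneg_of_le (fun n => by positivity) hC (summable_half C)

/-- The Taylor coefficients of `f` at `0`. -/
def taylorCoeff (f : ℂ → ℂ) (n : ℕ) : ℂ := (n.factorial : ℂ)⁻¹ * iteratedDeriv n f 0

section Algebra

variable {A : Type*} [NormedRing A] [NormedAlgebra ℂ A]

/-- The sum of the power series with coefficients `c` at an element of a Banach algebra. -/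
def psum (c : ℕ → ℂ) (M : A) : A := ∑' n, c n • M ^ n

theorem hasSum_taylorCoeff {f : ℂ → ℂ} (hf : Differentiable ℂ f) (z : ℂ) :
    HasSum (fun n => taylorCoeff f n • z ^ n) (f z) := by
  have h := Complex.hasSum_taylorSeries_of_entire hf 0 z
  refine hasSum_of_eq h fun n => ?_
  rw [sub_zero, taylorCoeff]
  simp only [smul_eq_mul]
  ring

theorem psum_taylorCoeff {f : ℂ → ℂ} (hf : Differentiable ℂ f) (z : ℂ) :
    psum (taylorCoeff f) z = f z :=
  (hasSum_taylorCoeff hf z).tsum_eq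

theorem rapidDecay_taylorCoeff {f : ℂ → ℂ} (hf : Differentiable ℂ f) :
    RapidDecay (taylorCoeff f) := by
  intro r hr
  have h := ((hasSum_taylorCoeff hf (r : ℂ)).summable.tendsto_atTop_zero).norm.bddAbove_range
  obtain ⟨C, hC⟩ := h
  refine ⟨C, fun n => ?_⟩
  have := hC (mem_range_self n)
  simpa [abs_of_nonneg hr] using this

variable [NormOneClass A]

theorem norm_smul_pow_le (c : ℕ → ℂ) {M : A} {r : ℝ} (hM : ‖M‖ ≤ r) (n : ℕ) :
    ‖c n • M ^ n‖ ≤ ‖c n‖ * r ^ n := by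
  rw [norm_smul]
  gcongr
  exact (norm_pow_le M n).trans (by gcongr)

variable [CompleteSpace A]

theorem RapidDecay.hasSum {c : ℕ → ℂ} (hc : RapidDecay c) (M : A) :
    HasSum (fun n => c n • M ^ n) (psum c M) :=
  (Summable.of_norm_bounded (hc.summable (norm_nonneg M))
    (norm_smul_pow_le c le_rfl)).hasSum

theorem norm_pow_sub_pow_le {A : Type*} [NormedRing A] [NormOneClass A] {M N : A} {r : ℝ}
    (hr : 1 ≤ r) (hM : ‖M‖ ≤ r)
    (hN : ‖N‖ ≤ r) (n : ℕ) : ‖M ^ n - N ^ n‖ ≤ (2 * r) ^ n * ‖M - N‖ := by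
  induction n with
  | zero => simp
  | succ n ih =>
    have e : M ^ (n + 1) - N ^ (n + 1) = M ^ n * (M - N) + (M ^ n - N ^ n) * N := by
      rw [pow_succ, pow_succ]; noncomm_ring
    have h1 : ‖M ^ n * (M - N)‖ ≤ (2 * r) ^ n * r * ‖M - N‖ := by
      refine (norm_mul_le _ _).trans ?_
      gcongr
      calc ‖M ^ n‖ ≤ r ^ n := (norm_pow_le M n).trans (by gcongr)
        _ ≤ (2 * r) ^ n := by gcongr; linarith
        _ ≤ (2 * r) ^ n * r := le_mul_of_one_le_right (by positivity) hr
    have h2 : ‖(M ^ n - N ^ n) * N‖ ≤ (2 * r) ^ n * ‖M - N‖ * r :=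
      (norm_mul_le _ _).trans (by gcongr)
    rw [e]
    refine (norm_add_le _ _).trans ((add_le_add h1 h2).trans_eq ?_)
    ring

/-- An entire function of an element of a Banach algebra is a tame map. -/
theorem RapidDecay.tame {c : ℕ → ℂ} (hc : RapidDecay c) : Tame (psum c : A → A) := by
  constructor
  · have hrad : (FormalMultilinearSeries.ofScalars A c).radius = ⊤ := by
      refine FormalMultilinearSeries.radius_eq_top_of_summable_norm _ fun r => ?_
      simpa [FormalMultilinearSeries.ofScalars_norm] using hc.summable r.2
    have h := FormalMultilinearSeries.hasFPowerSeriesOnBall (FormalMultilinearSeries.ofScalars A c)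
      (by rw [hrad]; exact ENNReal.coe_lt_top)
    have e : (FormalMultilinearSeries.ofScalars A c).sum = psum c :=
      FormalMultilinearSeries.ofScalarsSum_eq_tsum (E := A) c
    rw [hrad, e] at h
    have h2 := h.analyticOnNhd
    rw [Metric.eball_top] at h2
    exact (h2.contDiff (n := 1)).restrict_scalars ℝ
  · intro R
    set r := max R 1
    have hr : 1 ≤ r := le_max_right _ _
    have hs := hc.summable (r := 2 * r) (by positivity)
    have hS : 0 ≤ ∑' n, ‖c n‖ * (2 * r) ^ n := tsum_nonneg fun n => by positivity
    refine ⟨(∑' n, ‖c n‖ * (2 * r) ^ n).toNNReal, LipschitzOnWith.of_dist_le_mul ?_⟩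
    intro M hM N hN
    have hM' : ‖M‖ ≤ r := le_max_of_le_left (by simpa using hM)
    have hN' : ‖N‖ ≤ r := le_max_of_le_left (by simpa using hN)
    rw [Real.coe_toNNReal _ hS, dist_eq_norm, dist_eq_norm, ← tsum_mul_right]
    have h1 := (hc.hasSum M).sub (hc.hasSum N)
    rw [← h1.tsum_eq]
    refine tsum_of_norm_bounded (hs.mul_right _).hasSum fun n => ?_
    rw [← smul_sub, norm_smul, mul_assoc]
    gcongr
    exact norm_pow_sub_pow_le hr hM' hN' n

theorem RapidDecay.psum_conj {c : ℕ → ℂ} (hc : RapidDecay c) {U V : A} (hUV : U * V = 1)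
    (hVU : V * U = 1) (M : A) : psum c (U * M * V) = U * psum c M * V := by
  have e : ∀ n, (U * M * V) ^ n = U * M ^ n * V := by
    intro n
    induction n with
    | zero => simp [hUV]
    | succ n ih =>
      rw [pow_succ, ih, pow_succ]
      calc U * M ^ n * V * (U * M * V) = U * M ^ n * (V * U) * M * V := by noncomm_ring
        _ = _ := by rw [hVU]; noncomm_ring
  refine HasSum.unique (hc.hasSum _) ?_
  refine hasSum_of_eq (((hc.hasSum M).mul_left U).mul_right V) fun n => ?_
  rw [e, mul_smul_comm, smul_mul_assoc]

theorem RapidDecay.commute {c : ℕ → ℂ} (hc : RapidDecay c) {M N : A} (h : Commute M N) :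
    Commute (psum c M) N := by
  refine HasSum.unique ((hc.hasSum M).mul_right N) ?_
  refine hasSum_of_eq ((hc.hasSum M).mul_left N) fun n => ?_
  rw [smul_mul_assoc, mul_smul_comm, (h.pow_left n).eq]

theorem hasDerivAt_exp_conj {A : Type*} [NormedRing A] [NormedAlgebra ℂ A] [CompleteSpace A]
    (L M : A) :
    HasDerivAt (fun t : ℝ => NormedSpace.exp (t • L) * M * NormedSpace.exp (t • -L))
      (L * M - M * L) 0 := by
  have h1 := hasDerivAt_exp_smul_const (𝕂 := ℝ) L 0
  have h2 := hasDerivAt_exp_smul_const (𝕂 := ℝ) (-L) 0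
  have h := (h1.mul_const M).mul h2
  simp only [zero_smul, NormedSpace.exp_zero, one_mul, mul_one] at h
  rwa [mul_neg, ← sub_eq_add_neg] at h

theorem exp_mul_exp_neg {A : Type*} [NormedRing A] [NormedAlgebra ℂ A] [CompleteSpace A]
    (L : A) (t : ℝ) :
    NormedSpace.exp (t • L) * NormedSpace.exp (t • -L) = 1 := by
  let _ : NormedAlgebra ℚ A := NormedAlgebra.restrictScalars ℚ ℂ A
  rw [smul_neg, ← NormedSpace.exp_add_of_commute (Commute.neg_right (Commute.refl (t • L)))]
  simp

/-- The derivative of an entire function in the direction of a commutator: conjugate by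
`exp (t L)`. -/
theorem RapidDecay.fderiv_commutator {c : ℕ → ℂ} (hc : RapidDecay c) (L M : A) :
    fderiv ℝ (psum c) M (L * M - M * L) = L * psum c M - psum c M * L := by
  have h1 := hasDerivAt_exp_conj L M
  have h2 := hasDerivAt_exp_conj L (psum c M)
  have e : (fun t : ℝ => NormedSpace.exp (t • L) * psum c M * NormedSpace.exp (t • -L))
      = psum c ∘ fun t : ℝ => NormedSpace.exp (t • L) * M * NormedSpace.exp (t • -L) := by
    funext t
    refine (hc.psum_conj (exp_mul_exp_neg L t) ?_ M).symm
    simpa using exp_mul_exp_neg (-L) t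
  rw [e] at h2
  have h3 : HasFDerivAt (psum c) (fderiv ℝ (psum c) M)
      ((fun t : ℝ => NormedSpace.exp (t • L) * M * NormedSpace.exp (t • -L)) 0) := by
    have := (hc.tame (A := A)).differentiable M
    simpa using this.hasFDerivAt
  exact (h3.comp_hasDerivAt 0 h1).unique h2

theorem RapidDecay.hasDerivAt_psum_comp {c : ℕ → ℂ} (hc : RapidDecay c) {γ : ℝ → A} {t : ℝ} {L : A}
    (hγ : HasDerivAt γ (L * γ t - γ t * L) t) :
    HasDerivAt (fun s => psum c (γ s)) (L * psum c (γ t) - psum c (γ t) * L) t := by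
  have h := ((hc.tame (A := A)).differentiable (γ t)).hasFDerivAt.comp_hasDerivAt t hγ
  rw [hc.fderiv_commutator] at h
  exact h

/-! ### The divided difference of an entire function -/

/-- The Taylor coefficients of the divided difference `x ↦ (f x - f z) / (x - z)`, in terms of those
of `f`. -/
def tailCoeff (c : ℕ → ℂ) (z : ℂ) (k : ℕ) : ℂ := ∑' m, c (m + k + 1) * z ^ m

theorem RapidDecay.exists_tail_le {c : ℕ → ℂ} (hc : RapidDecay c) {r : ℝ} (hr : 0 ≤ r) :
    ∃ C, 0 ≤ C ∧ ∀ m k, ‖c (m + k + 1)‖ * (r ^ m * r ^ k)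
      ≤ C * ((1 / 2) ^ m * (1 / 2) ^ k) := by
  obtain ⟨C, hC0, hC⟩ := hc.exists_le (r := max r 1) (by positivity)
  refine ⟨C, hC0, fun m k => ?_⟩
  have h1 : 1 ≤ max r 1 := le_max_right _ _
  calc ‖c (m + k + 1)‖ * (r ^ m * r ^ k) ≤ ‖c (m + k + 1)‖ * (max r 1) ^ (m + k + 1) := by
        rw [← pow_add]
        gcongr
        calc r ^ (m + k) ≤ (max r 1) ^ (m + k) := by gcongr; exact le_max_left _ _
          _ ≤ (max r 1) ^ (m + k + 1) := pow_le_pow_right₀ h1 (by omega)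
    _ ≤ C * (1 / 2) ^ (m + k + 1) := hC _
    _ ≤ C * (1 / 2) ^ (m + k) := by
        gcongr C * ?_
        exact pow_le_pow_of_le_one (by norm_num) (by norm_num) (by omega)
    _ = _ := by rw [pow_add]

theorem RapidDecay.summable_tail {c : ℕ → ℂ} (hc : RapidDecay c) (z : ℂ) (k : ℕ) :
    Summable fun m => c (m + k + 1) * z ^ m := by
  obtain ⟨C, hC0, hC⟩ := hc.exists_tail_le (r := max ‖z‖ 1) (by positivity)
  refine Summable.of_norm_bounded (summable_half C) fun m => ?_
  have h1 : 1 ≤ max ‖z‖ 1 := le_max_right _ _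
  calc ‖c (m + k + 1) * z ^ m‖ ≤ ‖c (m + k + 1)‖ * ((max ‖z‖ 1) ^ m * (max ‖z‖ 1) ^ k) := by
        rw [norm_mul, norm_pow]
        gcongr
        calc ‖z‖ ^ m ≤ (max ‖z‖ 1) ^ m := by gcongr; exact le_max_left _ _
          _ ≤ _ := le_mul_of_one_le_right (by positivity) (one_le_pow₀ h1)
    _ ≤ C * ((1 / 2) ^ m * (1 / 2) ^ k) := hC m k
    _ ≤ C * (1 / 2) ^ m := by
        gcongr
        exact mul_le_of_le_one_right (by positivity) (pow_le_one₀ (by norm_num) (by norm_num))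

theorem RapidDecay.tail {c : ℕ → ℂ} (hc : RapidDecay c) (z : ℂ) : RapidDecay (tailCoeff c z) := by
  intro r hr
  set R := max ‖z‖ r
  have hR : 0 ≤ R := hr.trans (le_max_right _ _)
  obtain ⟨C, hC0, hC⟩ := hc.exists_tail_le hR
  refine ⟨∑' m : ℕ, C * (1 / 2) ^ m, fun k => ?_⟩
  have e : ‖tailCoeff c z k‖ * r ^ k = ‖∑' m, (c (m + k + 1) * z ^ m) * (r : ℂ) ^ k‖ := by
    rw [tsum_mul_right, norm_mul, tailCoeff]
    simp [abs_of_nonneg hr]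
  rw [e]
  refine tsum_of_norm_bounded (summable_half C).hasSum fun m => ?_
  calc ‖c (m + k + 1) * z ^ m * (r : ℂ) ^ k‖ ≤ ‖c (m + k + 1)‖ * (R ^ m * R ^ k) := by
        rw [norm_mul, norm_mul, norm_pow, norm_pow, mul_assoc, Complex.norm_real,
          Real.norm_eq_abs, abs_of_nonneg hr]
        gcongr
        · exact le_max_left _ _
        · exact le_max_right _ _
    _ ≤ C * ((1 / 2) ^ m * (1 / 2) ^ k) := hC m k
    _ ≤ C * (1 / 2) ^ m := by
        gcongr
        exact mul_le_of_le_one_right (by positivity) (pow_le_one₀ (by norm_num) (by norm_num))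

theorem RapidDecay.tail_eq {c : ℕ → ℂ} (hc : RapidDecay c) (z : ℂ) (k : ℕ) :
    tailCoeff c z k = c (k + 1) + z * tailCoeff c z (k + 1) := by
  have h := (hc.summable_tail z k).tsum_eq_zero_add
  rw [tailCoeff, h, tailCoeff, ← tsum_mul_left]
  simp only [zero_add, pow_zero, mul_one]
  congr 1
  refine tsum_congr fun m => ?_
  rw [show m + 1 + k + 1 = m + (k + 1) + 1 by omega]
  ring

theorem RapidDecay.psum_eq_tail {c : ℕ → ℂ} (hc : RapidDecay c) (z : ℂ) :
    psum c z = c 0 + z * tailCoeff c z 0 := by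
  rw [psum, (hc.hasSum z).summable.tsum_eq_zero_add, tailCoeff, ← tsum_mul_left]
  simp only [pow_zero, smul_eq_mul, mul_one]
  congr 1
  refine tsum_congr fun m => ?_
  ring_nf

/-- `f(M) = f(z) + (M - z) q(M)` for the divided difference `q` of `f`. -/
theorem RapidDecay.psum_eq_add {c : ℕ → ℂ} (hc : RapidDecay c) (z : ℂ) (M : A) :
    psum c M = psum c z • 1 + (M * psum (tailCoeff c z) M - z • psum (tailCoeff c z) M) := by
  set d := tailCoeff c z with hd
  have hM := (hc.tail z).hasSum M
  have h1 : HasSum (fun k => d k • M ^ (k + 1)) (M * psum d M) := by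
    refine hasSum_of_eq (hM.mul_left M) fun k => ?_
    rw [mul_smul_comm, pow_succ']
  have h2 : HasSum (fun k => c (k + 1) • M ^ (k + 1)) (psum c M - c 0 • 1) := by
    have := (hasSum_nat_add_iff' 1).mpr (hc.hasSum M)
    simpa using this
  have h3 : HasSum (fun k => d (k + 1) • M ^ (k + 1)) (psum d M - d 0 • 1) := by
    have := (hasSum_nat_add_iff' 1).mpr hM
    simpa using this
  have h4 : M * psum d M = psum c M - c 0 • 1 + z • (psum d M - d 0 • 1) := by
    refine h1.unique ?_
    refine hasSum_of_eq (h2.add (h3.const_smul z)) fun k => ?_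
    rw [hd, hc.tail_eq z k, add_smul, mul_smul]
  rw [h4, hc.psum_eq_tail z, ← hd, add_smul, mul_smul, smul_sub]
  abel

/-- The Taylor coefficients in `z` of a matrix element of the divided difference `q(M)`. -/
def dualTail (c : ℕ → ℂ) (M : A) (φ : A →L[ℂ] ℂ) (m : ℕ) : ℂ := ∑' k, c (m + k + 1) * φ (M ^ k)

theorem RapidDecay.exists_dualTail_le {A : Type*} [NormedRing A] [NormedAlgebra ℂ A]
    [NormOneClass A] {c : ℕ → ℂ} (hc : RapidDecay c) (M : A) (φ : A →L[ℂ] ℂ) {r : ℝ}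
    (hr : 0 ≤ r) : ∃ C, 0 ≤ C ∧ ∀ m k,
      ‖c (m + k + 1) * φ (M ^ k)‖ * r ^ m ≤ C * ((1 / 2) ^ m * (1 / 2) ^ k) := by
  set R := max ‖M‖ r
  have hR : 0 ≤ R := hr.trans (le_max_right _ _)
  obtain ⟨C, hC0, hC⟩ := hc.exists_tail_le hR
  refine ⟨‖φ‖ * C, by positivity, fun m k => ?_⟩
  have h1 : ‖φ (M ^ k)‖ ≤ ‖φ‖ * R ^ k := (φ.le_opNorm _).trans (by
    gcongr
    exact (norm_pow_le M k).trans (by gcongr; exact le_max_left _ _))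
  calc ‖c (m + k + 1) * φ (M ^ k)‖ * r ^ m ≤ ‖c (m + k + 1)‖ * (‖φ‖ * R ^ k) * R ^ m := by
        rw [norm_mul]
        gcongr
        exact le_max_right _ _
    _ = ‖φ‖ * (‖c (m + k + 1)‖ * (R ^ m * R ^ k)) := by ring
    _ ≤ ‖φ‖ * (C * ((1 / 2) ^ m * (1 / 2) ^ k)) :=
        mul_le_mul_of_nonneg_left (hC m k) (norm_nonneg φ)
    _ = _ := by ring

theorem RapidDecay.summable_dualTail {A : Type*} [NormedRing A] [NormedAlgebra ℂ A] [NormOneClass A]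
    {c : ℕ → ℂ} (hc : RapidDecay c) (M : A) (φ : A →L[ℂ] ℂ)
    (m : ℕ) : Summable fun k => c (m + k + 1) * φ (M ^ k) := by
  obtain ⟨C, hC0, hC⟩ := hc.exists_dualTail_le M φ zero_le_one
  refine Summable.of_norm_bounded (summable_half C) fun k => ?_
  have h := hC m k
  rw [one_pow, mul_one] at h
  refine h.trans ?_
  gcongr
  exact mul_le_of_le_one_left (by positivity) (pow_le_one₀ (by norm_num) (by norm_num))

theorem RapidDecay.dualTail {A : Type*} [NormedRing A] [NormedAlgebra ℂ A] [NormOneClass A]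
    {c : ℕ → ℂ} (hc : RapidDecay c) (M : A) (φ : A →L[ℂ] ℂ) :
    RapidDecay (dualTail c M φ) := by
  intro r hr
  obtain ⟨C, hC0, hC⟩ := hc.exists_dualTail_le M φ hr
  refine ⟨∑' k : ℕ, C * (1 / 2) ^ k, fun m => ?_⟩
  have e : ‖Toda.dualTail c M φ m‖ * r ^ m
      = ‖∑' k, (c (m + k + 1) * φ (M ^ k)) * (r : ℂ) ^ m‖ := by
    rw [tsum_mul_right, norm_mul, Toda.dualTail]
    simp [abs_of_nonneg hr]
  rw [e]
  refine tsum_of_norm_bounded (summable_half C).hasSum fun k => ?_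
  have h := hC m k
  rw [norm_mul, norm_pow, Complex.norm_real, Real.norm_eq_abs, abs_of_nonneg hr]
  refine h.trans ?_
  gcongr
  exact mul_le_of_le_one_left (by positivity) (pow_le_one₀ (by norm_num) (by norm_num))

/-- A matrix element of the divided difference `q(M)` as a power series in `z`. -/
theorem RapidDecay.apply_psum_tail {c : ℕ → ℂ} (hc : RapidDecay c) (M : A) (φ : A →L[ℂ] ℂ)
    (z : ℂ) : φ (psum (tailCoeff c z) M) = psum (Toda.dualTail c M φ) z := by
  have h1 := φ.hasSum ((hc.tail z).hasSum M)
  rw [← h1.tsum_eq, psum]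
  have e1 : ∀ k, φ (tailCoeff c z k • M ^ k) = ∑' m, c (m + k + 1) * z ^ m * φ (M ^ k) := by
    intro k
    rw [map_smul, smul_eq_mul, tailCoeff, tsum_mul_right]
  have e2 : ∀ m, Toda.dualTail c M φ m • z ^ m = ∑' k, c (m + k + 1) * z ^ m * φ (M ^ k) := by
    intro m
    rw [smul_eq_mul, Toda.dualTail, ← tsum_mul_right]
    exact tsum_congr fun k => by ring
  simp only [e1, e2]
  refine Summable.tsum_comm (f := fun m k => c (m + k + 1) * z ^ m * φ (M ^ k)) ?_
  obtain ⟨C, hC0, hC⟩ := hc.exists_dualTail_le M φ (norm_nonneg z)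
  have hg : Summable fun n : ℕ => (1 / 2 : ℝ) ^ n :=
    summable_geometric_of_lt_one (by norm_num) (by norm_num)
  refine Summable.of_norm_bounded ((hg.mul_of_nonneg hg (fun _ => by positivity)
    fun _ => by positivity).mul_left C) fun p => ?_
  have := hC p.1 p.2
  rw [← norm_pow, ← norm_mul] at this
  refine (le_of_eq (congrArg norm ?_)).trans this
  simp only [Function.uncurry]
  ring

end Algebra

/-! ### Entire functions of a tridiagonal operator -/

instance : NormOneClass Op :=
  ⟨le_antisymm ContinuousLinearMap.norm_id_le (by simpa [entry_one] using norm_entry_le 1 0 0)⟩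

theorem entry_pow_im (x : Coeffs) (n : ℕ) (j k : ℤ) : (entry (opL x ^ n) j k).im = 0 := by
  induction n generalizing j k with
  | zero => rw [pow_zero, entry_one]; split_ifs <;> simp
  | succ n ih => rw [pow_succ', entry_opL_mul]; simp [ih]

theorem entry_pow_symm (x : Coeffs) (n : ℕ) (j k : ℤ) :
    entry (opL x ^ n) j k = entry (opL x ^ n) k j := by
  have h := entry_star (opL x ^ n) j k
  rw [star_pow, star_opL] at h
  rw [h]
  exact Complex.conj_eq_iff_im.mpr (entry_pow_im x n k j)

theorem entry_pow_eq_zero (x : Coeffs) (n : ℕ) (j k : ℤ) (h : n < (j - k).natAbs) :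
    entry (opL x ^ n) j k = 0 := by
  induction n generalizing j k with
  | zero =>
    rw [pow_zero, entry_one, if_neg]
    omega
  | succ n ih =>
    rw [pow_succ', entry_opL_mul, ih _ _ (by omega), ih _ _ (by omega), ih _ _ (by omega)]
    simp

/-- The function with Taylor coefficients `c` of the tridiagonal operator with coefficients `x`. -/
abbrev funOp (c : ℕ → ℂ) (x : Coeffs) : Op := psum c (opL x)

theorem RapidDecay.hasSum_entry {c : ℕ → ℂ} (hc : RapidDecay c) (x : Coeffs) (j k : ℤ) :
    HasSum (fun n => c n * entry (opL x ^ n) j k) (entry (funOp c x) j k) :=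
  hasSum_of_eq ((entryL j k).hasSum (hc.hasSum (opL x))) fun n => by
    rw [map_smul, entryL_apply, smul_eq_mul]

theorem RapidDecay.entry_symm {c : ℕ → ℂ} (hc : RapidDecay c) (x : Coeffs) (j k : ℤ) :
    entry (funOp c x) j k = entry (funOp c x) k j :=
  (hc.hasSum_entry x j k).unique
    (hasSum_of_eq (hc.hasSum_entry x k j) fun n => by rw [entry_pow_symm])

theorem RapidDecay.entry_im {c : ℕ → ℂ} (hc : RapidDecay c) (hr : ∀ n, (c n).im = 0) (x : Coeffs)
    (j k : ℤ) : (entry (funOp c x) j k).im = 0 := by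
  have h := Complex.imCLM.hasSum (hc.hasSum_entry x j k)
  have h0 : ∀ n, Complex.imCLM (c n * entry (opL x ^ n) j k) = 0 := fun n => by
    simp [Complex.mul_im, hr, entry_pow_im]
  simp only [h0] at h
  exact h.unique hasSum_zero

/-- An operator whose matrix elements decay exponentially away from the diagonal. -/
def Decaying (F : Op) : Prop :=
  ∃ C, 0 ≤ C ∧ ∀ j k, ‖entry F j k‖ ≤ C * (1 / 2) ^ (j - k).natAbs

theorem RapidDecay.decaying {c : ℕ → ℂ} (hc : RapidDecay c) (x : Coeffs) :
    Decaying (funOp c x) := by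
  obtain ⟨C, hC0, hC⟩ := hc.exists_le (r := 2 * ‖opL x‖) (by positivity)
  refine ⟨∑' n : ℕ, C * (1 / 2) ^ n, tsum_nonneg fun n => by positivity, fun j k => ?_⟩
  rw [← (hc.hasSum_entry x j k).tsum_eq, ← tsum_mul_right]
  refine tsum_of_norm_bounded ((summable_half C).mul_right _).hasSum fun n => ?_
  rcases lt_or_ge n (j - k).natAbs with h | h
  · rw [entry_pow_eq_zero x n j k h]
    simp only [mul_zero, norm_zero]
    positivity
  · have h1 : ‖c n * entry (opL x ^ n) j k‖ ≤ ‖c n‖ * ‖opL x‖ ^ n := by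
      rw [norm_mul]
      gcongr
      exact (norm_entry_le _ _ _).trans (norm_pow_le _ _)
    have h2 : ‖c n‖ * ‖opL x‖ ^ n = (‖c n‖ * (2 * ‖opL x‖) ^ n) * (1 / 2) ^ n := by
      have h2 : (2 : ℝ) ^ n * (1 / 2) ^ n = 1 := by rw [← mul_pow]; norm_num
      rw [mul_pow]
      linear_combination (-‖c n‖ * ‖opL x‖ ^ n) * h2
    rw [h2] at h1
    refine h1.trans (mul_le_mul (hC n) ?_ (by positivity) (by positivity))
    exact pow_le_pow_of_le_one (by norm_num) (by norm_num) h

/-! ### The Lax pair -/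

/-- The sign of an integer, with `sgn 0 = 0`, as a complex number. -/
def sgn (n : ℤ) : ℂ := (Int.sign n : ℤ)

theorem sgn_of_pos {n : ℤ} (h : 0 < n) : sgn n = 1 := by simp [sgn, Int.sign_eq_one_of_pos h]

theorem sgn_of_neg {n : ℤ} (h : n < 0) : sgn n = -1 := by
  simp [sgn, Int.sign_eq_neg_one_of_neg h]

theorem sgn_zero : sgn 0 = 0 := by simp [sgn]

theorem sgn_neg (n : ℤ) : sgn (-n) = -sgn n := by simp [sgn]

theorem norm_sgn_le (n : ℤ) : ‖sgn n‖ ≤ 1 := by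
  rcases lt_trichotomy n 0 with h | h | h
  · simp [sgn_of_neg h]
  · simp [h, sgn_zero]
  · simp [sgn_of_pos h]

/-- The anti-symmetric part of a decaying operator with real matrix elements, as a bounded operator:
the norm convergent sum of its upper minus its lower diagonals. -/
def antiOp (F : Op) : Op :=
  ∑' d : ℕ, (wshiftL (d + 1) (diagL (d + 1) F) - wshiftL (-(d + 1)) (diagL (-(d + 1)) F))

theorem Decaying.summable {F : Op} (hF : Decaying F) :
    Summable fun d : ℕ =>
      (wshiftL (d + 1) (diagL (d + 1) F) - wshiftL (-(d + 1)) (diagL (-(d + 1)) F)) := by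
  obtain ⟨C, hC0, hC⟩ := hF
  have hd : ∀ (d : ℕ) (e : ℤ), e.natAbs = d + 1 → ‖wshiftL e (diagL e F)‖ ≤ C * (1 / 2) ^ d := by
    intro d e he
    refine (norm_wshiftL_le _ _).trans
      ((BoundedContinuousFunction.norm_le (by positivity)).mpr fun n => ?_)
    rw [diagL_apply, Real.norm_eq_abs]
    refine (Complex.abs_re_le_norm _).trans ((hC _ _).trans ?_)
    gcongr C * ?_
    exact pow_le_pow_of_le_one (by norm_num) (by norm_num) (by omega)
  refine Summable.of_norm_bounded (summable_half (2 * C)) fun d => ?_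
  refine (norm_sub_le _ _).trans ((add_le_add (hd d _ (by omega)) (hd d _ (by omega))).trans_eq ?_)
  ring

theorem Decaying.entry_antiOp {F : Op} (hF : Decaying F) (j k : ℤ) :
    entry (antiOp F) j k = sgn (k - j) * ((entry F j k).re : ℂ) := by
  have h := (entryL j k).hasSum hF.summable.hasSum
  have e : ∀ d : ℕ, entryL j k
      (wshiftL (d + 1) (diagL (d + 1) F) - wshiftL (-(d + 1)) (diagL (-(d + 1)) F))
      = if d = (k - j).natAbs - 1 then sgn (k - j) * ((entry F j k).re : ℂ) else 0 := by
    intro d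
    rw [map_sub, entryL_apply, entryL_apply, entry_wshiftL, entry_wshiftL]
    rcases lt_trichotomy j k with hjk | hjk | hjk
    · rw [sgn_of_pos (by omega : 0 < k - j), if_neg (by omega : ¬ j + -((d : ℤ) + 1) = k)]
      by_cases hd : j + ((d : ℤ) + 1) = k
      · rw [if_pos hd, if_pos (by omega), diagL_apply, hd]
        simp
      · rw [if_neg hd, if_neg (by omega), sub_zero]
    · rw [if_neg (by omega), if_neg (by omega), hjk, sub_self, sub_self, sgn_zero, zero_mul]
      simp
    · rw [sgn_of_neg (by omega : k - j < 0), if_neg (by omega : ¬ j + ((d : ℤ) + 1) = k)]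
      by_cases hd : j + -((d : ℤ) + 1) = k
      · rw [if_pos hd, if_pos (by omega), diagL_apply, hd]
        simp
      · rw [if_neg hd, if_neg (by omega), sub_zero]
  rw [funext e] at h
  exact h.unique (hasSum_ite_eq _ _)

/-- Taylor coefficients of entire functions that are real on the real line. -/
structure RealRapid (c : ℕ → ℂ) : Prop where
  rapid : RapidDecay c
  real : ∀ n, (c n).im = 0

theorem RealRapid.entry_re {c : ℕ → ℂ} (hc : RealRapid c) (x : Coeffs) (j k : ℤ) :
    ((entry (funOp c x) j k).re : ℂ) = entry (funOp c x) j k :=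
  Complex.ext (by simp) (by simp [hc.rapid.entry_im hc.real])

theorem RealRapid.entry_antiOp {c : ℕ → ℂ} (hc : RealRapid c) (x : Coeffs) (j k : ℤ) :
    entry (antiOp (funOp c x)) j k = sgn (k - j) * entry (funOp c x) j k := by
  rw [(hc.rapid.decaying x).entry_antiOp, hc.entry_re]

theorem RealRapid.star_antiOp {c : ℕ → ℂ} (hc : RealRapid c) (x : Coeffs) :
    star (antiOp (funOp c x)) = -antiOp (funOp c x) := by
  refine entry_ext fun j k => ?_
  rw [entry_star, entry_neg, hc.entry_antiOp, hc.entry_antiOp, ← hc.entry_re,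
    hc.rapid.entry_symm x k j, ← neg_sub j k, sgn_neg, neg_mul, neg_neg, star_mul', sgn]
  simp only [hc.entry_re]
  have hF : star (entry (funOp c x) j k) = entry (funOp c x) j k :=
    Complex.conj_eq_iff_im.mpr (hc.rapid.entry_im hc.real x j k)
  rw [hF]
  simp

/-- The vector field of the Toda flow on the coefficients:
`a_n' = a_n (F_{n+1,n+1} - F_{n,n})` and `b_n' = 2 a_n F_{n,n+1} - 2 a_{n-1} F_{n-1,n}` for
`F = f(J)`. -/
def field (c : ℕ → ℂ) (x : Coeffs) : Coeffs :=
  (x.1 * (translL 1 (diagL 0 (funOp c x)) - diagL 0 (funOp c x)),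
    (2 : ℝ) • (x.1 * diagL 1 (funOp c x) - translL (-1) (x.1 * diagL 1 (funOp c x))))

theorem field_fst (c : ℕ → ℂ) (x : Coeffs) (n : ℤ) :
    (field c x).1 n = x.1 n * ((entry (funOp c x) (n + 1) (n + 1)).re
      - (entry (funOp c x) n n).re) := by
  simp [field]

theorem field_snd (c : ℕ → ℂ) (x : Coeffs) (n : ℤ) :
    (field c x).2 n = 2 * (x.1 n * (entry (funOp c x) n (n + 1)).re
      - x.1 (n - 1) * (entry (funOp c x) (n - 1) n).re) := by
  simp [field, sub_eq_add_neg]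
  ring

theorem tame_funOp {c : ℕ → ℂ} (hc : RapidDecay c) : Tame (funOp c) :=
  hc.tame.comp (Tame.clm opL)

theorem RapidDecay.tame_field {c : ℕ → ℂ} (hc : RapidDecay c) : Tame (field c) := by
  have h0 : Tame fun x : Coeffs => x.1 := Tame.clm (ContinuousLinearMap.fst ℝ Seq Seq)
  have h1 := fun d => (Tame.clm (diagL d)).comp (tame_funOp hc)
  have h2 := h0.mul (((Tame.clm (translL 1)).comp (h1 0)).sub (h1 0))
  have h3 := h0.mul (h1 1)
  have h4 := (Tame.clm ((2 : ℝ) • ContinuousLinearMap.id ℝ Seq)).comp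
    (h3.sub ((Tame.clm (translL (-1))).comp h3))
  exact h2.prodMk h4

/-- The matrix elements of the relation `f(J) J = J f(J)`. -/
theorem RapidDecay.entry_comm {c : ℕ → ℂ} (hc : RapidDecay c) (x : Coeffs) (j k : ℤ) :
    (x.1 (k - 1) : ℂ) * entry (funOp c x) j (k - 1) + x.2 k * entry (funOp c x) j k
        + x.1 k * entry (funOp c x) j (k + 1)
      = x.1 j * entry (funOp c x) (j + 1) k + x.1 (j - 1) * entry (funOp c x) (j - 1) k
        + x.2 j * entry (funOp c x) j k := by
  rw [← entry_mul_opL, ← entry_opL_mul, (hc.commute (Commute.refl (opL x))).eq]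

/-- The Lax form of the vector field. Off the tridiagonal band the commutator vanishes since `f(J)`
commutes with `J` and the signs in `f(J)_a` are constant there. -/
theorem RealRapid.opL_field {c : ℕ → ℂ} (hc : RealRapid c) (x : Coeffs) :
    opL (field c x) = antiOp (funOp c x) * opL x - opL x * antiOp (funOp c x) := by
  refine entry_ext fun j k => ?_
  rw [entry_sub, entry_mul_opL, entry_opL_mul, entry_opL]
  simp only [hc.entry_antiOp, field_fst, field_snd]
  push_cast
  simp only [hc.entry_re]
  have hs := hc.rapid.entry_symm x
  have hcomm := hc.rapid.entry_comm x j k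
  rcases lt_trichotomy k j with h | h | h
  · rcases eq_or_ne k (j - 1) with h' | h'
    · subst h'
      rw [if_neg (by omega), if_pos rfl, sgn_of_neg (by omega : j - 1 - 1 - j < 0),
        sgn_of_neg (by omega : j - 1 - j < 0), show j - 1 + 1 - j = 0 by omega,
        sgn_of_neg (by omega : j - 1 - (j + 1) < 0), show j - 1 - (j - 1) = 0 by omega, sgn_zero]
      simp only [sub_add_cancel] at hcomm ⊢
      linear_combination hcomm
    · rw [if_neg (by omega), if_neg (by omega), if_neg (by omega),
        sgn_of_neg (by omega : k - 1 - j < 0), sgn_of_neg (by omega : k - j < 0),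
        sgn_of_neg (by omega : k + 1 - j < 0), sgn_of_neg (by omega : k - (j + 1) < 0),
        sgn_of_neg (by omega : k - (j - 1) < 0)]
      linear_combination hcomm
  · subst h
    rw [if_neg (by omega), if_neg (by omega), if_pos rfl, sgn_of_neg (by omega : k - 1 - k < 0),
      show k - k = 0 by omega, sgn_of_pos (by omega : 0 < k + 1 - k),
      sgn_of_neg (by omega : k - (k + 1) < 0), sgn_of_pos (by omega : 0 < k - (k - 1)), sgn_zero,
      hs k (k - 1), hs (k + 1) k]
    ring
  · rcases eq_or_ne k (j + 1) with h' | h'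
    · subst h'
      rw [if_pos rfl, show j + 1 - 1 - j = 0 by omega, sgn_of_pos (by omega : 0 < j + 1 - j),
        sgn_of_pos (by omega : 0 < j + 1 + 1 - j), show j + 1 - (j + 1) = 0 by omega,
        sgn_of_pos (by omega : 0 < j + 1 - (j - 1)), sgn_zero]
      simp only [add_sub_cancel_right] at hcomm ⊢
      linear_combination -hcomm
    · rw [if_neg (by omega), if_neg (by omega), if_neg (by omega),
        sgn_of_pos (by omega : 0 < k - 1 - j), sgn_of_pos (by omega : 0 < k - j),
        sgn_of_pos (by omega : 0 < k + 1 - j), sgn_of_pos (by omega : 0 < k - (j + 1)),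
        sgn_of_pos (by omega : 0 < k - (j - 1))]
      linear_combination -hcomm

theorem star_real_smul (r : ℝ) (L : Op) : star (r • L) = r • star L := by
  refine entry_ext fun j k => ?_
  have h : ∀ X : Op, r • X = (r : ℂ) • X := fun X => rfl
  rw [h, h, star_smul]
  simp

/-- The norm is stationary along a Lax equation with a skew-adjoint operator `L`, because to first
order the evolution is the unitary conjugation by `exp (t L)`. -/
theorem hasDerivWithinAt_norm_of_lax {γ : ℝ → Op} {L : Op} (hL : star L = -L) {s : Set ℝ} {t : ℝ}
    (hγ : HasDerivWithinAt γ (L * γ t - γ t * L) s t) :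
    HasDerivWithinAt (fun u => ‖γ u‖) 0 s t := by
  have hU : ∀ u : ℝ, NormedSpace.exp (u • L) ∈ unitary Op := fun u => by
    let _ : NormedAlgebra ℚ Op := NormedAlgebra.restrictScalars ℚ ℂ Op
    refine NormedSpace.exp_mem_unitary_of_mem_skewAdjoint ?_
    rw [skewAdjoint.mem_iff, star_real_smul, hL, smul_neg]
  have hnorm : ∀ u : ℝ, ‖NormedSpace.exp (u • L) * γ t * NormedSpace.exp (u • -L)‖ = ‖γ t‖ := by
    intro u
    have h2 : u • -L = (-u) • L := by simp
    rw [h2]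
    exact (CStarRing.norm_mul_coe_unitary _ ⟨_, hU (-u)⟩).trans
      (CStarRing.norm_coe_unitary_mul ⟨_, hU u⟩ _)
  have h1 : HasDerivAt (fun u : ℝ => NormedSpace.exp ((u - t) • L) * γ t
      * NormedSpace.exp ((u - t) • -L)) (L * γ t - γ t * L) t := by
    have := hasDerivAt_exp_conj L (γ t)
    rw [← sub_self t] at this
    exact this.comp_sub_const t t
  have h2 := hγ.sub h1.hasDerivWithinAt
  rw [sub_self, hasDerivWithinAt_iff_isLittleO] at h2
  rw [hasDerivWithinAt_iff_isLittleO]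
  refine Asymptotics.IsBigO.trans_isLittleO (Asymptotics.IsBigO.of_bound 1 ?_) h2
  refine Eventually.of_forall fun u => ?_
  simp only [Pi.sub_apply, sub_self, zero_smul, NormedSpace.exp_zero, one_mul, mul_one, smul_zero,
    sub_zero]
  have h3 := abs_norm_sub_norm_le (γ u)
    (NormedSpace.exp ((u - t) • L) * γ t * NormedSpace.exp ((u - t) • -L))
  rwa [hnorm] at h3

/-- The operator norm is conserved by the Toda flows, also if the vector field is multiplied by a
scalar function. -/
theorem RealRapid.norm_conserved {c : ℕ → ℂ} (hc : RealRapid c) {T : ℝ} {x : ℝ → Coeffs}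
    {χ : ℝ → ℝ}
    (hx : ∀ t ∈ Icc (-T) T, HasDerivWithinAt x (χ t • field c (x t)) (Icc (-T) T) t) :
    ∀ t ∈ Icc (-T) T, ‖opL (x t)‖ = ‖opL (x 0)‖ := by
  intro t ht
  have h : ∀ t ∈ Icc (-T) T, HasDerivWithinAt (fun u => ‖opL (x u)‖) 0 (Icc (-T) T) t := by
    intro t ht
    refine hasDerivWithinAt_norm_of_lax (γ := fun u => opL (x u))
      (L := χ t • antiOp (funOp c (x t))) ?_ ?_
    · rw [star_real_smul, hc.star_antiOp, smul_neg]
    · have h1 := opL.hasFDerivAt.comp_hasDerivWithinAt t (hx t ht)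
      rw [map_smul, hc.opL_field] at h1
      rw [smul_mul_assoc, mul_smul_comm, ← smul_sub]
      exact h1
  have h0 : (0 : ℝ) ∈ Icc (-T) T := ⟨by linarith [ht.1, ht.2], by linarith [ht.1, ht.2]⟩
  have := (convex_Icc (-T) T).norm_image_sub_le_of_norm_hasDerivWithin_le (C := 0) h
    (fun _ _ => by simp) h0 ht
  rw [zero_mul] at this
  exact sub_eq_zero.mp (norm_le_zero_iff.mp this)

/-- The evolution of entire functions of the operator along a Toda flow. -/
theorem RealRapid.hasDerivAt_funOp {k : ℕ → ℂ} (hk : RealRapid k) {c : ℕ → ℂ} (hc : RapidDecay c)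
    {x : ℝ → Coeffs} {t : ℝ} (hx : HasDerivAt x (field k (x t)) t) :
    HasDerivAt (fun s => funOp c (x s))
      (antiOp (funOp k (x t)) * funOp c (x t) - funOp c (x t) * antiOp (funOp k (x t))) t := by
  have h1 : HasDerivAt (fun s => opL (x s)) (opL (field k (x t))) t :=
    opL.hasFDerivAt.comp_hasDerivAt t hx
  rw [hk.opL_field] at h1
  exact hc.hasDerivAt_psum_comp h1

/-! ### Commutators of Toda flows -/

/-- The derivative of the matrix element `f(J)_{ij}` along the Toda flow of `k`, where `c` and `k`
are the coefficients of `f` and of the generating function. -/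
def lieEntry (k c : ℕ → ℂ) (x : Coeffs) (i j : ℤ) : ℂ :=
  entry (antiOp (funOp k x) * funOp c x - funOp c x * antiOp (funOp k x)) i j

theorem RealRapid.hasSum_lieEntry {k : ℕ → ℂ} (hk : RealRapid k) (c : ℕ → ℂ) (x : Coeffs)
    (i j : ℤ) :
    HasSum (fun l => sgn (l - i) * (entry (funOp k x) i l * entry (funOp c x) l j)
      + sgn (l - j) * (entry (funOp c x) i l * entry (funOp k x) l j)) (lieEntry k c x i j) := by
  rw [lieEntry, entry_sub]
  refine hasSum_of_eq ((hasSum_entry_mul _ _ i j).sub (hasSum_entry_mul _ _ i j)) fun l => ?_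
  rw [hk.entry_antiOp, hk.entry_antiOp, ← neg_sub l j, sgn_neg]
  ring

theorem hasSum_two {f : ℤ → ℂ} {i j : ℤ} (hij : i ≠ j) (h : ∀ l, l ≠ i → l ≠ j → f l = 0) :
    HasSum f (f i + f j) := by
  rw [← Finset.sum_pair hij]
  refine hasSum_sum_of_ne_finset_zero fun l hl => ?_
  simp only [Finset.mem_insert, Finset.mem_singleton, not_or] at hl
  exact h l hl.1 hl.2

/-- `[K_a, F]_{ii}` is symmetric in `F` and `K`. -/
theorem RealRapid.lieEntry_diag {k c : ℕ → ℂ} (hk : RealRapid k) (hc : RealRapid c) (x : Coeffs)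
    (i : ℤ) : lieEntry k c x i i = lieEntry c k x i i := by
  refine (hk.hasSum_lieEntry c x i i).unique
    (hasSum_of_eq (hc.hasSum_lieEntry k x i i) fun l => ?_)
  ring

/-- Next to the diagonal, `[K_a, F] - [F_a, K]` has only two nonvanishing terms: the signs in the two
sums over `l` differ only for `l = i` and `l = i + 1`. -/
theorem RealRapid.lieEntry_succ {k c : ℕ → ℂ} (hk : RealRapid k) (hc : RealRapid c) (x : Coeffs)
    (i : ℤ) : lieEntry k c x i (i + 1) - lieEntry c k x i (i + 1)
      = (entry (funOp k x) i i - entry (funOp k x) (i + 1) (i + 1)) * entry (funOp c x) i (i + 1)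
        - (entry (funOp c x) i i - entry (funOp c x) (i + 1) (i + 1))
          * entry (funOp k x) i (i + 1) := by
  have h := (hk.hasSum_lieEntry c x i (i + 1)).sub (hc.hasSum_lieEntry k x i (i + 1))
  have h2 := hasSum_two (f := fun l => (sgn (l - i) - sgn (l - (i + 1)))
      * (entry (funOp k x) i l * entry (funOp c x) l (i + 1)
        - entry (funOp c x) i l * entry (funOp k x) l (i + 1))) (i := i) (j := i + 1) (by omega)
    (fun l h1 h2 => by
      rcases lt_or_gt_of_ne h1 with h3 | h3
      · rw [sgn_of_neg (by omega), sgn_of_neg (by omega)]; ring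
      · rw [sgn_of_pos (by omega), sgn_of_pos (by omega)]; ring)
  rw [h.unique (hasSum_of_eq h2 fun l => by ring)]
  rw [sub_self, sub_self, sgn_of_neg (by omega : i - (i + 1) < 0),
    sgn_of_pos (by omega : 0 < i + 1 - i), sgn_zero]
  ring

theorem summable_half_int (j : ℤ) (C : ℝ) : Summable fun l : ℤ => C * (1 / 2) ^ (l - j).natAbs := by
  refine Summable.mul_left C ?_
  have h : Summable fun l : ℤ => (1 / 2 : ℝ) ^ l.natAbs := by
    have h1 : Summable fun n : ℕ => (1 / 2 : ℝ) ^ n := summable_geometric_two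
    exact Summable.of_nat_of_neg (by simpa only [Int.natAbs_natCast] using h1)
      (by simpa only [Int.natAbs_neg, Int.natAbs_natCast] using h1)
  have h2 := (Equiv.subRight j).summable_iff.mpr h
  simpa only [Function.comp_def, Equiv.subRight_apply] using h2

theorem Decaying.summable_mul {F : Op} (hF : Decaying F) (j : ℤ) {v : ℤ → ℂ} {C : ℝ}
    (hv : ∀ l, ‖v l‖ ≤ C) : Summable fun l => v l * entry F l j := by
  obtain ⟨D, hD0, hD⟩ := hF
  have hC0 : 0 ≤ C := (norm_nonneg _).trans (hv 0)
  refine Summable.of_norm_bounded (summable_half_int j (C * D)) fun l => ?_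
  rw [norm_mul, mul_assoc]
  gcongr
  exacts [hv l, hD l j]

/-- Summation by parts against the sign function. -/
theorem hasSum_sgn_telescope {u : ℤ → ℂ} (hu : Summable u) (i : ℤ) :
    HasSum (fun l => sgn (l - i) * (u l - u (l - 1))) (-u i - u (i - 1)) := by
  have hs : ∀ v : ℤ → ℤ, Summable fun l => sgn (v l) * u l := fun v =>
    Summable.of_norm_bounded hu.norm fun l => by
      rw [norm_mul]
      exact mul_le_of_le_one_left (norm_nonneg _) (norm_sgn_le _)
  have h1 := (hs fun l => l - i).hasSum
  have h2 := (hs fun l => l + 1 - i).hasSum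
  have h3 := (Equiv.subRight (1 : ℤ)).hasSum_iff.mpr h2
  have h4 := hasSum_two (f := fun l => (sgn (l - i) - sgn (l + 1 - i)) * u l) (i := i)
    (j := i - 1) (by omega) (fun l h1 h2 => by
      rcases lt_or_gt_of_ne h1 with h3 | h3
      · rw [sgn_of_neg (by omega), sgn_of_neg (by omega)]; ring
      · rw [sgn_of_pos (by omega), sgn_of_pos (by omega)]; ring)
  have h5 := (hasSum_of_eq (h1.sub h2) fun l => by ring).unique h4
  have e : -u i - u (i - 1) = (∑' l, sgn (l - i) * u l) - ∑' l, sgn (l + 1 - i) * u l := by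
    rw [h5]
    rw [sub_self, show i - 1 + 1 - i = 0 by omega, sgn_of_neg (by omega : i - 1 - i < 0),
      sgn_of_pos (by omega : 0 < i + 1 - i), sgn_zero]
    ring
  rw [e]
  refine hasSum_of_eq (h1.sub h3) fun l => ?_
  simp only [Function.comp_apply, Equiv.subRight_apply, sub_add_cancel]
  ring

/-! ### The divided difference of `f` at the operator -/

/-- The operator `q(J)` for the divided difference `q(x) = (f(x) - f(z)) / (x - z)`, where `c` are
the coefficients of `f`. -/
abbrev divOp (c : ℕ → ℂ) (z : ℂ) (x : Coeffs) : Op := funOp (tailCoeff c z) x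

/-- The matrix elements of `f(J) = f(z) + (J - z) q(J)`. -/
theorem RapidDecay.entry_eq_left {c : ℕ → ℂ} (hc : RapidDecay c) (z : ℂ) (x : Coeffs) (i l : ℤ) :
    entry (funOp c x) i l = psum c z * (if i = l then 1 else 0)
      + (x.1 i * entry (divOp c z x) (i + 1) l + x.1 (i - 1) * entry (divOp c z x) (i - 1) l
        + x.2 i * entry (divOp c z x) i l - z * entry (divOp c z x) i l) := by
  rw [funOp, hc.psum_eq_add z, entry_add, entry_smul, entry_one, entry_sub, entry_opL_mul,
    entry_smul]

/-- The matrix elements of `f(J) = f(z) + q(J) (J - z)`. -/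
theorem RapidDecay.entry_eq_right {c : ℕ → ℂ} (hc : RapidDecay c) (z : ℂ) (x : Coeffs) (i l : ℤ) :
    entry (funOp c x) i l = psum c z * (if i = l then 1 else 0)
      + (x.1 (l - 1) * entry (divOp c z x) i (l - 1) + x.2 l * entry (divOp c z x) i l
        + x.1 l * entry (divOp c z x) i (l + 1) - z * entry (divOp c z x) i l) := by
  rw [hc.entry_eq_left z, (hc.tail z).entry_comm]

/-- Green's identity for the divided differences `P`, `Q` of two functions `k`, `f`: after insertion of
`K = k(z) + (J - z) P` and `F = f(z) + (J - z) Q`, the difference of the derivative of `Q` along the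
flow of `k` and of the derivative of `P` along the flow of `f` telescopes; for `j = i` and for
`j = i + 1` only finitely many terms of the remaining sum are nonzero. -/
theorem RealRapid.lieEntry_div {k c : ℕ → ℂ} (hk : RealRapid k) (hc : RealRapid c) (z : ℂ)
    (x : Coeffs) (i j : ℤ) {u : ℤ → ℂ}
    (hu : ∀ l, u l = x.1 l * (entry (divOp k z x) i (l + 1) * entry (divOp c z x) l j
      + entry (divOp c z x) i l * entry (divOp k z x) (l + 1) j
      - entry (divOp c z x) i (l + 1) * entry (divOp k z x) l j
      - entry (divOp k z x) i l * entry (divOp c z x) (l + 1) j)) :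
    HasSum (fun l => sgn (l - i) * (psum k z * ((if i = l then 1 else 0) * entry (divOp c z x) l j
        + entry (divOp c z x) i l * (if l = j then 1 else 0))
        - psum c z * ((if i = l then 1 else 0) * entry (divOp k z x) l j
        + entry (divOp k z x) i l * (if l = j then 1 else 0)))
      + (sgn (l - j) - sgn (l - i)) * (entry (divOp c z x) i l * entry (funOp k x) l j
        - entry (divOp k z x) i l * entry (funOp c x) l j))
      (lieEntry k (tailCoeff c z) x i j - lieEntry c (tailCoeff k z) x i j + u i + u (i - 1)) := by
  have hP := (hk.rapid.tail z).decaying x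
  have hQ := (hc.rapid.tail z).decaying x
  have hus : Summable u := by
    have b : ∀ (F : Op) (m : ℤ → ℤ) (l : ℤ), ‖(x.1 l : ℂ) * entry F i (m l)‖ ≤ ‖x.1‖ * ‖F‖ := by
      intro F m l
      rw [norm_mul, Complex.norm_real]
      exact mul_le_mul (x.1.norm_coe_le_norm l) (norm_entry_le _ _ _) (norm_nonneg _)
        (norm_nonneg _)
    have b' : ∀ (F : Op) (l : ℤ), ‖(x.1 (l - 1) : ℂ) * entry F i (l - 1)‖ ≤ ‖x.1‖ * ‖F‖ := by
      intro F l
      exact b F (fun l => l) (l - 1)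
    have s1 := hQ.summable_mul j (b (divOp k z x) fun l => l + 1)
    have s2 := (Equiv.addRight (1 : ℤ)).summable_iff.mpr (hP.summable_mul j (b' (divOp c z x)))
    have s3 := hP.summable_mul j (b (divOp c z x) fun l => l + 1)
    have s4 := (Equiv.addRight (1 : ℤ)).summable_iff.mpr (hQ.summable_mul j (b' (divOp k z x)))
    convert! ((s1.add s2).sub s3).sub s4 using 1
    funext l
    rw [hu]
    simp only [Function.comp_apply, Equiv.coe_addRight, add_sub_cancel_right]
    ring
  have h := ((hk.hasSum_lieEntry (tailCoeff c z) x i j).sub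
    (hc.hasSum_lieEntry (tailCoeff k z) x i j)).sub (hasSum_sgn_telescope hus i)
  have e : lieEntry k (tailCoeff c z) x i j - lieEntry c (tailCoeff k z) x i j + u i + u (i - 1)
      = lieEntry k (tailCoeff c z) x i j - lieEntry c (tailCoeff k z) x i j
        - (-u i - u (i - 1)) := by ring
  rw [e]
  refine hasSum_of_eq h fun l => ?_
  rw [hu, hu, hk.rapid.entry_eq_right z x i l, hc.rapid.entry_eq_right z x i l,
    hk.rapid.entry_eq_left z x l j, hc.rapid.entry_eq_left z x l j, sub_add_cancel]
  ring

theorem RealRapid.lieEntry_div_diag {k c : ℕ → ℂ} (hk : RealRapid k) (hc : RealRapid c) (z : ℂ)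
    (x : Coeffs) (i : ℤ) :
    lieEntry k (tailCoeff c z) x i i - lieEntry c (tailCoeff k z) x i i
      = 2 * (x.1 i * (entry (divOp c z x) i (i + 1) * entry (divOp k z x) i i
          - entry (divOp k z x) i (i + 1) * entry (divOp c z x) i i)
        + x.1 (i - 1) * (entry (divOp c z x) i i * entry (divOp k z x) (i - 1) i
          - entry (divOp k z x) i i * entry (divOp c z x) (i - 1) i)) := by
  have h := hk.lieEntry_div hc z x i i (u := fun l => _) fun l => rfl
  have h0 := h.unique (hasSum_of_eq hasSum_zero fun l => by
    by_cases hl : i = l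
    · subst hl; simp [sgn_zero]
    · simp [hl, Ne.symm hl])
  rw [sub_add_cancel, (hk.rapid.tail z).entry_symm x (i + 1) i,
    (hc.rapid.tail z).entry_symm x (i + 1) i, (hk.rapid.tail z).entry_symm x i (i - 1),
    (hc.rapid.tail z).entry_symm x i (i - 1)] at h0
  linear_combination h0

theorem RealRapid.lieEntry_div_succ {k c : ℕ → ℂ} (hk : RealRapid k) (hc : RealRapid c) (z : ℂ)
    (x : Coeffs) (i : ℤ) :
    lieEntry k (tailCoeff c z) x i (i + 1) - lieEntry c (tailCoeff k z) x i (i + 1)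
        + ((entry (funOp k x) (i + 1) (i + 1) - entry (funOp k x) i i)
            * entry (divOp c z x) i (i + 1)
          - (entry (funOp c x) (i + 1) (i + 1) - entry (funOp c x) i i)
            * entry (divOp k z x) i (i + 1))
      = 2 * x.1 i * (entry (divOp k z x) i i * entry (divOp c z x) (i + 1) (i + 1)
          - entry (divOp c z x) i i * entry (divOp k z x) (i + 1) (i + 1)) := by
  have h := hk.lieEntry_div hc z x i (i + 1) (u := fun l => _) fun l => rfl
  have h2 := h.unique (hasSum_two (i := i) (j := i + 1) (by omega) fun l h1 h2 => by
    rcases lt_or_gt_of_ne h1 with h3 | h3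
    · rw [sgn_of_neg (by omega : l - i < 0), sgn_of_neg (by omega), if_neg (Ne.symm h1), if_neg h2]
      ring
    · rw [sgn_of_pos (by omega : 0 < l - i), sgn_of_pos (by omega), if_neg (Ne.symm h1), if_neg h2]
      ring)
  rw [sub_self, sub_self, sgn_of_neg (by omega : i - (i + 1) < 0),
    sgn_of_pos (by omega : 0 < i + 1 - i), sgn_zero, if_pos rfl,
    if_neg (by omega : ¬ i = i + 1), if_pos rfl, sub_add_cancel] at h2
  have k1 := hk.rapid.entry_eq_left z x i (i + 1)
  have k2 := hk.rapid.entry_eq_left z x i i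
  have c1 := hc.rapid.entry_eq_left z x i (i + 1)
  have c2 := hc.rapid.entry_eq_left z x i i
  rw [if_neg (by omega)] at k1 c1
  rw [if_pos rfl, (hk.rapid.tail z).entry_symm x (i + 1) i] at k2
  rw [if_pos rfl, (hc.rapid.tail z).entry_symm x (i + 1) i] at c2
  rw [(hk.rapid.tail z).entry_symm x i (i - 1), (hc.rapid.tail z).entry_symm x i (i - 1)] at h2
  linear_combination h2 - entry (divOp c z x) i i * k1 + entry (divOp k z x) i i * c1
    - entry (divOp c z x) i (i + 1) * k2 + entry (divOp k z x) i (i + 1) * c2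

/-! ### The matrix function `B` and the joint evolution of operator and cocycle -/

/-- Complex `2 × 2` matrices, as a Banach algebra with the operator norm of `ℓ^∞`. -/
abbrev Mat : Type := Matrix (Fin 2) (Fin 2) ℂ

attribute [local instance] Matrix.linftyOpNormedRing Matrix.linftyOpNormedAlgebra

/-- The upper left element of `B_f(J)(z)`, in terms of the divided difference of `f`. -/
def bDiag (c : ℕ → ℂ) (z : ℂ) (x : Coeffs) : ℂ :=
  (z - x.2 1) * entry (divOp c z x) 1 1 - x.1 1 * entry (divOp c z x) 1 2
    + x.1 0 * entry (divOp c z x) 0 1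

/-- The matrix `B_f(J)(z)`, in terms of the divided difference of `f`. -/
def bMat (c : ℕ → ℂ) (z : ℂ) (x : Coeffs) : Mat :=
  !![bDiag c z x, 2 * entry (divOp c z x) 1 1;
    -(2 * (x.1 0 ^ 2 * entry (divOp c z x) 0 0)), -bDiag c z x]

theorem RapidDecay.bDiag_eq {c : ℕ → ℂ} (hc : RapidDecay c) (z : ℂ) (x : Coeffs) :
    bDiag c z x = 2 * (x.1 0 * entry (divOp c z x) 0 1) + psum c z - entry (funOp c x) 1 1 := by
  have h := hc.entry_eq_left z x 1 1
  rw [if_pos rfl, (hc.tail z).entry_symm x (1 + 1) 1] at h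
  norm_num at h
  rw [h, bDiag]
  ring

section derivatives

variable {k : ℕ → ℂ} {x : ℝ → Coeffs} {t : ℝ}

theorem hasDerivAt_coeff_fst {x : ℝ → Coeffs} {v : Coeffs} {t : ℝ} (hx : HasDerivAt x v t)
    (n : ℤ) : HasDerivAt (fun s => ((x s).1 n : ℂ)) (v.1 n : ℂ) t :=
  (Complex.ofRealCLM.comp ((evalL n).comp
    (ContinuousLinearMap.fst ℝ Seq Seq))).hasFDerivAt.comp_hasDerivAt t hx

theorem hasDerivAt_coeff_snd {x : ℝ → Coeffs} {v : Coeffs} {t : ℝ} (hx : HasDerivAt x v t)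
    (n : ℤ) : HasDerivAt (fun s => ((x s).2 n : ℂ)) (v.2 n : ℂ) t :=
  (Complex.ofRealCLM.comp ((evalL n).comp
    (ContinuousLinearMap.snd ℝ Seq Seq))).hasFDerivAt.comp_hasDerivAt t hx

theorem RealRapid.field_fst (hk : RealRapid k) (x : Coeffs) (n : ℤ) : ((field k x).1 n : ℂ)
    = x.1 n * (entry (funOp k x) (n + 1) (n + 1) - entry (funOp k x) n n) := by
  rw [Toda.field_fst]
  push_cast
  rw [hk.entry_re, hk.entry_re]

theorem RealRapid.field_snd (hk : RealRapid k) (x : Coeffs) (n : ℤ) : ((field k x).2 n : ℂ)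
    = 2 * (x.1 n * entry (funOp k x) n (n + 1)
      - x.1 (n - 1) * entry (funOp k x) (n - 1) n) := by
  rw [Toda.field_snd]
  push_cast
  rw [hk.entry_re, hk.entry_re]

theorem RealRapid.hasDerivAt_entry (hk : RealRapid k)
    (hx : HasDerivAt x (field k (x t)) t) {c : ℕ → ℂ} (hc : RapidDecay c) (i j : ℤ) :
    HasDerivAt (fun s => entry (funOp c (x s)) i j) (lieEntry k c (x t) i j) t :=
  ((entryL i j).restrictScalars ℝ).hasFDerivAt.comp_hasDerivAt t (hk.hasDerivAt_funOp hc hx)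

/-- The derivative of `B_f(J)(z)` along the Toda flow of `k`. -/
def bMatDeriv (k c : ℕ → ℂ) (z : ℂ) (x : Coeffs) : Mat :=
  let K := fun n => entry (funOp k x) n n
  let d := 2 * (x.1 0 * (K 1 - K 0) * entry (divOp c z x) 0 1
    + x.1 0 * lieEntry k (tailCoeff c z) x 0 1) - lieEntry k c x 1 1
  !![d, 2 * lieEntry k (tailCoeff c z) x 1 1;
    -(2 * (2 * x.1 0 ^ 2 * (K 1 - K 0) * entry (divOp c z x) 0 0
      + x.1 0 ^ 2 * lieEntry k (tailCoeff c z) x 0 0)), -d]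

theorem hasDerivAt_matrix {T : ℝ → Mat} {T' : Mat} {t : ℝ}
    (h : ∀ i j, HasDerivAt (fun s => T s i j) (T' i j) t) : HasDerivAt T T' t := by
  have e : ∀ M : Mat, M = ∑ i, ∑ j, M i j • Matrix.single i j (1 : ℂ) := fun M => by
    conv_lhs => rw [Matrix.matrix_eq_sum_single M]
    simp [Matrix.smul_single]
  rw [funext fun s => e (T s), e T']
  exact HasDerivAt.fun_sum fun i _ => HasDerivAt.fun_sum fun j _ => (h i j).smul_const _

/-- The matrix element as a continuous linear functional on matrices. -/
def matEntryL (i j : Fin 2) : Mat →L[ℂ] ℂ :=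
  LinearMap.toContinuousLinearMap (Matrix.entryLinearMap ℂ ℂ i j)

theorem hasDerivAt_matrix_entry {T : ℝ → Mat} {T' : Mat} {t : ℝ} (h : HasDerivAt T T' t)
    (i j : Fin 2) : HasDerivAt (fun s => T s i j) (T' i j) t :=
  ((matEntryL i j).restrictScalars ℝ).hasFDerivAt.comp_hasDerivAt t h

theorem RealRapid.hasDerivAt_bMat (hk : RealRapid k)
    (hx : HasDerivAt x (field k (x t)) t) {c : ℕ → ℂ} (hc : RapidDecay c) (z : ℂ) :
    HasDerivAt (fun s => bMat c z (x s)) (bMatDeriv k c z (x t)) t := by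
  have ha := hasDerivAt_coeff_fst hx 0
  rw [hk.field_fst] at ha
  norm_num at ha
  have hQ := fun i j => hk.hasDerivAt_entry hx (hc.tail z) i j
  have hF := hk.hasDerivAt_entry hx hc 1 1
  have hd := ((((ha.mul (hQ 0 1)).const_mul 2).add_const (psum c z)).sub hF)
  have hd' : HasDerivAt (fun s => bDiag c z (x s)) ((bMatDeriv k c z (x t)) 0 0) t := by
    have e : (fun s => bDiag c z (x s)) = _ := funext fun s => hc.bDiag_eq z (x s)
    rw [e]
    exact hd
  refine hasDerivAt_matrix fun i j => ?_
  fin_cases i <;> fin_cases j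
  · exact hd'
  · exact (hQ 1 1).const_mul 2
  · have h := (((ha.pow 2).mul (hQ 0 0)).const_mul 2).neg
    convert! h using 1
    simp only [bMatDeriv, Matrix.of_apply, Matrix.cons_val', Matrix.cons_val_zero,
      Matrix.cons_val_one, Matrix.cons_val_fin_one, Fin.mk_one, Fin.zero_eta, Pi.pow_apply]
    push_cast
    ring
  · exact hd'.neg

/-- The zero curvature equation of two commuting Toda flows. -/
theorem RealRapid.bMatDeriv_add_mul {c : ℕ → ℂ} (hk : RealRapid k) (hc : RealRapid c) (z : ℂ)
    (x : Coeffs) : bMatDeriv k c z x + bMat c z x * bMat k z x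
      = bMatDeriv c k z x + bMat k z x * bMat c z x := by
  have h1 := hk.lieEntry_div_diag hc z x 1
  have h0 := hk.lieEntry_div_diag hc z x 0
  have h01 := hk.lieEntry_div_succ hc z x 0
  have hF := hk.lieEntry_diag hc x 1
  have e1 := hk.rapid.entry_eq_left z x 0 0
  have e2 := hc.rapid.entry_eq_left z x 0 0
  have e3 := hk.rapid.entry_eq_left z x 1 1
  have e4 := hc.rapid.entry_eq_left z x 1 1
  rw [if_pos rfl, (hk.rapid.tail z).entry_symm x (0 + 1) 0] at e1
  rw [if_pos rfl, (hc.rapid.tail z).entry_symm x (0 + 1) 0] at e2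
  rw [if_pos rfl, (hk.rapid.tail z).entry_symm x (1 + 1) 1] at e3
  rw [if_pos rfl, (hc.rapid.tail z).entry_symm x (1 + 1) 1] at e4
  norm_num at h1 h0 h01 e1 e2 e3 e4
  ext i j
  fin_cases i <;> fin_cases j
  · simp [bMatDeriv, bMat]
    linear_combination 2 * (x.1 0 : ℂ) * h01 - hF
  · simp [bMatDeriv, bMat, bDiag]
    linear_combination 2 * h1
  · simp [bMatDeriv, bMat, hk.rapid.bDiag_eq,
      hc.rapid.bDiag_eq]
    rw [e1, e2, e3, e4]
    linear_combination -2 * (x.1 0 : ℂ) ^ 2 * h0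
  · simp [bMatDeriv, bMat]
    linear_combination -2 * (x.1 0 : ℂ) * h01 + hF

end derivatives

/-! ### The joint flow of operator and cocycle -/

theorem tame_matrix {E : Type*} [NormedAddCommGroup E] [NormedSpace ℝ E] {T : E → Mat}
    (h : ∀ i j, Tame fun x => T x i j) : Tame T := by
  have e : T = fun x => ((T x 0 0 • Matrix.single 0 0 (1 : ℂ) + T x 0 1 • Matrix.single 0 1 (1 : ℂ))
      + (T x 1 0 • Matrix.single 1 0 (1 : ℂ) + T x 1 1 • Matrix.single 1 1 (1 : ℂ)) : Mat) := by
    ext x i j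
    fin_cases i <;> fin_cases j <;> simp [Matrix.single]
  have t : ∀ i j, Tame fun x => (T x i j • Matrix.single i j (1 : ℂ) : Mat) := fun i j =>
    (Tame.clm ((ContinuousLinearMap.toSpanSingleton ℂ
      (Matrix.single i j (1 : ℂ) : Mat)).restrictScalars ℝ)).comp (h i j)
  rw [e]
  exact ((t 0 0).add (t 0 1)).add ((t 1 0).add (t 1 1))

theorem tame_coeff_fst (n : ℤ) : Tame fun x : Coeffs => (x.1 n : ℂ) :=
  Tame.clm (Complex.ofRealCLM.comp ((evalL n).comp (ContinuousLinearMap.fst ℝ Seq Seq)))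

theorem tame_coeff_snd (n : ℤ) : Tame fun x : Coeffs => (x.2 n : ℂ) :=
  Tame.clm (Complex.ofRealCLM.comp ((evalL n).comp (ContinuousLinearMap.snd ℝ Seq Seq)))

theorem RapidDecay.tame_entry {c : ℕ → ℂ} (hc : RapidDecay c) (i j : ℤ) :
    Tame fun x => entry (funOp c x) i j :=
  (Tame.clm ((entryL i j).restrictScalars ℝ)).comp (tame_funOp hc)

theorem RapidDecay.tame_bDiag {c : ℕ → ℂ} (hc : RapidDecay c) (z : ℂ) : Tame (bDiag c z) :=
  ((((Tame.const z).sub (tame_coeff_snd 1)).mul ((hc.tail z).tame_entry 1 1)).sub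
    ((tame_coeff_fst 1).mul ((hc.tail z).tame_entry 1 2))).add
    ((tame_coeff_fst 0).mul ((hc.tail z).tame_entry 0 1))

theorem RapidDecay.tame_bMat {c : ℕ → ℂ} (hc : RapidDecay c) (z : ℂ) : Tame (bMat c z) := by
  refine tame_matrix fun i j => ?_
  fin_cases i <;> fin_cases j
  · exact hc.tame_bDiag z
  · exact (Tame.const 2).mul ((hc.tail z).tame_entry 1 1)
  · have h := ((Tame.const 2).mul (((tame_coeff_fst 0).mul (tame_coeff_fst 0)).mul
      ((hc.tail z).tame_entry 0 0))).neg
    simp only [← pow_two] at h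
    exact h
  · exact (hc.tame_bDiag z).neg

/-- The vector field of the Toda flow of `c`, joined with the equation for the Toda cocycle at the
spectral parameter `z`. -/
def extField (c : ℕ → ℂ) (z : ℂ) (p : Coeffs × Mat) : Coeffs × Mat :=
  (field c p.1, bMat c z p.1 * p.2)

theorem RapidDecay.tame_extField {c : ℕ → ℂ} (hc : RapidDecay c) (z : ℂ) :
    Tame (extField c z) :=
  (hc.tame_field.comp (Tame.clm (ContinuousLinearMap.fst ℝ Coeffs Mat))).prodMk
    (((hc.tame_bMat z).comp (Tame.clm (ContinuousLinearMap.fst ℝ Coeffs Mat))).mul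
      (Tame.clm (ContinuousLinearMap.snd ℝ Coeffs Mat)))

theorem hasDerivAt_line {E : Type*} [NormedAddCommGroup E] [NormedSpace ℝ E] (x v : E) :
    HasDerivAt (fun s : ℝ => x + s • v) v 0 := by
  simpa using ((hasDerivAt_id (0 : ℝ)).smul_const v).const_add x

theorem hasDerivAt_fderiv_line {E F : Type*} [NormedAddCommGroup E] [NormedSpace ℝ E]
    [NormedAddCommGroup F] [NormedSpace ℝ F] {f : E → F} (hf : Differentiable ℝ f) (x v : E) :
    HasDerivAt (fun s : ℝ => f (x + s • v)) (fderiv ℝ f x v) 0 := by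
  have h := (hf (x + (0 : ℝ) • v)).hasFDerivAt.comp_hasDerivAt 0 (hasDerivAt_line x v)
  simpa using! h

theorem hasDerivAt_field_line (k : ℕ → ℂ) (x : Coeffs) :
    HasDerivAt (fun s : ℝ => x + s • field k x) (field k (x + (0 : ℝ) • field k x)) 0 := by
  simpa using hasDerivAt_line x (field k x)

/-- The derivative of the Toda field of `c` in the direction of the Toda field of `k`, in terms of
the derivatives of the matrix elements. -/
theorem RealRapid.fderiv_field {k c : ℕ → ℂ} (hk : RealRapid k) (hc : RealRapid c) (x : Coeffs)
    (n : ℤ) :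
    ((fderiv ℝ (field c) x (field k x)).1 n : ℂ)
        = x.1 n * (entry (funOp k x) (n + 1) (n + 1) - entry (funOp k x) n n)
            * (entry (funOp c x) (n + 1) (n + 1) - entry (funOp c x) n n)
          + x.1 n * (lieEntry k c x (n + 1) (n + 1) - lieEntry k c x n n) ∧
      ((fderiv ℝ (field c) x (field k x)).2 n : ℂ)
        = 2 * ((x.1 n * (entry (funOp k x) (n + 1) (n + 1) - entry (funOp k x) n n)
              * entry (funOp c x) n (n + 1) + x.1 n * lieEntry k c x n (n + 1))
          - (x.1 (n - 1) * (entry (funOp k x) (n - 1 + 1) (n - 1 + 1)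
                - entry (funOp k x) (n - 1) (n - 1)) * entry (funOp c x) (n - 1) (n - 1 + 1)
            + x.1 (n - 1) * lieEntry k c x (n - 1) (n - 1 + 1))) := by
  have hx := hasDerivAt_field_line k x
  have h := hasDerivAt_fderiv_line hc.rapid.tame_field.differentiable x (field k x)
  have ha := fun n => hasDerivAt_coeff_fst hx n
  have hF := fun i j => hk.hasDerivAt_entry hx hc.rapid i j
  simp only [hk.field_fst, zero_smul, add_zero] at ha hF
  constructor
  · have h1 := hasDerivAt_coeff_fst h n
    simp only [hc.field_fst] at h1
    have h2 := (ha n).mul ((hF (n + 1) (n + 1)).sub (hF n n))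
    have h3 := h1.unique h2
    simpa using! h3
  · have h1 := hasDerivAt_coeff_snd h n
    simp only [hc.field_snd] at h1
    have h2 := (((ha n).mul (hF n (n + 1))).sub ((ha (n - 1)).mul (hF (n - 1) n))).const_mul 2
    have h3 := h1.unique h2
    simpa using! h3

theorem Coeffs.ext_ofReal {x y : Coeffs} (h1 : ∀ n, (x.1 n : ℂ) = y.1 n)
    (h2 : ∀ n, (x.2 n : ℂ) = y.2 n) : x = y :=
  Prod.ext (BoundedContinuousFunction.ext fun n => Complex.ofReal_injective (h1 n))
    (BoundedContinuousFunction.ext fun n => Complex.ofReal_injective (h2 n))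

/-- The Toda fields commute. -/
theorem RealRapid.fderiv_field_comm {k c : ℕ → ℂ} (hk : RealRapid k) (hc : RealRapid c)
    (x : Coeffs) : fderiv ℝ (field c) x (field k x) = fderiv ℝ (field k) x (field c x) := by
  refine Coeffs.ext_ofReal (fun n => ?_) fun n => ?_
  · rw [(hk.fderiv_field hc x n).1, (hc.fderiv_field hk x n).1, hk.lieEntry_diag hc,
      hk.lieEntry_diag hc]
    ring
  · rw [(hk.fderiv_field hc x n).2, (hc.fderiv_field hk x n).2]
    linear_combination 2 * (x.1 n : ℂ) * hk.lieEntry_succ hc x n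
      - 2 * (x.1 (n - 1) : ℂ) * hk.lieEntry_succ hc x (n - 1)

theorem RealRapid.fderiv_extField {k c : ℕ → ℂ} (hk : RealRapid k) (hc : RealRapid c) (z : ℂ)
    (p : Coeffs × Mat) : fderiv ℝ (extField c z) p (extField k z p)
      = (fderiv ℝ (field c) p.1 (field k p.1),
        (bMatDeriv k c z p.1 + bMat c z p.1 * bMat k z p.1) * p.2) := by
  have h := hasDerivAt_fderiv_line (hc.rapid.tame_extField z).differentiable p (extField k z p)
  have h1 := hasDerivAt_fderiv_line hc.rapid.tame_field.differentiable p.1 (field k p.1)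
  have h2 := hk.hasDerivAt_bMat (hasDerivAt_field_line k p.1) hc.rapid z
  have h3 := h1.prodMk (h2.mul (hasDerivAt_line p.2 (bMat k z p.1 * p.2)))
  refine (h.unique h3).trans ?_
  simp [add_mul, mul_assoc]

/-- The joint fields commute: this is the commutation of the Toda fields together with the zero
curvature equation for two of them. -/
theorem RealRapid.fderiv_extField_comm {k c : ℕ → ℂ} (hk : RealRapid k) (hc : RealRapid c) (z : ℂ)
    (p : Coeffs × Mat) : fderiv ℝ (extField c z) p (extField k z p)
      = fderiv ℝ (extField k z) p (extField c z p) := by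
  rw [hk.fderiv_extField hc, hc.fderiv_extField hk, hk.fderiv_field_comm hc,
    hk.bMatDeriv_add_mul hc]

/-- Bounds for the solutions of the joint system, also with a cutoff `χ`: the Toda flow conserves
the operator norm, and then the equation for the cocycle is linear with bounded coefficients. -/
theorem RealRapid.extField_bound {c : ℕ → ℂ} (hc : RealRapid c) (z : ℂ) (R T : ℝ) :
    ∃ R', ∀ (χ : ℝ → ℝ) (q : ℝ → Coeffs × Mat), (∀ t, 0 ≤ χ t ∧ χ t ≤ 1) → ‖q 0‖ ≤ R →
      (∀ t ∈ Icc (-T) T, HasDerivWithinAt q (χ t • extField c z (q t)) (Icc (-T) T) t) →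
      ∀ t ∈ Icc (-T) T, ‖q t‖ ≤ R' := by
  obtain ⟨C, hC0, hC⟩ := (hc.rapid.tame_bMat z).exists_bound (‖opL‖ * R)
  refine ⟨max (‖opL‖ * R) (R * Real.exp (C * T)), fun χ q hχ h0 hq t ht => ?_⟩
  have hx : ∀ t ∈ Icc (-T) T, HasDerivWithinAt (fun t => (q t).1) (χ t • field c (q t).1)
      (Icc (-T) T) t := fun t ht =>
    (ContinuousLinearMap.fst ℝ Coeffs Mat).hasFDerivAt.comp_hasDerivWithinAt t (hq t ht)
  have hY : ∀ t ∈ Icc (-T) T, HasDerivWithinAt (fun t => (q t).2)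
      (χ t • (bMat c z (q t).1 * (q t).2)) (Icc (-T) T) t := fun t ht =>
    (ContinuousLinearMap.snd ℝ Coeffs Mat).hasFDerivAt.comp_hasDerivWithinAt t (hq t ht)
  have h1 : ∀ t ∈ Icc (-T) T, ‖(q t).1‖ ≤ ‖opL‖ * R := fun t ht => by
    refine (norm_le_norm_opL _).trans ?_
    rw [hc.norm_conserved hx t ht]
    refine (opL.le_opNorm _).trans ?_
    gcongr
    exact (norm_fst_le _).trans h0
  refine max_le_max (h1 t ht) ?_
  refine (norm_le_of_norm_deriv_le hY (K := C) (fun t ht => ?_) t ht).trans ?_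
  · rw [norm_smul, Real.norm_eq_abs, abs_of_nonneg (hχ t).1]
    refine (mul_le_mul (hχ t).2 (norm_mul_le _ _) (norm_nonneg _) zero_le_one).trans ?_
    rw [one_mul]
    gcongr
    exact hC _ (h1 t ht)
  · gcongr
    · exact (norm_nonneg _).trans h0
    · exact (norm_snd_le _).trans h0
    · exact abs_le.mpr ht

theorem RealRapid.exists_extFlow {c : ℕ → ℂ} (hc : RealRapid c) (z : ℂ) (p : Coeffs × Mat) :
    ∃ q : ℝ → Coeffs × Mat, q 0 = p ∧ ∀ t, HasDerivAt q (extField c z (q t)) t := by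
  have : CompleteSpace Mat := FiniteDimensional.complete ℂ Mat
  refine (hc.rapid.tame_extField z).exists_global p fun T hT => ?_
  obtain ⟨R', h⟩ := hc.extField_bound z ‖p‖ T
  exact ⟨R', fun χ q hχ h0 hq => h (fun t => χ (q t)) q (fun t => hχ _) (by rw [h0]) hq⟩

/-- The joint solution of the Toda flow and the cocycle equation with initial value `p`. -/
def extFlow {c : ℕ → ℂ} (hc : RealRapid c) (z : ℂ) (p : Coeffs × Mat) : ℝ → Coeffs × Mat :=
  (hc.exists_extFlow z p).choose

section extFlow

variable {c k : ℕ → ℂ} (hc : RealRapid c) (hk : RealRapid k) (z : ℂ)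

@[simp]
theorem extFlow_zero (p : Coeffs × Mat) : extFlow hc z p 0 = p :=
  (hc.exists_extFlow z p).choose_spec.1

theorem hasDerivAt_extFlow (p : Coeffs × Mat) (t : ℝ) :
    HasDerivAt (extFlow hc z p) (extField c z (extFlow hc z p t)) t :=
  (hc.exists_extFlow z p).choose_spec.2 t

theorem extFlow_unique {q : ℝ → Coeffs × Mat} (hq : ∀ t, HasDerivAt q (extField c z (q t)) t) :
    q = extFlow hc z (q 0) :=
  (hc.rapid.tame_extField z).unique hq (hasDerivAt_extFlow hc z _) (extFlow_zero hc z _).symm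

theorem extFlow_bound (R S : ℝ) :
    ∃ R', ∀ p, ‖p‖ ≤ R → ∀ s, |s| ≤ S → ‖extFlow hc z p s‖ ≤ R' := by
  obtain ⟨R', h⟩ := hc.extField_bound z R S
  refine ⟨R', fun p hp s hs => h (fun _ => 1) _ (fun _ => ⟨zero_le_one, le_rfl⟩) ?_ (fun t ht => ?_)
    s (abs_le.mp hs)⟩
  · rwa [extFlow_zero]
  · rw [one_smul]
    exact (hasDerivAt_extFlow hc z p t).hasDerivWithinAt

/-- The composition of two commuting flows at equal times is the flow of the sum of the fields. -/
theorem hasDerivAt_extFlow_extFlow (p : Coeffs × Mat) (t : ℝ) :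
    HasDerivAt (fun t => extFlow hc z (extFlow hk z p t) t)
      (extField c z (extFlow hc z (extFlow hk z p t) t)
        + extField k z (extFlow hc z (extFlow hk z p t) t)) t :=
  Tame.hasDerivAt_flow_comp (hc.rapid.tame_extField z) (hk.rapid.tame_extField z)
    (fun p => hk.fderiv_extField_comm hc z p) (Φ := fun s p => extFlow hc z p s)
    (fun p => extFlow_zero hc z p) (fun p s => hasDerivAt_extFlow hc z p s)
    (extFlow_bound hc z) (fun t => hasDerivAt_extFlow hk z p t) t

end extFlow

section flow

variable {c k m : ℕ → ℂ} (hc : RealRapid c) (hk : RealRapid k) (hm : RealRapid m)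

/-- The Toda flow of `c` on the pairs of coefficient sequences. It is the first component of the joint
flow, which does not depend on the spectral parameter, here taken as `0`. -/
def flow (x : Coeffs) (t : ℝ) : Coeffs := (extFlow hc 0 (x, 1) t).1

/-- The Toda cocycle at the spectral parameter `z` and time `t`: the solution `T` of
`T' = bMat c z (flow x t) * T` with `T = 1` at time `0`. -/
def fund (z : ℂ) (x : Coeffs) (t : ℝ) : Mat := (extFlow hc z (x, 1) t).2

@[simp]
theorem flow_zero (x : Coeffs) : flow hc x 0 = x := by simp [flow]

@[simp]
theorem fund_zero (z : ℂ) (x : Coeffs) : fund hc z x 0 = 1 := by simp [fund]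

theorem hasDerivAt_flow (x : Coeffs) (t : ℝ) :
    HasDerivAt (flow hc x) (field c (flow hc x t)) t :=
  (ContinuousLinearMap.fst ℝ Coeffs Mat).hasFDerivAt.comp_hasDerivAt t
    (hasDerivAt_extFlow hc 0 (x, 1) t)

theorem continuous_flow (x : Coeffs) : Continuous (flow hc x) :=
  continuous_iff_continuousAt.mpr fun t => (hasDerivAt_flow hc x t).continuousAt

theorem flow_unique {y : ℝ → Coeffs} (hy : ∀ t, HasDerivAt y (field c (y t)) t) :
    y = flow hc (y 0) :=
  hc.rapid.tame_field.unique hy (hasDerivAt_flow hc _) (flow_zero hc _).symm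

theorem extFlow_fst (z : ℂ) (p : Coeffs × Mat) (t : ℝ) :
    (extFlow hc z p t).1 = flow hc p.1 t := by
  have h := flow_unique hc (y := fun t => (extFlow hc z p t).1) fun t =>
    (ContinuousLinearMap.fst ℝ Coeffs Mat).hasFDerivAt.comp_hasDerivAt t
      (hasDerivAt_extFlow hc z p t)
  simpa using congrFun h t

theorem hasDerivAt_fund (z : ℂ) (x : Coeffs) (t : ℝ) :
    HasDerivAt (fund hc z x) (bMat c z (flow hc x t) * fund hc z x t) t := by
  have h := (ContinuousLinearMap.snd ℝ Coeffs Mat).hasFDerivAt.comp_hasDerivAt t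
    (hasDerivAt_extFlow hc z (x, 1) t)
  have e := extFlow_fst hc z (x, 1) t
  simp only [ContinuousLinearMap.coe_snd', extField] at h
  rw [e] at h
  exact h

theorem eq_extFlow {z : ℂ} {x : Coeffs} {Y : ℝ → Mat}
    (hY : ∀ t, HasDerivAt Y (bMat c z (flow hc x t) * Y t) t) (t : ℝ) :
    (flow hc x t, Y t) = extFlow hc z (x, Y 0) t := by
  have h := extFlow_unique hc z (q := fun t => (flow hc x t, Y t)) fun t =>
    (hasDerivAt_flow hc x t).prodMk (hY t)
  simpa using congrFun h t

/-- The solutions of the linear equation for the cocycle are determined by their initial values. -/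
theorem fund_unique {z : ℂ} {x : Coeffs} {Y : ℝ → Mat}
    (hY : ∀ t, HasDerivAt Y (bMat c z (flow hc x t) * Y t) t) (t : ℝ) :
    Y t = fund hc z x t * Y 0 := by
  have h := eq_extFlow hc hY t
  have h' := eq_extFlow hc (Y := fun t => fund hc z x t * Y 0) (z := z) (x := x) (fun t => by
    have := (hasDerivAt_fund hc z x t).mul_const (Y 0)
    rwa [mul_assoc] at this) t
  simp only [fund_zero, one_mul] at h'
  exact congrArg Prod.snd (h.trans h'.symm)

theorem extFlow_eq (z : ℂ) (x : Coeffs) (Y : Mat) (t : ℝ) :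
    extFlow hc z (x, Y) t = (flow hc x t, fund hc z x t * Y) := by
  have h := eq_extFlow hc (Y := fun t => fund hc z x t * Y) (z := z) (x := x) (fun t => by
    have := (hasDerivAt_fund hc z x t).mul_const Y
    rwa [mul_assoc] at this) t
  simp only [fund_zero, one_mul] at h
  exact h.symm

/-! ### Dependence of the flows on the entire function -/

theorem RapidDecay.psum_add {A : Type*} [NormedRing A] [NormedAlgebra ℂ A] [NormOneClass A]
    [CompleteSpace A] {c k m : ℕ → ℂ} (hc : RapidDecay c) (hk : RapidDecay k)
    (e : ∀ n, m n = c n + k n) (M : A) : psum m M = psum c M + psum k M :=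
  (hasSum_of_eq ((hc.hasSum M).add (hk.hasSum M)) fun n => by rw [e, add_smul]).tsum_eq

theorem RapidDecay.psum_smul {A : Type*} [NormedRing A] [NormedAlgebra ℂ A] [NormOneClass A]
    [CompleteSpace A] {c m : ℕ → ℂ} (hc : RapidDecay c) {s : ℂ}
    (e : ∀ n, m n = s * c n) (M : A) : psum m M = s • psum c M :=
  (hasSum_of_eq ((hc.hasSum M).const_smul s) fun n => by rw [e, mul_smul]).tsum_eq

theorem RapidDecay.tailCoeff_add {c k m : ℕ → ℂ} (hc : RapidDecay c) (hk : RapidDecay k)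
    (e : ∀ n, m n = c n + k n) (z : ℂ) (n : ℕ) :
    tailCoeff m z n = tailCoeff c z n + tailCoeff k z n :=
  (hasSum_of_eq ((hc.summable_tail z n).hasSum.add (hk.summable_tail z n).hasSum)
    fun n => by rw [e, add_mul]).tsum_eq

theorem RapidDecay.tailCoeff_smul {c m : ℕ → ℂ} (hc : RapidDecay c) {s : ℂ}
    (e : ∀ n, m n = s * c n) (z : ℂ) (n : ℕ) : tailCoeff m z n = s * tailCoeff c z n :=
  (hasSum_of_eq ((hc.summable_tail z n).hasSum.mul_left s)
    fun n => by rw [e, mul_assoc]).tsum_eq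

theorem RealRapid.field_add {c k m : ℕ → ℂ} (hc : RealRapid c) (hk : RealRapid k)
    (hm : RealRapid m) (e : ∀ n, m n = c n + k n) (x : Coeffs) :
    field m x = field c x + field k x := by
  have h := hc.rapid.psum_add hk.rapid e (opL x)
  refine Coeffs.ext_ofReal (fun n => ?_) fun n => ?_
  · simp only [Prod.fst_add, BoundedContinuousFunction.coe_add, Pi.add_apply, Complex.ofReal_add,
      hm.field_fst, hc.field_fst, hk.field_fst, funOp, h, entry_add]
    ring
  · simp only [Prod.snd_add, BoundedContinuousFunction.coe_add, Pi.add_apply, Complex.ofReal_add,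
      hm.field_snd, hc.field_snd, hk.field_snd, funOp, h, entry_add]
    ring

theorem RealRapid.field_smul {c m : ℕ → ℂ} (hc : RealRapid c) (hm : RealRapid m) {s : ℝ}
    (e : ∀ n, m n = s * c n) (x : Coeffs) : field m x = s • field c x := by
  have h := hc.rapid.psum_smul e (opL x)
  refine Coeffs.ext_ofReal (fun n => ?_) fun n => ?_
  · simp only [Prod.smul_fst, BoundedContinuousFunction.coe_smul, smul_eq_mul, Complex.ofReal_mul,
      hm.field_fst, hc.field_fst, funOp, h, entry_smul]
    ring
  · simp only [Prod.smul_snd, BoundedContinuousFunction.coe_smul, smul_eq_mul, Complex.ofReal_mul,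
      hm.field_snd, hc.field_snd, funOp, h, entry_smul]
    ring

theorem RapidDecay.bMat_add {c k m : ℕ → ℂ} (hc : RapidDecay c) (hk : RapidDecay k)
    (e : ∀ n, m n = c n + k n) (z : ℂ) (x : Coeffs) :
    bMat m z x = bMat c z x + bMat k z x := by
  have h := (hc.tail z).psum_add (hk.tail z) (hc.tailCoeff_add hk e z) (opL x)
  ext i j
  fin_cases i <;> fin_cases j <;> simp [bMat, bDiag, h, entry_add] <;> ring

theorem RapidDecay.bMat_smul {c m : ℕ → ℂ} (hc : RapidDecay c) {s : ℂ}
    (e : ∀ n, m n = s * c n) (z : ℂ) (x : Coeffs) : bMat m z x = s • bMat c z x := by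
  have h := (hc.tail z).psum_smul (hc.tailCoeff_smul e z) (opL x)
  ext i j
  fin_cases i <;> fin_cases j <;> simp [bMat, bDiag, h, entry_smul] <;> ring

/-- The joint flow of a sum is the composition of the joint flows. -/
theorem extFlow_add (e : ∀ n, m n = c n + k n) (z : ℂ) (p : Coeffs × Mat) (t : ℝ) :
    extFlow hm z p t = extFlow hc z (extFlow hk z p t) t := by
  have h := extFlow_unique hm z (q := fun t => extFlow hc z (extFlow hk z p t) t) fun t => by
    have h := hasDerivAt_extFlow_extFlow hc hk z p t
    convert! h using 1
    rw [extField, hc.field_add hk hm e, hc.rapid.bMat_add hk.rapid e, add_mul]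
    rfl
  have h' := congrFun h t
  simp only [extFlow_zero] at h'
  exact h'.symm

theorem flow_add (e : ∀ n, m n = c n + k n) (x : Coeffs) (t : ℝ) :
    flow hm x t = flow hc (flow hk x t) t := by
  have h := congrArg Prod.fst (extFlow_add hc hk hm e 0 (x, 1) t)
  simpa only [extFlow_fst] using h

theorem fund_add (e : ∀ n, m n = c n + k n) (z : ℂ) (x : Coeffs) (t : ℝ) :
    fund hm z x t = fund hc z (flow hk x t) t * fund hk z x t := by
  have h := congrArg Prod.snd (extFlow_add hc hk hm e z (x, 1) t)
  simpa only [extFlow_eq, mul_one] using h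

theorem extFlow_smul {s : ℝ} (e : ∀ n, m n = s * c n) (z : ℂ) (p : Coeffs × Mat) (t : ℝ) :
    extFlow hm z p t = extFlow hc z p (s * t) := by
  have h := extFlow_unique hm z (q := fun t => extFlow hc z p (s * t)) fun t => by
    have h := (hasDerivAt_extFlow hc z p (s * t)).scomp t ((hasDerivAt_id t).const_mul s)
    convert! h using 1
    rw [extField, hc.field_smul hm e, hc.rapid.bMat_smul e, mul_one, Matrix.smul_mul]
    rfl
  have h' := congrFun h t
  simp only [extFlow_zero, mul_zero] at h'
  exact h'.symm

theorem flow_smul {s : ℝ} (e : ∀ n, m n = s * c n) (x : Coeffs) (t : ℝ) :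
    flow hm x t = flow hc x (s * t) := by
  have h := congrArg Prod.fst (extFlow_smul hc hm e 0 (x, 1) t)
  simpa only [extFlow_fst] using h

/-! ### Positivity of the off-diagonal elements -/

/-- The elements `a_n` solve `a_n' = κ a_n` with a continuous function `κ`, hence they keep their
signs. -/
theorem flow_pos {x : Coeffs} {n : ℤ} (hx : 0 < x.1 n) (t : ℝ) : 0 < (flow hc x t).1 n := by
  set κ : ℝ → ℝ := fun t => (entry (funOp c (flow hc x t)) (n + 1) (n + 1)).re
    - (entry (funOp c (flow hc x t)) n n).re with hκ
  have hcont : Continuous κ :=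
    (Complex.continuous_re.comp ((hc.rapid.tame_entry _ _).contDiff.continuous.comp
      (continuous_flow hc x))).sub
    (Complex.continuous_re.comp ((hc.rapid.tame_entry _ _).contDiff.continuous.comp
      (continuous_flow hc x)))
  have hI : ∀ t, HasDerivAt (fun t => ∫ s in (0 : ℝ)..t, κ s) (κ t) t := fun t =>
    intervalIntegral.integral_hasDerivAt_right (hcont.intervalIntegrable _ _)
      hcont.stronglyMeasurable.stronglyMeasurableAtFilter hcont.continuousAt
  have hu : ∀ t, HasDerivAt (fun t => (flow hc x t).1 n) ((flow hc x t).1 n * κ t) t := fun t => by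
    have h := ((evalL n).comp (ContinuousLinearMap.fst ℝ Seq Seq)).hasFDerivAt.comp_hasDerivAt t
      (hasDerivAt_flow hc x t)
    have e := Toda.field_fst c (flow hc x t) n
    rw [hκ, ← e]
    exact h
  have hv : ∀ t, HasDerivAt
      (fun t => (flow hc x t).1 n * Real.exp (-∫ s in (0 : ℝ)..t, κ s)) 0 t := fun t => by
    convert! (hu t).mul (hI t).neg.exp using 1
    ring
  have h := is_const_of_deriv_eq_zero (fun t => (hv t).differentiableAt)
    (fun t => (hv t).deriv) t 0
  simp only [intervalIntegral.integral_same, neg_zero, Real.exp_zero, mul_one, flow_zero] at h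
  exact pos_of_mul_pos_left (h ▸ hx) (Real.exp_pos _).le

/-! ### Equivariance under shifts -/

/-- The shift of both coefficient sequences by `r`. -/
def shiftL (r : ℤ) : Coeffs →L[ℝ] Coeffs := (translL r).prodMap (translL r)

@[simp]
theorem shiftL_fst (r : ℤ) (x : Coeffs) (n : ℤ) : (shiftL r x).1 n = x.1 (n + r) := rfl

@[simp]
theorem shiftL_snd (r : ℤ) (x : Coeffs) (n : ℤ) : (shiftL r x).2 n = x.2 (n + r) := rfl

theorem entry_pow_shiftL (r : ℤ) (x : Coeffs) (n : ℕ) (i j : ℤ) :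
    entry (opL (shiftL r x) ^ n) i j = entry (opL x ^ n) (i + r) (j + r) := by
  induction n generalizing i j with
  | zero => simp [entry_one]
  | succ n ih =>
    rw [pow_succ, pow_succ, entry_mul_opL, entry_mul_opL, ih, ih, ih, shiftL_fst, shiftL_snd,
      shiftL_fst]
    ring_nf

theorem RapidDecay.entry_shiftL {c : ℕ → ℂ} (hc : RapidDecay c) (r : ℤ) (x : Coeffs) (i j : ℤ) :
    entry (funOp c (shiftL r x)) i j = entry (funOp c x) (i + r) (j + r) :=
  (hasSum_of_eq (hc.hasSum_entry (shiftL r x) i j) fun n => by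
    rw [entry_pow_shiftL]).unique (hc.hasSum_entry x (i + r) (j + r))

theorem RealRapid.field_shiftL {c : ℕ → ℂ} (hc : RealRapid c) (r : ℤ) (x : Coeffs) :
    field c (shiftL r x) = shiftL r (field c x) := by
  refine Coeffs.ext_ofReal (fun n => ?_) fun n => ?_
  · rw [hc.field_fst, shiftL_fst, shiftL_fst, hc.field_fst, hc.rapid.entry_shiftL,
      hc.rapid.entry_shiftL, add_right_comm]
  · rw [hc.field_snd, shiftL_snd, shiftL_fst, shiftL_fst, hc.field_snd, hc.rapid.entry_shiftL,
      hc.rapid.entry_shiftL, add_right_comm, sub_add_eq_add_sub]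

theorem flow_shiftL (r : ℤ) (x : Coeffs) (t : ℝ) :
    flow hc (shiftL r x) t = shiftL r (flow hc x t) := by
  have h := flow_unique hc (y := fun t => shiftL r (flow hc x t)) fun t => by
    rw [hc.field_shiftL]
    exact (shiftL r).hasFDerivAt.comp_hasDerivAt t (hasDerivAt_flow hc x t)
  have h' := congrFun h t
  simp only [flow_zero] at h'
  exact h'.symm

/-! ### The zero curvature equation for a flow and the shift -/

/-- The one step transfer matrix in terms of the coefficient sequences. -/
def stepMat (z : ℂ) (x : Coeffs) : Mat :=
  !![(z - x.2 1) / x.1 1, 1 / x.1 1; -x.1 1, 0]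

/-- The zero curvature equation, from the matrix elements `(1, 1)`, `(1, 2)` and `(0, 1)` of
`f(J) = f(z) + (J - z) q(J)`. -/
theorem RealRapid.hasDerivAt_stepMat {c : ℕ → ℂ} (hc : RealRapid c) (z : ℂ) {x : ℝ → Coeffs}
    {t : ℝ} (hx : HasDerivAt x (field c (x t)) t) (h0 : (x t).1 1 ≠ 0) :
    HasDerivAt (fun s => stepMat z (x s))
      (bMat c z (shiftL 1 (x t)) * stepMat z (x t) - stepMat z (x t) * bMat c z (x t)) t := by
  have ha := hasDerivAt_coeff_fst hx 1
  have hb := hasDerivAt_coeff_snd hx 1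
  rw [hc.field_fst] at ha
  rw [hc.field_snd] at hb
  norm_num at ha hb
  have h0' : ((x t).1 1 : ℂ) ≠ 0 := Complex.ofReal_ne_zero.mpr h0
  have hQ := (hc.rapid.tail z).entry_shiftL 1 (x t)
  have hF := hc.rapid.entry_shiftL 1 (x t) 1 1
  have hd := hc.rapid.bDiag_eq z (x t)
  have hd' := hc.rapid.bDiag_eq z (shiftL 1 (x t))
  have e11 := hc.rapid.entry_eq_left z (x t) 1 1
  have e12 := hc.rapid.entry_eq_left z (x t) 1 2
  have e01 := hc.rapid.entry_eq_right z (x t) 0 1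
  rw [(hc.rapid.tail z).entry_symm (x t) (1 + 1) 1] at e11
  rw [hF, shiftL_fst, hQ] at hd'
  norm_num at hd' e11 e12 e01
  refine hasDerivAt_matrix fun i j => ?_
  fin_cases i <;> fin_cases j
  · have h := (hb.const_sub z).div ha h0'
    convert! h using 1
    simp [stepMat, bMat, hQ, hd, hd']
    rw [eq_div_iff (pow_ne_zero 2 h0')]
    field_simp
    linear_combination 2 * (x t).1 1 * e12 - 2 * (x t).1 0 * e01
  · have h := (hasDerivAt_const t (1 : ℂ)).div ha h0'
    convert! h using 1
    simp [stepMat, bMat, hQ, hd, hd']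
    rw [eq_div_iff (pow_ne_zero 2 h0')]
    field_simp
    linear_combination -2 * e11
  · have h := ha.neg
    convert! h using 1
    simp [stepMat, bMat, hQ, hd, hd']
    field_simp
    linear_combination -2 * e11
  · have h := hasDerivAt_const t (0 : ℂ)
    convert! h using 1
    simp [stepMat, bMat, hQ]
    field_simp
    ring

/-- The cocycle relation between a flow and the shift by one. -/
theorem fund_mul_stepMat (z : ℂ) {x : Coeffs} (hx : 0 < x.1 1) (t : ℝ) :
    fund hc z (shiftL 1 x) t * stepMat z x = stepMat z (flow hc x t) * fund hc z x t := by
  have h := fund_unique hc (z := z) (x := shiftL 1 x)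
    (Y := fun t => stepMat z (flow hc x t) * fund hc z x t) (fun t => by
      have h := (hc.hasDerivAt_stepMat z (hasDerivAt_flow hc x t) (flow_pos hc hx t).ne').mul
        (hasDerivAt_fund hc z x t)
      convert! h using 1
      rw [flow_shiftL]
      noncomm_ring) t
  simp only [flow_zero, fund_zero, mul_one] at h
  exact h.symm

end flow

/-! ### Taylor coefficients of entire functions that are real on the real line -/

theorem im_deriv_ofReal {f : ℂ → ℂ} (hf : Differentiable ℂ f) (h : ∀ x : ℝ, (f x).im = 0) (x : ℝ) :
    (deriv f x).im = 0 := by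
  have h1 := Complex.imCLM.hasFDerivAt.comp_hasDerivAt x (hf x).hasDerivAt.comp_ofReal
  have h2 : HasDerivAt (fun y : ℝ => (f y).im) (deriv f x).im x := h1
  rw [funext h] at h2
  exact h2.unique (hasDerivAt_const x 0)

theorem im_iteratedDeriv_ofReal (n : ℕ) {f : ℂ → ℂ} (hf : Differentiable ℂ f)
    (h : ∀ x : ℝ, (f x).im = 0) (x : ℝ) : (iteratedDeriv n f x).im = 0 := by
  induction n generalizing f with
  | zero => simpa using h x
  | succ n ih =>
    rw [iteratedDeriv_succ']
    exact ih hf.deriv (im_deriv_ofReal hf h)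

theorem realRapid (f : RealEntire) : RealRapid (taylorCoeff f) where
  rapid := rapidDecay_taylorCoeff f.2.1
  real n := by
    have h := im_iteratedDeriv_ofReal n f.2.1 f.2.2 0
    rw [Complex.ofReal_zero] at h
    rw [taylorCoeff, ← Complex.ofReal_natCast, ← Complex.ofReal_inv, Complex.im_ofReal_mul, h,
      mul_zero]

theorem taylorCoeff_add (f g : RealEntire) (n : ℕ) :
    taylorCoeff (f + g : RealEntire) n = taylorCoeff f n + taylorCoeff g n := by
  rw [taylorCoeff, taylorCoeff, taylorCoeff, ← mul_add]
  congr 1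
  exact iteratedDeriv_add f.2.1.contDiff.contDiffAt g.2.1.contDiff.contDiffAt

theorem taylorCoeff_smul (s : ℝ) (f : RealEntire) (n : ℕ) :
    taylorCoeff (s • f : RealEntire) n = s * taylorCoeff f n := by
  have h : ((s • f : RealEntire) : ℂ → ℂ) = fun z => (s : ℂ) * (f : ℂ → ℂ) z :=
    funext fun z => by simp
  rw [taylorCoeff, taylorCoeff, h, iteratedDeriv_const_mul_field]
  ring

/-! ### The functional calculus of a Jacobi matrix -/

/-- The continuous functional calculus of a self-adjoint operator agrees with the power series, since
the Taylor series converges uniformly on the spectrum. -/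
theorem cfc_eq_psum {f : ℂ → ℂ} (hf : Differentiable ℂ f) {M : Op} (hM : IsSelfAdjoint M) :
    cfc f M = psum (taylorCoeff f) M := by
  have hn : IsStarNormal M := hM.isStarNormal
  have hc : ContinuousOn f (spectrum ℂ M) := hf.continuous.continuousOn
  have : Nontrivial Op := NormOneClass.nontrivial (G := Op)
  have : Nonempty (spectrum ℂ M) := (spectrum.nonempty M).to_subtype
  -- The series is summed in the algebra of continuous functions on the spectrum.
  set X : C(spectrum ℂ M, ℂ) := (ContinuousMap.id ℂ).restrict (spectrum ℂ M) with hX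
  have h1 := (rapidDecay_taylorCoeff hf).hasSum X
  have h2 : psum (taylorCoeff f) X = ⟨_, hc.domRestrict⟩ := by
    ext w
    have h3 := h1.map (ContinuousMap.evalCLM ℂ w) (ContinuousMap.evalCLM ℂ w).continuous
    exact h3.unique (hasSum_taylorCoeff hf w)
  rw [h2] at h1
  have h4 := h1.map (cfcHom hn) (cfcHom_continuous hn)
  rw [cfc_apply f M hn hc]
  refine h4.unique (hasSum_of_eq ((rapidDecay_taylorCoeff hf).hasSum M) fun n => ?_)
  simp only [Function.comp_apply, map_smul, map_pow, hX, cfcHom_id hn]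

theorem funcCalc_eq (f : RealEntire) (J : JacobiMatrix) :
    funcCalc f J = funOp (taylorCoeff f) J.toCoeffs := by
  rw [funcCalc, J.op_eq, cfc_eq_psum f.2.1 (isSelfAdjoint_opL _)]

/-! ### The Lax equation in terms of the coefficients -/

theorem antiPart_eq (f : RealEntire) (J : JacobiMatrix) (j k : ℤ) :
    antiPart f J j k = entry (antiOp (funOp (taylorCoeff f) J.toCoeffs)) j k := by
  rw [(realRapid f).entry_antiOp, antiPart, funcCalc_eq]
  rcases lt_trichotomy j k with h | h | h
  · rw [if_pos h, sgn_of_pos (by omega : 0 < k - j), one_mul]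
  · subst h
    simp [sgn_zero]
  · rw [if_neg h.le.not_gt, if_pos h, sgn_of_neg (by omega : k - j < 0), neg_one_mul]

theorem sum_Icc_three (k : ℤ) (u : ℤ → ℂ) :
    ∑ l ∈ Finset.Icc (k - 1) (k + 1), u l = u (k - 1) + (u k + u (k + 1)) := by
  have e : Finset.Icc (k - 1) (k + 1) = {k - 1, k, k + 1} := by
    ext l
    simp only [Finset.mem_Icc, Finset.mem_insert, Finset.mem_singleton]
    omega
  rw [e, Finset.sum_insert, Finset.sum_pair]
  · omega
  · simp only [Finset.mem_insert, Finset.mem_singleton]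
    omega

theorem laxMatrix_eq (f : RealEntire) (J : JacobiMatrix) (j k : ℤ) :
    laxMatrix f J j k = entry (opL (field (taylorCoeff f) J.toCoeffs)) j k := by
  rw [laxMatrix]
  split_ifs with h
  · rw [(realRapid f).opL_field, entry_sub, entry_mul_opL, entry_opL_mul, sum_Icc_three,
      sum_Icc_three, J.op_eq]
    simp only [antiPart_eq, entry_opL]
    simp
    ring_nf
    split_ifs <;> first | omega | ring
  · rw [entry_opL, if_neg, if_neg, if_neg] <;>
    · rintro rfl
      simp at h

theorem isLaxSolution_iff (f : RealEntire) (J : JacobiMatrix) (γ : ℝ → JacobiMatrix) :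
    IsLaxSolution f J γ ↔ γ 0 = J ∧ ∀ t, HasDerivAt (fun s => (γ s).toCoeffs)
      (field (taylorCoeff f) (γ t).toCoeffs) t := by
  have e : (fun s => (γ s).op) = fun s => opL (γ s).toCoeffs := funext fun s => (γ s).op_eq
  constructor
  · rintro ⟨h0, h⟩
    refine ⟨h0, fun t => ?_⟩
    obtain ⟨D, hD, h1⟩ := h t
    have h2 : D = opL (field (taylorCoeff f) (γ t).toCoeffs) := entry_ext fun j k => by
      rw [hD, laxMatrix_eq]
    rw [h2, e] at h1
    have h3 := coeffsL.hasFDerivAt.comp_hasDerivAt t h1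
    simpa only [Function.comp_def, coeffsL_opL] using h3
  · rintro ⟨h0, h⟩
    refine ⟨h0, fun t => ⟨_, fun j k => (laxMatrix_eq f (γ t) j k).symm, ?_⟩⟩
    rw [e]
    exact opL.hasFDerivAt.comp_hasDerivAt t (h t)

/-- The solution of the Lax equation with initial value `J`. -/
def todaCurve (f : RealEntire) (J : JacobiMatrix) (t : ℝ) : JacobiMatrix :=
  JacobiMatrix.ofCoeffs (flow (realRapid f) J.toCoeffs t)
    fun n => flow_pos (realRapid f) (J.a_pos n) t

theorem isLaxSolution_todaCurve (f : RealEntire) (J : JacobiMatrix) :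
    IsLaxSolution f J (todaCurve f J) :=
  (isLaxSolution_iff _ _ _).mpr ⟨JacobiMatrix.toCoeffs_injective (flow_zero (realRapid f) _),
    hasDerivAt_flow (realRapid f) _⟩

theorem IsLaxSolution.eq_todaCurve {f : RealEntire} {J : JacobiMatrix} {γ : ℝ → JacobiMatrix}
    (h : IsLaxSolution f J γ) : γ = todaCurve f J := by
  obtain ⟨h0, h1⟩ := (isLaxSolution_iff _ _ _).mp h
  funext t
  have h2 := congrFun (flow_unique (realRapid f) h1) t
  rw [h0] at h2
  exact JacobiMatrix.toCoeffs_injective h2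

theorem todaMap_eq (f : RealEntire) (J : JacobiMatrix) : todaMap f J = todaCurve f J 1 := by
  have h : ∃ γ, IsLaxSolution f J γ := ⟨_, isLaxSolution_todaCurve f J⟩
  rw [todaMap, dif_pos h]
  exact congrFun h.choose_spec.eq_todaCurve 1

theorem toCoeffs_todaMap (f : RealEntire) (J : JacobiMatrix) :
    (todaMap f J).toCoeffs = flow (realRapid f) J.toCoeffs 1 := by
  rw [todaMap_eq]
  rfl

theorem toCoeffs_todaMap_smul (f : RealEntire) (t : ℝ) (J : JacobiMatrix) :
    (todaMap (t • f) J).toCoeffs = flow (realRapid f) J.toCoeffs t := by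
  rw [toCoeffs_todaMap, flow_smul (realRapid f) _ (taylorCoeff_smul t f), mul_one]

theorem todaMap_smul (f : RealEntire) (J : JacobiMatrix) :
    (fun t : ℝ => todaMap (t • f) J) = todaCurve f J :=
  funext fun t => JacobiMatrix.toCoeffs_injective (toCoeffs_todaMap_smul f t J)

/-! ### The Laurent coefficients of `f g_n` and `f h_n` -/

/-- Laurent coefficients of the product of an entire function and a series in `1 / w`. -/
theorem hasSum_laurentCoeff {f : ℂ → ℂ} (hf : Differentiable ℂ f) {R : ℝ} (hR : 0 < R) {L : ℂ → ℂ}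
    {d : ℕ → ℂ} (hd : Summable fun n => ‖d n‖ * R⁻¹ ^ n)
    (hL : ∀ w : ℂ, ‖w‖ = R → HasSum (fun n => d n * w⁻¹ ^ n) (L w)) (m : ℕ) :
    HasSum (fun n => d n * taylorCoeff f (m + n)) (laurentCoeff R (fun w => f w * L w) m) := by
  set u : ℕ → ℂ → ℂ := fun n w => f w * (d n * w⁻¹ ^ n) / w ^ (m + 1) with hu
  obtain ⟨C, hC⟩ := (isCompact_sphere (0 : ℂ) R).exists_bound_of_continuousOn
    hf.continuous.continuousOn
  have hb : ∀ n w, w ∈ sphere (0 : ℂ) R →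
      ‖u n w‖ ≤ C * (R ^ (m + 1))⁻¹ * (‖d n‖ * R⁻¹ ^ n) := fun n w hw => by
    have hw' : ‖w‖ = R := by simpa using hw
    rw [hu, norm_div, norm_mul, norm_mul, norm_pow, norm_pow, norm_inv, hw', div_eq_mul_inv]
    calc ‖f w‖ * (‖d n‖ * R⁻¹ ^ n) * (R ^ (m + 1))⁻¹
        ≤ C * (‖d n‖ * R⁻¹ ^ n) * (R ^ (m + 1))⁻¹ := by gcongr; exact hC w hw
      _ = _ := by ring
  have hbs := hd.mul_left (C * (R ^ (m + 1))⁻¹)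
  have hcont : ∀ n, ContinuousOn (u n) (sphere 0 R) := fun n => by
    have h0 : ∀ w ∈ sphere (0 : ℂ) R, w ≠ 0 := fun w hw h => by
      rw [h] at hw
      simp at hw
      exact hR.ne hw
    exact (hf.continuous.continuousOn.mul (continuousOn_const.mul
      ((continuousOn_id.inv₀ h0).pow n))).div (continuousOn_id.pow _)
      fun w hw => pow_ne_zero _ (h0 w hw)
  have hint : ∀ n, (2 * Real.pi * Complex.I)⁻¹ * ∮ w in C(0, R), u n w
      = d n * taylorCoeff f (m + n) := fun n => by
    have e : u n = fun w => d n * ((1 / (w - 0) ^ (m + n + 1)) • f w) := funext fun w => by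
      simp only [hu, sub_zero, smul_eq_mul, inv_pow, div_eq_mul_inv]
      rw [show m + n + 1 = n + (m + 1) by ring, pow_add w n (m + 1), mul_inv]
      ring
    rw [e, circleIntegral.integral_const_mul,
      hf.differentiableOn.circleIntegral_one_div_sub_center_pow_smul hR, taylorCoeff, smul_eq_mul]
    have := Complex.two_pi_I_ne_zero
    field_simp
  have hlim := (tendstoUniformlyOn_tsum_nat hbs hb).tendsto_circleIntegral_of_continuousOn hR.le
    (Eventually.of_forall fun N => continuousOn_finsetSum _ fun n _ => hcont n)
  have htsum : ∮ w in C(0, R), ∑' n, u n w = ∮ w in C(0, R), f w * L w / w ^ (m + 1) := by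
    have h : EqOn (fun w => ∑' n, u n w) (fun w => f w * L w / w ^ (m + 1)) (sphere 0 R) :=
      fun w hw => (((hL w (by simpa using hw)).mul_left (f w)).div_const (w ^ (m + 1))).tsum_eq
    exact circleIntegral.integral_congr hR.le h
  have hsummable : Summable fun n => d n * taylorCoeff f (m + n) := by
    have hI : ∀ n, ‖∮ w in C(0, R), u n w‖
        ≤ 2 * Real.pi * R * (C * (R ^ (m + 1))⁻¹ * (‖d n‖ * R⁻¹ ^ n)) := fun n =>
      circleIntegral.norm_integral_le_of_norm_le_const hR.le (hb n)
    have hI' : Summable fun n => ∮ w in C(0, R), u n w :=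
      Summable.of_norm_bounded (hbs.mul_left (2 * Real.pi * R)) hI
    exact (hI'.mul_left ((2 * Real.pi * Complex.I)⁻¹)).congr hint
  rw [hsummable.hasSum_iff_tendsto_nat, laurentCoeff, ← htsum]
  convert! hlim.const_mul ((2 * Real.pi * Complex.I : ℂ)⁻¹) using 2 with N
  rw [circleIntegral.integral_fun_sum fun n _ => (hcont n).circleIntegrable hR.le, Finset.mul_sum]
  exact Finset.sum_congr rfl fun n _ => (hint n).symm

/-- The Neumann series of the resolvent. -/
theorem hasSum_inverse_sub {M : Op} {w : ℂ} (hw : ‖M‖ < ‖w‖) :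
    HasSum (fun n => -(w⁻¹ ^ (n + 1)) • M ^ n) (Ring.inverse (M - algebraMap ℂ Op w)) := by
  have hw0 : w ≠ 0 := norm_pos_iff.mp ((norm_nonneg M).trans_lt hw)
  have ht : ‖w⁻¹ • M‖ < 1 := by
    rw [norm_smul, norm_inv, inv_mul_lt_iff₀ (norm_pos_iff.mpr hw0), mul_one]
    exact hw
  have hs := summable_geometric_of_norm_lt_one ht
  have h1 := hs.tsum_pow_mul_one_sub
  have h2 := hs.one_sub_mul_tsum_pow
  set S := ∑' n, (w⁻¹ • M) ^ n with hS
  have e : M - algebraMap ℂ Op w = (-w) • (1 - w⁻¹ • M) := by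
    rw [Algebra.algebraMap_eq_smul_one, smul_sub, smul_smul, neg_mul, mul_inv_cancel₀ hw0]
    simp only [neg_smul, one_smul]
    abel
  have e' : Ring.inverse (M - algebraMap ℂ Op w) = (-w⁻¹) • S := by
    have hu1 : (M - algebraMap ℂ Op w) * ((-w⁻¹) • S) = 1 := by
      rw [e, smul_mul_smul_comm, h2, neg_mul_neg, mul_inv_cancel₀ hw0, one_smul]
    have hu2 : ((-w⁻¹) • S) * (M - algebraMap ℂ Op w) = 1 := by
      rw [e, smul_mul_smul_comm, h1, neg_mul_neg, inv_mul_cancel₀ hw0, one_smul]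
    exact Ring.inverse_unit ⟨_, _, hu1, hu2⟩
  rw [e']
  refine hasSum_of_eq (hs.hasSum.const_smul (-w⁻¹)) fun n => ?_
  rw [smul_pow, smul_smul, pow_succ']
  congr 1
  ring

/-- The power series part of the product of an entire function with `φ ((M - w)⁻¹) + β`: it is
given by the divided difference of `f`. -/
theorem powerPart_eq {f : ℂ → ℂ} (hf : Differentiable ℂ f) (M : Op) (φ : Op →L[ℂ] ℂ) (β : ℂ)
    {R : ℝ} (hR : ‖M‖ < R) (z : ℂ) :
    powerPart R (fun w => f w * (φ (Ring.inverse (M - algebraMap ℂ Op w)) + β)) z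
      = β * f z - φ (psum (tailCoeff (taylorCoeff f) z) M) := by
  have hR0 : 0 < R := (norm_nonneg M).trans_lt hR
  have hc := rapidDecay_taylorCoeff hf
  -- The coefficients of `φ ((M - w)⁻¹) + β` in powers of `1 / w`.
  set d : ℕ → ℂ := fun n => Nat.casesOn n β fun k => -φ (M ^ k) with hd
  have hds : Summable fun n => ‖d n‖ * R⁻¹ ^ n := by
    rw [← summable_nat_add_iff 1]
    have hq : Summable fun n => ‖φ‖ * R⁻¹ * (‖M‖ * R⁻¹) ^ n :=
      (summable_geometric_of_lt_one (by positivity)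
        (by rw [← div_eq_mul_inv]; exact (div_lt_one hR0).mpr hR)).mul_left _
    refine Summable.of_nonneg_of_le (fun n => by positivity) (fun n => ?_) hq
    change ‖-φ (M ^ n)‖ * R⁻¹ ^ (n + 1) ≤ _
    rw [norm_neg]
    calc ‖φ (M ^ n)‖ * R⁻¹ ^ (n + 1) ≤ ‖φ‖ * ‖M‖ ^ n * R⁻¹ ^ (n + 1) := by
          gcongr
          exact (φ.le_opNorm _).trans (by gcongr; exact norm_pow_le _ _)
      _ = _ := by rw [mul_pow, pow_succ]; ring
  have hL : ∀ w : ℂ, ‖w‖ = R → HasSum (fun n => d n * w⁻¹ ^ n)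
      (φ (Ring.inverse (M - algebraMap ℂ Op w)) + β) := fun w hw => by
    have h := (hasSum_inverse_sub (hw ▸ hR : ‖M‖ < ‖w‖)).map φ φ.continuous
    rw [← hasSum_nat_add_iff' 1]
    have e : φ (Ring.inverse (M - algebraMap ℂ Op w)) + β - ∑ i ∈ Finset.range 1, d i * w⁻¹ ^ i
        = φ (Ring.inverse (M - algebraMap ℂ Op w)) := by simp [hd]
    rw [e]
    refine hasSum_of_eq h fun n => ?_
    simp only [Function.comp_apply, map_smul, smul_eq_mul, hd]
    ring
  have hlc : ∀ m, laurentCoeff R (fun w => f w * (φ (Ring.inverse (M - algebraMap ℂ Op w)) + β)) m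
      = β * taylorCoeff f m - dualTail (taylorCoeff f) M φ m := fun m => by
    have h := hasSum_laurentCoeff hf hR0 hds hL m
    rw [← hasSum_nat_add_iff' 1] at h
    have h' := h.unique (hasSum_of_eq (hc.summable_dualTail M φ m).hasSum.neg fun n => by
      simp only [hd]
      rw [← add_assoc]
      ring)
    have hd0 : d 0 = β := rfl
    simp only [Finset.range_one, Finset.sum_singleton, add_zero, hd0] at h'
    rw [sub_eq_iff_eq_add] at h'
    rw [h', dualTail, neg_add_eq_sub]
  rw [hc.apply_psum_tail, powerPart]
  have h1 := (hc.hasSum z).mul_left β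
  have h2 := (hc.dualTail M φ).hasSum z
  rw [psum_taylorCoeff hf] at h1
  refine (hasSum_of_eq (h1.sub h2) fun n => ?_).tsum_eq
  rw [hlc, smul_eq_mul, smul_eq_mul]
  ring

/-- `[f g_n](z) = -q(J)_{nn}`. -/
theorem fg_eq (f : RealEntire) (J : JacobiMatrix) (n : ℤ) (z : ℂ) :
    fg f J n z = -entry (divOp (taylorCoeff f) z J.toCoeffs) n n := by
  have h := powerPart_eq f.2.1 J.op (entryL n n) 0 (lt_add_one ‖J.op‖) z
  simp only [add_zero, zero_mul, zero_sub, entryL_apply] at h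
  rw [J.op_eq] at h
  rw [fg, J.op_eq]
  simpa only [gFun, green, J.op_eq] using h

/-- `[f h_n](z) = -f(z) - 2 a_n q(J)_{n+1,n}`. -/
theorem fh_eq (f : RealEntire) (J : JacobiMatrix) (n : ℤ) (z : ℂ) :
    fh f J n z = -(f : ℂ → ℂ) z
      - 2 * J.a n * entry (divOp (taylorCoeff f) z J.toCoeffs) (n + 1) n := by
  have h := powerPart_eq f.2.1 J.op ((2 * J.a n : ℂ) • entryL (n + 1) n) (-1)
    (lt_add_one ‖J.op‖) z
  simp only [FunLike.coe_smul, Pi.smul_apply, smul_eq_mul, entryL_apply,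
    neg_one_mul] at h
  rw [J.op_eq] at h
  rw [fh, J.op_eq]
  simpa only [hFun, green, J.op_eq, sub_eq_add_neg] using h

theorem bMatrix_eq (f : RealEntire) (J : JacobiMatrix) (z : ℂ) :
    bMatrix f J z = bMat (taylorCoeff f) z J.toCoeffs := by
  have h := (realRapid f).rapid.entry_eq_left z J.toCoeffs 1 1
  have hs := ((realRapid f).rapid.tail z).entry_symm J.toCoeffs 1 2
  rw [if_pos rfl, psum_taylorCoeff f.2.1] at h
  norm_num at h
  ext i j
  fin_cases i <;> fin_cases j <;>
    simp [bMatrix, bMat, bDiag, fg_eq, fh_eq, funcCalc_eq, h, hs] <;> ring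

theorem stepMatrix_eq (J : JacobiMatrix) (z : ℂ) : stepMatrix J z = stepMat z J.toCoeffs := rfl

theorem toCoeffs_shift (n : ℤ) (J : JacobiMatrix) :
    (J.shift n).toCoeffs = shiftL n J.toCoeffs := rfl

/-! ### The Toda cocycle takes values in `SL` -/

theorem norm_mat_le {M : Mat} {C : ℝ} (h : ∀ i j, ‖M i j‖ ≤ C) : ‖M‖ ≤ 2 * C := by
  have hC : 0 ≤ C := (norm_nonneg _).trans (h 0 0)
  lift C to ℝ≥0 using hC
  rw [Matrix.linfty_opNorm_def]
  have h2 : (2 * (C : ℝ)) = ((2 * C : ℝ≥0) : ℝ) := by push_cast; rfl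
  rw [h2, NNReal.coe_le_coe]
  refine Finset.sup_le fun i _ => ?_
  rw [Fin.sum_univ_two, two_mul]
  exact add_le_add (h i 0) (h i 1)

theorem RapidDecay.norm_divOp_le {c : ℕ → ℂ} (hc : RapidDecay c) (r : ℝ) :
    ∃ C, ∀ z : ℂ, ‖z‖ ≤ r → ∀ x, ‖opL x‖ ≤ r → ‖divOp c z x‖ ≤ C := by
  obtain ⟨C, hC0, hC⟩ := hc.exists_tail_le (abs_nonneg r)
  refine ⟨∑' k : ℕ, C * 2 * (1 / 2 : ℝ) ^ k, fun z hz x hx => ?_⟩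
  have hz' := hz.trans (le_abs_self r)
  have hx' := hx.trans (le_abs_self r)
  refine tsum_of_norm_bounded (summable_half (C * 2)).hasSum fun k => ?_
  refine (norm_smul_pow_le _ hx' k).trans ?_
  have h1 : HasSum (fun m : ℕ => C * (1 / 2 : ℝ) ^ k * (1 / 2 : ℝ) ^ m) (C * (1 / 2 : ℝ) ^ k * 2) :=
    hasSum_geometric_two.mul_left _
  have h2 := tsum_of_norm_bounded (f := fun m => c (m + k + 1) * z ^ m * ((|r| : ℝ) : ℂ) ^ k) h1
    fun m => by
      rw [norm_mul, norm_mul, norm_pow, norm_pow, Complex.norm_real, Real.norm_eq_abs, abs_abs]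
      calc ‖c (m + k + 1)‖ * ‖z‖ ^ m * |r| ^ k ≤ ‖c (m + k + 1)‖ * |r| ^ m * |r| ^ k := by gcongr
        _ = ‖c (m + k + 1)‖ * (|r| ^ m * |r| ^ k) := by ring
        _ ≤ C * ((1 / 2) ^ m * (1 / 2) ^ k) := hC m k
        _ = _ := by ring
  rw [tsum_mul_right, norm_mul, norm_pow, Complex.norm_real, Real.norm_eq_abs, abs_abs] at h2
  rw [tailCoeff]
  linarith

theorem Seq.norm_le (x : Coeffs) (n : ℤ) : ‖(x.1 n : ℂ)‖ ≤ ‖x‖ ∧ ‖(x.2 n : ℂ)‖ ≤ ‖x‖ := by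
  rw [Complex.norm_real, Complex.norm_real]
  exact ⟨(x.1.norm_coe_le_norm n).trans (norm_fst_le x), (x.2.norm_coe_le_norm n).trans
    (norm_snd_le x)⟩

/-- The matrices `B` are bounded, uniformly on bounded sets of spectral parameters and
coefficients. -/
theorem RapidDecay.norm_bMat_le {c : ℕ → ℂ} (hc : RapidDecay c) (r : ℝ) :
    ∃ C, 0 ≤ C ∧ ∀ z : ℂ, ‖z‖ ≤ r → ∀ x : Coeffs, ‖x‖ ≤ r → ‖bMat c z x‖ ≤ C := by
  obtain ⟨C, hC⟩ := hc.norm_divOp_le (max r (‖opL‖ * r))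
  refine ⟨2 * (2 * (1 + r) ^ 2 * (4 * |C|)), by positivity, fun z hz x hx => norm_mat_le ?_⟩
  have hr : 0 ≤ r := (norm_nonneg z).trans hz
  have hx' : ‖opL x‖ ≤ max r (‖opL‖ * r) :=
    ((opL.le_opNorm x).trans (by gcongr)).trans (le_max_right _ _)
  have hQ : ∀ i j, ‖entry (divOp c z x) i j‖ ≤ |C| := fun i j =>
    (norm_entry_le _ _ _).trans ((hC z (hz.trans (le_max_left _ _)) x hx').trans (le_abs_self C))
  have hC0 := abs_nonneg C
  have ha := fun n => (Seq.norm_le x n).1.trans hx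
  have hb := fun n => (Seq.norm_le x n).2.trans hx
  have hrC : 0 ≤ r * |C| := by positivity
  have hrC2 : 0 ≤ r ^ 2 * |C| := by positivity
  have hd : ‖bDiag c z x‖ ≤ 4 * r * |C| := by
    have h1 : ‖(z - x.2 1) * entry (divOp c z x) 1 1‖ ≤ 2 * r * |C| := by
      rw [norm_mul]
      gcongr
      · exact (norm_sub_le _ _).trans (by linarith [hb 1])
      · exact hQ 1 1
    have h2 : ‖(x.1 1 : ℂ) * entry (divOp c z x) 1 2‖ ≤ r * |C| := by
      rw [norm_mul]
      gcongr
      exacts [ha 1, hQ 1 2]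
    have h3 : ‖(x.1 0 : ℂ) * entry (divOp c z x) 0 1‖ ≤ r * |C| := by
      rw [norm_mul]
      gcongr
      exacts [ha 0, hQ 0 1]
    have h4 := norm_add_le ((z - x.2 1) * entry (divOp c z x) 1 1
      - x.1 1 * entry (divOp c z x) 1 2) (x.1 0 * entry (divOp c z x) 0 1)
    have h5 := norm_sub_le ((z - x.2 1) * entry (divOp c z x) 1 1)
      (x.1 1 * entry (divOp c z x) 1 2)
    rw [bDiag]
    linarith
  intro i j
  fin_cases i <;> fin_cases j
  · change ‖bDiag c z x‖ ≤ _
    nlinarith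
  · change ‖2 * entry (divOp c z x) 1 1‖ ≤ _
    rw [norm_mul, Complex.norm_ofNat]
    nlinarith [hQ 1 1]
  · change ‖-(2 * ((x.1 0 : ℂ) ^ 2 * entry (divOp c z x) 0 0))‖ ≤ _
    rw [norm_neg, norm_mul, norm_mul, norm_pow, Complex.norm_ofNat]
    have : ‖(x.1 0 : ℂ)‖ ^ 2 * ‖entry (divOp c z x) 0 0‖ ≤ r ^ 2 * |C| := by
      gcongr
      exacts [ha 0, hQ 0 0]
    nlinarith
  · change ‖-bDiag c z x‖ ≤ _
    rw [norm_neg]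
    nlinarith

theorem RapidDecay.differentiable_psum {c : ℕ → ℂ} (hc : RapidDecay c) :
    Differentiable ℂ (psum c : ℂ → ℂ) := by
  intro z
  have h : DifferentiableOn ℂ (psum c : ℂ → ℂ) (ball 0 (‖z‖ + 1)) :=
    Complex.differentiableOn_tsum_of_summable_norm (hc.summable (r := ‖z‖ + 1) (by positivity))
      (fun n => ((differentiable_id.pow n).const_smul (c n)).differentiableOn) isOpen_ball
      fun n w hw => norm_smul_pow_le c (mem_ball_zero_iff.mp hw).le n
  exact h.differentiableAt (isOpen_ball.mem_nhds (by simp))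

theorem RapidDecay.differentiable_entry_divOp {c : ℕ → ℂ} (hc : RapidDecay c) (x : Coeffs)
    (i j : ℤ) : Differentiable ℂ fun z => entry (divOp c z x) i j := by
  have e : (fun z => entry (divOp c z x) i j) = psum (Toda.dualTail c (opL x) (entryL i j)) :=
    funext fun z => hc.apply_psum_tail (opL x) (entryL i j) z
  rw [e]
  exact (hc.dualTail (opL x) (entryL i j)).differentiable_psum

theorem RapidDecay.differentiable_bMat {c : ℕ → ℂ} (hc : RapidDecay c) (x : Coeffs) :
    Differentiable ℂ fun z => bMat c z x := by
  have hQ := hc.differentiable_entry_divOp x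
  have hd : Differentiable ℂ fun z => bDiag c z x :=
    (((differentiable_id.sub_const _).mul (hQ 1 1)).sub ((hQ 1 2).const_mul _)).add
      ((hQ 0 1).const_mul _)
  have e : (fun z => bMat c z x) = fun z =>
      ((bDiag c z x • Matrix.single 0 0 (1 : ℂ)
        + (2 * entry (divOp c z x) 1 1) • Matrix.single 0 1 (1 : ℂ))
      + ((-(2 * (x.1 0 ^ 2 * entry (divOp c z x) 0 0))) • Matrix.single 1 0 (1 : ℂ)
        + (-bDiag c z x) • Matrix.single 1 1 (1 : ℂ)) : Mat) := by
    ext z i j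
    fin_cases i <;> fin_cases j <;> simp [Matrix.single, bMat]
  rw [e]
  exact ((hd.smul_const _).add (((hQ 1 1).const_mul 2).smul_const _)).add
    (((((hQ 0 0).const_mul _).const_mul 2).neg.smul_const _).add (hd.neg.smul_const _))

section SL

variable {c : ℕ → ℂ} (hc : RealRapid c)

/-- The determinant is conserved because `B` is traceless. -/
theorem det_fund (z : ℂ) (x : Coeffs) (t : ℝ) : (fund hc z x t).det = 1 := by
  have h : ∀ t, HasDerivAt (fun t => (fund hc z x t).det) 0 t := fun t => by
    have hT := hasDerivAt_matrix_entry (hasDerivAt_fund hc z x t)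
    simp only [Matrix.det_fin_two]
    convert! ((hT 0 0).mul (hT 1 1)).sub ((hT 0 1).mul (hT 1 0)) using 1
    simp only [Matrix.mul_apply, Fin.sum_univ_two]
    simp [bMat]
    ring
  have h' := is_const_of_deriv_eq_zero (fun t => (h t).differentiableAt) (fun t => (h t).deriv) t 0
  simpa using h'

theorem RealRapid.tailCoeff_im {c : ℕ → ℂ} (hc : RealRapid c) (r : ℝ) (n : ℕ) :
    (tailCoeff c r n).im = 0 := by
  have h := ((Complex.hasSum_iff _ _).mp (hc.rapid.summable_tail r n).hasSum).2
  refine h.unique (hasSum_of_eq hasSum_zero fun m => ?_)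
  rw [← Complex.ofReal_pow, Complex.im_mul_ofReal, hc.real, zero_mul]

theorem RealRapid.star_bMat {c : ℕ → ℂ} (hc : RealRapid c) (r : ℝ) (x : Coeffs) (i j : Fin 2) :
    star (bMat c r x i j) = bMat c r x i j := by
  have hQ : ∀ i j, star (entry (divOp c r x) i j) = entry (divOp c r x) i j := fun i j =>
    Complex.conj_eq_iff_im.mpr ((hc.rapid.tail r).entry_im (hc.tailCoeff_im r) x i j)
  have hd : star (bDiag c r x) = bDiag c r x := by
    simp [bDiag, hQ]
  fin_cases i <;> fin_cases j
  · exact hd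
  · simp [bMat, hQ]
  · simp [bMat, hQ]
  · simp [bMat, hd]

/-- For a real spectral parameter, the complex conjugate of the solution solves the same equation,
so the solution is real. -/
theorem im_fund (r : ℝ) (x : Coeffs) (t : ℝ) (i j : Fin 2) : (fund hc r x t i j).im = 0 := by
  have h := fund_unique hc (z := r) (x := x) (Y := fun t => (fund hc r x t).map star) (fun t => by
    refine hasDerivAt_matrix fun i j => ?_
    have h := Complex.conjCLE.toContinuousLinearMap.hasFDerivAt.comp_hasDerivAt t
      (hasDerivAt_matrix_entry (hasDerivAt_fund hc r x t) i j)
    convert! h using 1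
    simp only [Matrix.mul_apply, Fin.sum_univ_two, Matrix.map_apply]
    change _ = star _
    rw [star_add, star_mul', star_mul', hc.star_bMat, hc.star_bMat]) t
  simp only [fund_zero, Matrix.map_one star (star_zero ℂ) (star_one ℂ), mul_one] at h
  exact Complex.conj_eq_iff_im.mp (congrFun (congrFun h i) j)

/-! ### Analytic dependence on the spectral parameter -/

theorem continuous_fund (z : ℂ) (x : Coeffs) : Continuous (fund hc z x) :=
  continuous_iff_continuousAt.mpr fun t => (hasDerivAt_fund hc z x t).continuousAt

theorem continuous_bMat_flow (z : ℂ) (x : Coeffs) :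
    Continuous fun s => bMat c z (flow hc x s) :=
  (hc.rapid.tame_bMat z).contDiff.continuous.comp (continuous_flow hc x)

theorem exists_norm_flow_le (x : Coeffs) :
    ∃ ρ, ∀ s ∈ Icc (-1 : ℝ) 1, ‖flow hc x s‖ ≤ ρ :=
  isCompact_Icc.exists_bound_of_continuousOn (continuous_flow hc x).continuousOn

theorem exists_norm_bMat_flow_le (x : Coeffs) (r : ℝ) :
    ∃ C, 0 ≤ C ∧ ∀ z : ℂ, ‖z‖ ≤ r → ∀ s ∈ Icc (-1 : ℝ) 1, ‖bMat c z (flow hc x s)‖ ≤ C := by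
  obtain ⟨ρ, hρ⟩ := exists_norm_flow_le hc x
  obtain ⟨C, hC0, hC⟩ := hc.rapid.norm_bMat_le (max r ρ)
  exact ⟨C, hC0, fun z hz s hs => hC z (hz.trans (le_max_left _ _)) _
    ((hρ s hs).trans (le_max_right _ _))⟩

theorem exists_norm_fund_le (x : Coeffs) (r : ℝ) :
    ∃ C, 0 ≤ C ∧ ∀ z : ℂ, ‖z‖ ≤ r → ∀ s ∈ Icc (-1 : ℝ) 1, ‖fund hc z x s‖ ≤ C := by
  obtain ⟨C, hC0, hC⟩ := exists_norm_bMat_flow_le hc x r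
  refine ⟨‖(1 : Mat)‖ * Real.exp C, by positivity, fun z hz s hs => ?_⟩
  have h := norm_le_of_norm_deriv_le (K := C) (T := 1)
    (fun t _ => (hasDerivAt_fund hc z x t).hasDerivWithinAt)
    (fun t ht => (norm_mul_le _ _).trans (by gcongr; exact hC z hz t ht)) s hs
  rw [fund_zero] at h
  refine h.trans ?_
  gcongr
  exact mul_le_of_le_one_right hC0 (abs_le.mpr hs)

/-- A Lipschitz estimate for `B`, from the Schwarz lemma. -/
theorem exists_norm_bMat_sub_le (x : Coeffs) (z : ℂ) :
    ∃ K, 0 ≤ K ∧ ∀ z' ∈ ball z 1, ∀ s ∈ Icc (-1 : ℝ) 1,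
      ‖bMat c z' (flow hc x s) - bMat c z (flow hc x s)‖ ≤ K * ‖z' - z‖ := by
  obtain ⟨C, hC0, hC⟩ := exists_norm_bMat_flow_le hc x (‖z‖ + 1)
  refine ⟨2 * C, by positivity, fun z' hz' s hs => ?_⟩
  have hb : ∀ w ∈ ball z 1, ‖w‖ ≤ ‖z‖ + 1 := fun w hw => by
    have h1 : ‖w - z‖ < 1 := mem_ball_iff_norm.mp hw
    have h2 := norm_sub_norm_le w z
    linarith
  have h := Complex.dist_le_div_mul_dist_of_mapsTo_ball (c := z) (R₁ := 1) (R₂ := 2 * C)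
    (hc.rapid.differentiable_bMat (flow hc x s)).differentiableOn (fun w hw => by
      rw [mem_closedBall, dist_eq_norm]
      refine (norm_sub_le _ _).trans ?_
      rw [two_mul]
      exact add_le_add (hC w (hb w hw) s hs) (hC z (by linarith) s hs)) hz'
  simpa [dist_eq_norm] using h

/-- The inverse of the fundamental solution, which is its adjugate as the determinant is one. -/
def fundInv (z : ℂ) (x : Coeffs) (t : ℝ) : Mat := (fund hc z x t).adjugate

theorem fundInv_mul (z : ℂ) (x : Coeffs) (t : ℝ) : fundInv hc z x t * fund hc z x t = 1 := by
  rw [fundInv, Matrix.adjugate_mul, det_fund, one_smul]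

theorem mul_fundInv (z : ℂ) (x : Coeffs) (t : ℝ) : fund hc z x t * fundInv hc z x t = 1 := by
  rw [fundInv, Matrix.mul_adjugate, det_fund, one_smul]

theorem hasDerivAt_fundInv (z : ℂ) (x : Coeffs) (t : ℝ) :
    HasDerivAt (fundInv hc z x) (-(fundInv hc z x t * bMat c z (flow hc x t))) t := by
  have hT := hasDerivAt_matrix_entry (hasDerivAt_fund hc z x t)
  refine hasDerivAt_matrix fun i j => ?_
  simp only [fundInv, Matrix.adjugate_fin_two]
  fin_cases i <;> fin_cases j
  · convert! hT 1 1 using 1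
    simp [Matrix.mul_apply, Fin.sum_univ_two, bMat]
    ring
  · convert! (hT 0 1).neg using 1
    simp [Matrix.mul_apply, Fin.sum_univ_two, bMat]
    ring
  · convert! (hT 1 0).neg using 1
    simp [Matrix.mul_apply, Fin.sum_univ_two, bMat]
    ring
  · convert! hT 0 0 using 1
    simp [Matrix.mul_apply, Fin.sum_univ_two, bMat]
    ring

theorem continuous_fundInv (z : ℂ) (x : Coeffs) : Continuous (fundInv hc z x) :=
  continuous_iff_continuousAt.mpr fun t => (hasDerivAt_fundInv hc z x t).continuousAt

theorem hasDerivAt_fundInv_mul_fund (z z' : ℂ) (x : Coeffs) (t : ℝ) :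
    HasDerivAt (fun t => fundInv hc z x t * fund hc z' x t)
      (fundInv hc z x t * (bMat c z' (flow hc x t) - bMat c z (flow hc x t))
        * fund hc z' x t) t := by
  convert! (hasDerivAt_fundInv hc z x t).mul (hasDerivAt_fund hc z' x t) using 1
  noncomm_ring

/-- The comparison of the solutions for two spectral parameters by variation of constants. -/
theorem exists_norm_fundInv_mul_fund_le (x : Coeffs) (z : ℂ) :
    ∃ K, 0 ≤ K ∧ ∀ z' ∈ ball z 1, ∀ s ∈ Icc (0 : ℝ) 1,
      ‖fundInv hc z x s * (bMat c z' (flow hc x s) - bMat c z (flow hc x s)) * fund hc z' x s‖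
        ≤ K * ‖z' - z‖ := by
  obtain ⟨K, hK0, hK⟩ := exists_norm_bMat_sub_le hc x z
  obtain ⟨C, hC0, hC⟩ := exists_norm_fund_le hc x (‖z‖ + 1)
  obtain ⟨D, hD⟩ := isCompact_Icc.exists_bound_of_continuousOn (s := Icc (-1 : ℝ) 1)
    (continuous_fundInv hc z x).continuousOn
  have hD0 : 0 ≤ D := (norm_nonneg _).trans (hD 0 (by simp))
  refine ⟨D * K * C, by positivity, fun z' hz' s hs => ?_⟩
  have hs' : s ∈ Icc (-1 : ℝ) 1 := ⟨by linarith [hs.1], hs.2⟩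
  have hz'' : ‖z'‖ ≤ ‖z‖ + 1 := by
    have h1 : ‖z' - z‖ < 1 := mem_ball_iff_norm.mp hz'
    have h2 := norm_sub_norm_le z' z
    linarith
  calc _ ≤ D * (K * ‖z' - z‖) * C := by
        refine (norm_mul_le _ _).trans (mul_le_mul ((norm_mul_le _ _).trans
          (mul_le_mul (hD s hs') (hK z' hz' s hs') (norm_nonneg _) hD0)) (hC z' hz'' s hs')
          (norm_nonneg _) (by positivity))
    _ = _ := by ring

/-- Differentiability in a complex parameter of the solutions of a differential equation, under the
integral sign; at the parameter `z` itself the solution is constant. -/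
theorem differentiableAt_of_hasDerivAt_time {E : Type*} [NormedAddCommGroup E] [NormedSpace ℂ E]
    [CompleteSpace E] {z : ℂ} {W G : ℂ → ℝ → E} {D : ℝ → E} {K : ℝ} {w₀ : E}
    (hW : ∀ z' t, HasDerivAt (W z') (G z' t) t) (hG : ∀ z', Continuous (G z'))
    (h0 : ∀ z', W z' 0 = w₀) (hz : ∀ t, W z t = w₀)
    (hK : ∀ z' ∈ ball z 1, ∀ t ∈ Icc (0 : ℝ) 1, ‖G z' t‖ ≤ K * ‖z' - z‖)
    (hD : ∀ t ∈ Icc (0 : ℝ) 1, Tendsto (fun z' => (z' - z)⁻¹ • G z' t) (𝓝[≠] z) (𝓝 (D t))) :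
    DifferentiableAt ℂ (fun z' => W z' 1) z := by
  have hlim : Tendsto (fun z' => ∫ t in (0 : ℝ)..1, (z' - z)⁻¹ • G z' t) (𝓝[≠] z)
      (𝓝 (∫ t in (0 : ℝ)..1, D t)) := by
    refine intervalIntegral.tendsto_integral_filter_of_dominated_convergence (fun _ => K)
      (Eventually.of_forall fun z' => ((hG z').const_smul _).aestronglyMeasurable) ?_
      intervalIntegrable_const (Eventually.of_forall fun t ht => ?_)
    · filter_upwards [mem_nhdsWithin_of_mem_nhds (ball_mem_nhds z zero_lt_one),
        self_mem_nhdsWithin] with z' hz' hne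
      refine Eventually.of_forall fun t ht => ?_
      rw [uIoc_of_le zero_le_one] at ht
      rw [norm_smul, norm_inv, inv_mul_le_iff₀ (norm_pos_iff.mpr (sub_ne_zero.mpr hne)), mul_comm]
      exact hK z' hz' t ⟨ht.1.le, ht.2⟩
    · rw [uIoc_of_le zero_le_one] at ht
      exact hD t ⟨ht.1.le, ht.2⟩
  have h : HasDerivAt (fun z' => W z' 1) (∫ t in (0 : ℝ)..1, D t) z := by
    rw [hasDerivAt_iff_tendsto_slope]
    refine hlim.congr fun z' => ?_
    have h := intervalIntegral.integral_eq_sub_of_hasDerivAt (a := 0) (b := 1)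
      (fun t _ => hW z' t) ((hG z').intervalIntegrable 0 1)
    rw [slope, vsub_eq_sub, hz, ← h0 z', ← h]
    exact intervalIntegral.integral_smul _ _
  exact h.differentiableAt

/-- Continuity of the solutions in the spectral parameter. -/
theorem tendsto_fund (x : Coeffs) (z : ℂ) {s : ℝ} (hs : s ∈ Icc (0 : ℝ) 1) :
    Tendsto (fun z' => fund hc z' x s) (𝓝 z) (𝓝 (fund hc z x s)) := by
  obtain ⟨K, hK0, hK⟩ := exists_norm_fundInv_mul_fund_le hc x z
  have h1 : ∀ z' ∈ ball z 1, ‖fundInv hc z x s * fund hc z' x s - 1‖ ≤ K * ‖z' - z‖ :=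
    fun z' hz' => by
    have h := (convex_Icc (0 : ℝ) 1).norm_image_sub_le_of_norm_hasDerivWithin_le
      (fun t _ => (hasDerivAt_fundInv_mul_fund hc z z' x t).hasDerivWithinAt)
      (fun t ht => hK z' hz' t ht) (left_mem_Icc.mpr zero_le_one) hs
    rw [fund_zero, mul_one, ← mul_one (fundInv hc z x 0), ← fund_zero hc z x, fundInv_mul] at h
    refine h.trans (mul_le_of_le_one_right (by positivity) ?_)
    rw [sub_zero, Real.norm_eq_abs, abs_of_nonneg hs.1]
    exact hs.2
  have h2 : Tendsto (fun z' => fundInv hc z x s * fund hc z' x s) (𝓝 z) (𝓝 1) := by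
    refine tendsto_iff_norm_sub_tendsto_zero.mpr ?_
    refine squeeze_zero' (Eventually.of_forall fun _ => norm_nonneg _)
      (eventually_of_mem (ball_mem_nhds z zero_lt_one) h1) ?_
    have : Tendsto (fun z' : ℂ => K * ‖z' - z‖) (𝓝 z) (𝓝 (K * ‖z - z‖)) :=
      (continuous_const.mul (continuous_id.sub continuous_const).norm).tendsto z
    simpa using this
  have h3 := h2.const_mul (fund hc z x s)
  simpa only [← mul_assoc, mul_fundInv, one_mul, mul_one] using h3

theorem differentiable_fund_one (x : Coeffs) : Differentiable ℂ fun z => fund hc z x 1 := by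
  intro z
  obtain ⟨K, hK0, hK⟩ := exists_norm_fundInv_mul_fund_le hc x z
  have hcont : ∀ z', Continuous fun s => fundInv hc z x s
      * (bMat c z' (flow hc x s) - bMat c z (flow hc x s)) * fund hc z' x s := fun z' =>
    ((continuous_fundInv hc z x).mul ((continuous_bMat_flow hc z' x).sub
      (continuous_bMat_flow hc z x))).mul (continuous_fund hc z' x)
  have h0 : ∀ z', fundInv hc z x 0 * fund hc z' x 0 = 1 := fun z' => by
    simp [fundInv]
  have : CompleteSpace Mat := FiniteDimensional.complete ℂ Mat
  have hW := differentiableAt_of_hasDerivAt_time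
    (D := fun s => fundInv hc z x s * deriv (fun w => bMat c w (flow hc x s)) z * fund hc z x s)
    (hasDerivAt_fundInv_mul_fund hc z · x) hcont h0 (fundInv_mul hc z x) hK fun s hs => by
      have h1 := ((hc.rapid.differentiable_bMat (flow hc x s)) z).hasDerivAt.tendsto_slope
      have h2 := (tendsto_fund hc x z hs).mono_left (nhdsWithin_le_nhds (s := ({z}ᶜ : Set ℂ)))
      have h3 := (h1.const_mul (fundInv hc z x s)).mul h2
      refine h3.congr fun z' => ?_
      simp only [slope, vsub_eq_sub, Matrix.mul_smul, Matrix.smul_mul]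
  have h := hW.const_mul (fund hc z x 1)
  simp only [← mul_assoc, mul_fundInv, one_mul] at h
  exact h

theorem fund_one_mem_SLFun (x : Coeffs) : (fun z => fund hc z x 1) ∈ SLFun :=
  ⟨fun i j => (matEntryL i j).differentiable.comp (differentiable_fund_one hc x),
    fun z => det_fund hc z x 1, fun r i j => im_fund hc r x 1 i j⟩

end SL

/-! ### The group `SL` of matrix functions -/

theorem one_mem_SLFun : (fun _ => 1 : MatFun) ∈ SLFun := by
  refine ⟨fun i j => differentiable_const _, fun z => Matrix.det_one, fun x i j => ?_⟩
  fin_cases i <;> fin_cases j <;> simp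

theorem mul_mem_SLFun {S T : MatFun} (hS : S ∈ SLFun) (hT : T ∈ SLFun) :
    (fun z => S z * T z) ∈ SLFun := by
  refine ⟨fun i j => ?_, fun z => ?_, fun x i j => ?_⟩
  · simp only [Matrix.mul_apply, Fin.sum_univ_two]
    exact ((hS.1 i 0).mul (hT.1 0 j)).add ((hS.1 i 1).mul (hT.1 1 j))
  · rw [Matrix.det_mul, hS.2.1, hT.2.1, mul_one]
  · simp [Matrix.mul_apply, Fin.sum_univ_two, hS.2.2, hT.2.2]

theorem inv_mem_SLFun {T : MatFun} (hT : T ∈ SLFun) : (fun z => (T z)⁻¹) ∈ SLFun := by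
  have e : (fun z => (T z)⁻¹) = fun z => !![T z 1 1, -T z 0 1; -T z 1 0, T z 0 0] := by
    funext z
    rw [Matrix.inv_def, hT.2.1, Ring.inverse_one, one_smul, Matrix.adjugate_fin_two]
  rw [e]
  refine ⟨fun i j => ?_, fun z => ?_, fun x i j => ?_⟩
  · fin_cases i <;> fin_cases j
    exacts [hT.1 1 1, (hT.1 0 1).neg, (hT.1 1 0).neg, hT.1 0 0]
  · rw [Matrix.det_fin_two_of, ← hT.2.1 z, Matrix.det_fin_two]
    ring
  · fin_cases i <;> fin_cases j <;> simp [hT.2.2]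

/-! ### The transfer matrices -/

theorem stepMatrix_mem_SLFun (J : JacobiMatrix) : stepMatrix J ∈ SLFun := by
  refine ⟨fun i j => ?_, fun z => ?_, fun x i j => ?_⟩
  · fin_cases i <;> fin_cases j
    exacts [(differentiable_id.sub_const _).div_const _, differentiable_const _,
      differentiable_const _, differentiable_const _]
  · have h : (J.a 1 : ℂ) ≠ 0 := Complex.ofReal_ne_zero.mpr (J.a_pos 1).ne'
    rw [stepMatrix, Matrix.det_fin_two_of]
    field_simp
    ring
  · fin_cases i <;> fin_cases j
    · change (((x : ℂ) - J.b 1) / J.a 1).im = 0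
      rw [← Complex.ofReal_sub, ← Complex.ofReal_div, Complex.ofReal_im]
    · change ((1 : ℂ) / J.a 1).im = 0
      rw [← Complex.ofReal_one, ← Complex.ofReal_div, Complex.ofReal_im]
    · change (-(J.a 1 : ℂ)).im = 0
      simp
    · rfl

theorem isUnit_det_of_mem_SLFun {T : MatFun} (hT : T ∈ SLFun) (z : ℂ) : IsUnit (T z).det := by
  rw [hT.2.1]
  exact isUnit_one

theorem transferNat_mem_SLFun (n : ℕ) (J : JacobiMatrix) : transferNat n J ∈ SLFun := by
  induction n with
  | zero => exact one_mem_SLFun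
  | succ n ih => exact mul_mem_SLFun (stepMatrix_mem_SLFun _) ih

theorem transfer_mem_SLFun (n : ℤ) (J : JacobiMatrix) : transfer n J ∈ SLFun := by
  by_cases h : 0 ≤ n
  · have e : transfer n J = transferNat n.toNat J := funext fun z => if_pos h
    rw [e]
    exact transferNat_mem_SLFun _ _
  · have e : transfer n J = fun z => (transferNat (-n).toNat (J.shift n) z)⁻¹ :=
      funext fun z => if_neg h
    rw [e]
    exact inv_mem_SLFun (transferNat_mem_SLFun _ _)

theorem shift_shift (m n : ℤ) (J : JacobiMatrix) : (J.shift n).shift m = J.shift (m + n) := by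
  ext k <;> simp [JacobiMatrix.shift, add_assoc]

theorem shift_zero (J : JacobiMatrix) : J.shift 0 = J := by
  ext k <;> simp [JacobiMatrix.shift]

theorem transferNat_succ' (n : ℕ) (J : JacobiMatrix) (z : ℂ) :
    transferNat (n + 1) J z = transferNat n (J.shift 1) z * stepMatrix J z := by
  induction n with
  | zero => simp [transferNat, shift_zero]
  | succ n ih =>
    change stepMatrix (J.shift (n + 1 : ℕ)) z * transferNat (n + 1) J z
      = stepMatrix ((J.shift 1).shift n) z * transferNat n (J.shift 1) z * stepMatrix J z
    rw [ih, shift_shift, mul_assoc, Nat.cast_succ]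

theorem transfer_zero (J : JacobiMatrix) (z : ℂ) : transfer 0 J z = 1 := by
  simp [transfer, transferNat]

theorem transfer_add_one (n : ℤ) (J : JacobiMatrix) (z : ℂ) :
    transfer (n + 1) J z = stepMatrix (J.shift n) z * transfer n J z := by
  rcases le_or_gt 0 n with h | h
  · lift n to ℕ using h
    rw [transfer, transfer, if_pos (by positivity), if_pos (by positivity), Int.toNat_natCast,
      Int.toNat_natCast_add_one, transferNat]
  · obtain ⟨m, rfl⟩ : ∃ m : ℕ, n = -(m + 1) := ⟨(-n - 1).toNat, by omega⟩
    have h1 : transfer (-(m + 1 : ℤ)) J z = (transferNat (m + 1) (J.shift (-(m + 1))) z)⁻¹ := by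
      rw [transfer, if_neg (by omega), neg_neg, Int.toNat_natCast_add_one]
    have h2 : transfer (-(m + 1 : ℤ) + 1) J z = (transferNat m (J.shift (-m)) z)⁻¹ := by
      rw [neg_add, neg_add_cancel_right]
      cases m with
      | zero => simp [transfer, transferNat]
      | succ m =>
        rw [transfer, if_neg (by push_cast; omega), neg_neg, Int.toNat_natCast]
    rw [h1, h2, transferNat_succ', shift_shift, Matrix.mul_inv_rev, ← mul_assoc,
      Matrix.mul_nonsing_inv _ (isUnit_det_of_mem_SLFun (stepMatrix_mem_SLFun _) z), one_mul]
    congr 3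
    ring_nf

theorem stepMatrix_mul_cancel {J : JacobiMatrix} {z : ℂ} {M N : Mat}
    (h : stepMatrix J z * M = stepMatrix J z * N) : M = N := by
  have hu := isUnit_det_of_mem_SLFun (stepMatrix_mem_SLFun J) z
  have h' := congrArg ((stepMatrix J z)⁻¹ * ·) h
  simpa only [← mul_assoc, Matrix.nonsing_inv_mul _ hu, one_mul] using h'

theorem transfer_add (m n : ℤ) (J : JacobiMatrix) (z : ℂ) :
    transfer (m + n) J z = transfer m (J.shift n) z * transfer n J z := by
  induction m using Int.induction_on with
  | zero => rw [zero_add, transfer_zero, one_mul]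
  | succ m ih =>
    rw [add_right_comm, transfer_add_one, ih, transfer_add_one, shift_shift, mul_assoc]
  | pred m ih =>
    have h1 := transfer_add_one (-(m : ℤ) - 1) (J.shift n) z
    have h2 := transfer_add_one (-(m : ℤ) - 1 + n) J z
    rw [add_right_comm, sub_add_cancel] at h2
    rw [sub_add_cancel, shift_shift] at h1
    refine stepMatrix_mul_cancel (J := J.shift (-(m : ℤ) - 1 + n)) (z := z) ?_
    rw [← h2, ih, h1, mul_assoc]

/-! ### The action and the cocycle -/

theorem todaMap_shift (f : RealEntire) (n : ℤ) (J : JacobiMatrix) :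
    todaMap f (J.shift n) = (todaMap f J).shift n := by
  refine JacobiMatrix.toCoeffs_injective ?_
  rw [toCoeffs_todaMap, toCoeffs_shift, toCoeffs_shift, toCoeffs_todaMap, flow_shiftL]

theorem todaMap_add (f g : RealEntire) (J : JacobiMatrix) :
    todaMap (f + g) J = todaMap f (todaMap g J) := by
  refine JacobiMatrix.toCoeffs_injective ?_
  rw [toCoeffs_todaMap, toCoeffs_todaMap, toCoeffs_todaMap]
  exact flow_add (realRapid f) (realRapid g) (realRapid (f + g)) (taylorCoeff_add f g) _ _

theorem todaMap_zero (J : JacobiMatrix) : todaMap 0 J = J := by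
  refine JacobiMatrix.toCoeffs_injective ?_
  have h := toCoeffs_todaMap_smul 0 0 J
  rwa [zero_smul, flow_zero] at h

theorem isAction_act : IsAction act where
  zero J := by
    change todaMap 0 (J.shift 0) = J
    rw [shift_zero, todaMap_zero]
  add g h J := by
    change todaMap (g.1 + h.1) (J.shift (g.2 + h.2))
      = todaMap g.1 ((todaMap h.1 (J.shift h.2)).shift g.2)
    rw [todaMap_add, ← shift_shift, todaMap_shift h.1 g.2]

theorem isTodaCocycleSolution_fund (f : RealEntire) (J : JacobiMatrix) :
    IsTodaCocycleSolution f J fun t z => fund (realRapid f) z J.toCoeffs t where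
  initial z := fund_zero _ _ _
  ode z t := by
    rw [bMatrix_eq, toCoeffs_todaMap_smul]
    exact hasDerivAt_matrix_entry (hasDerivAt_fund (realRapid f) z J.toCoeffs t)

theorem IsTodaCocycleSolution.eq_fund {f : RealEntire} {J : JacobiMatrix} {T : ℝ → MatFun}
    (h : IsTodaCocycleSolution f J T) : T = fun t z => fund (realRapid f) z J.toCoeffs t := by
  funext t z
  have h1 := fund_unique (realRapid f) (z := z) (x := J.toCoeffs) (Y := fun t => T t z) (fun t => by
    have h2 := h.ode z t
    rw [bMatrix_eq, toCoeffs_todaMap_smul] at h2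
    exact hasDerivAt_matrix h2) t
  rwa [h.initial, mul_one] at h1

theorem todaCocycle_eq (f : RealEntire) (J : JacobiMatrix) (z : ℂ) :
    todaCocycle f J z = fund (realRapid f) z J.toCoeffs 1 := by
  have h : ∃ T, IsTodaCocycleSolution f J T := ⟨_, isTodaCocycleSolution_fund f J⟩
  rw [todaCocycle, dif_pos h]
  exact congrFun (congrFun h.choose_spec.eq_fund 1) z

theorem todaCocycle_add (f g : RealEntire) (J : JacobiMatrix) (z : ℂ) :
    todaCocycle (f + g) J z = todaCocycle f (todaMap g J) z * todaCocycle g J z := by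
  rw [todaCocycle_eq, todaCocycle_eq, todaCocycle_eq, toCoeffs_todaMap]
  exact fund_add (realRapid f) (realRapid g) (realRapid (f + g)) (taylorCoeff_add f g) _ _ _

theorem todaCocycle_mul_stepMatrix (f : RealEntire) (J : JacobiMatrix) (z : ℂ) :
    todaCocycle f (J.shift 1) z * stepMatrix J z
      = stepMatrix (todaMap f J) z * todaCocycle f J z := by
  rw [todaCocycle_eq, todaCocycle_eq, stepMatrix_eq, stepMatrix_eq, toCoeffs_todaMap,
    toCoeffs_shift]
  exact fund_mul_stepMat (realRapid f) z (J.a_pos 1) 1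

/-- The cocycle relation between a flow and a shift; the steps to negative `n` are those to positive
`n`, read backwards. -/
theorem todaCocycle_mul_transfer (f : RealEntire) (n : ℤ) (J : JacobiMatrix) (z : ℂ) :
    todaCocycle f (J.shift n) z * transfer n J z
      = transfer n (todaMap f J) z * todaCocycle f J z := by
  induction n using Int.induction_on with
  | zero => rw [shift_zero, transfer_zero, transfer_zero, one_mul, mul_one]
  | succ n ih =>
    rw [transfer_add_one, transfer_add_one, add_comm (n : ℤ) 1, ← shift_shift, ← mul_assoc,
      todaCocycle_mul_stepMatrix, todaMap_shift, mul_assoc, ih, mul_assoc]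
  | pred n ih =>
    have h1 := transfer_add_one (-(n : ℤ) - 1) J z
    have h2 := transfer_add_one (-(n : ℤ) - 1) (todaMap f J) z
    have h3 := todaCocycle_mul_stepMatrix f (J.shift (-(n : ℤ) - 1)) z
    rw [sub_add_cancel] at h1 h2
    rw [shift_shift, add_sub_cancel, todaMap_shift] at h3
    refine stepMatrix_mul_cancel (J := (todaMap f J).shift (-(n : ℤ) - 1)) (z := z) ?_
    rw [← mul_assoc, ← h3, mul_assoc, ← h1, ih, h2, mul_assoc]

theorem isCocycle_jointCocycle : IsCocycle act jointCocycle where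
  mem g J := by
    have e : todaCocycle g.1 (J.shift g.2) ∈ SLFun := by
      rw [funext (todaCocycle_eq g.1 (J.shift g.2))]
      exact fund_one_mem_SLFun (realRapid g.1) _
    exact mul_mem_SLFun e (transfer_mem_SLFun g.2 J)
  add g h J z := by
    change todaCocycle (g.1 + h.1) (J.shift (g.2 + h.2)) z * transfer (g.2 + h.2) J z
      = todaCocycle g.1 ((todaMap h.1 (J.shift h.2)).shift g.2) z
          * transfer g.2 (todaMap h.1 (J.shift h.2)) z
        * (todaCocycle h.1 (J.shift h.2) z * transfer h.2 J z)
    rw [todaCocycle_add, transfer_add, ← shift_shift, todaMap_shift]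
    have h1 := todaCocycle_mul_transfer h.1 g.2 (J.shift h.2) z
    rw [mul_assoc, mul_assoc, ← mul_assoc (todaCocycle h.1 _ z) (transfer g.2 _ z), h1, mul_assoc]

theorem hasDerivAt_stepMatrix_todaMap (f : RealEntire) (J : JacobiMatrix) (z : ℂ) (i j : Fin 2) :
    HasDerivAt (fun t : ℝ => stepMatrix (todaMap (t • f) J) z i j)
      ((bMatrix f (J.shift 1) z * stepMatrix J z - stepMatrix J z * bMatrix f J z) i j) 0 := by
  have hx := hasDerivAt_flow (realRapid f) J.toCoeffs 0
  have h := (realRapid f).hasDerivAt_stepMat z hx (by rw [flow_zero]; exact (J.a_pos 1).ne')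
  rw [flow_zero] at h
  have h' := hasDerivAt_matrix_entry h i j
  rw [bMatrix_eq, bMatrix_eq]
  simp only [stepMatrix_eq, toCoeffs_todaMap_smul]
  exact h'

end Toda

end

theorem theorem3p3 :
    (∀ (f : Toda.RealEntire) (J : Toda.JacobiMatrix),
      Toda.IsLaxSolution f J (fun t => Toda.todaMap (t • f) J) ∧
      (∃! γ : ℝ → Toda.JacobiMatrix, Toda.IsLaxSolution f J γ) ∧
      (∃! T : ℝ → Toda.MatFun, Toda.IsTodaCocycleSolution f J T)) ∧
    Toda.IsAction Toda.act ∧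
    Toda.IsCocycle Toda.act Toda.jointCocycle ∧
    (∀ (f : Toda.RealEntire) (J : Toda.JacobiMatrix) (z : ℂ) (i j : Fin 2),
      HasDerivAt (fun t : ℝ => Toda.stepMatrix (Toda.todaMap (t • f) J) z i j)
        ((Toda.bMatrix f (J.shift 1) z * Toda.stepMatrix J z
          - Toda.stepMatrix J z * Toda.bMatrix f J z) i j) 0) := by
  refine ⟨fun f J => ⟨?_, ?_, ?_⟩, Toda.isAction_act, Toda.isCocycle_jointCocycle,
    Toda.hasDerivAt_stepMatrix_todaMap⟩
  · rw [Toda.todaMap_smul]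
    exact Toda.isLaxSolution_todaCurve f J
  · exact ⟨_, Toda.isLaxSolution_todaCurve f J, fun γ h => h.eq_todaCurve⟩
  · exact ⟨_, Toda.isTodaCocycleSolution_fund f J, fun T h => h.eq_fund⟩
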